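/- **Setting.** Let $V$ be a finite set with $|V|=n\ge 2$, and let $\Omega=\{\eta\in[0,\infty)^V:\sum_{x}\eta_x=1\}$. For $x,y\in V$ let $\beta_{xy}$ be a Borel measure on $[0,1]^2$ (possibly infinite), with $\beta_{xx}=0$ and $\int \{(1-u)+(1-v)\}\,\beta_{xy}(du,dv)<\infty$. For $x\ne y$ let $\eta R^{uv}_{xy}$ be obtained from $\eta$ by replacing $(\eta_x,\eta_y)$ with $(u\eta_x+(1-v)\eta_y,\,(1-u)\eta_x+v\eta_y)$. Let $\mathscr P$ be the space of restrictions to $\Omega$ of complex polynomials in $(\eta_x)_{x\in V}$, and for $f\in\mathscr P$ let $$\mathcal L f(\eta)=\sum_{x,y\in V}\int_{[0,1]^2}\beta_{xy}(du,dv)\,\{f(\eta R^{uv}_{xy})-f(\eta)\}.$$ Write $\bar\beta_{xy}(du,dv)=\beta_{xy}(du,dv)+\beta_{yx}(dv,du)$ and, for $x\neq y$, $r_{xy}=\int\bar\beta_{xy}(du,dv)(1-u)$ and $s_{xy}=\int\bar\beta_{xy}(du,dv)\,u(1-u)$. Assume that any $x,y\in V$ are joined by a path $x=x_0,x_1,\dots,x_m=y$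 with $m\ge 1$, $x_{i}\ne x_{i+1}$ and $s_{x_ix_{i+1}}>0$ for all $i$. Given a probability vector $\pi$ on $V$, put for $x\ne y$ $$\pi_{xy}=\tfrac12(\pi_xr_{xy}+\pi_yr_{yx}),\quad \chi_{xy}=\int\bar\beta_{xy}(du,dv)\,(\pi_x u(1-u)+\pi_y v(1-v)),\quad \sigma_{xy}=\int\bar\beta_{xy}(du,dv)\,(\pi_x(1-u)-\pi_y(1-v))^2,$$ $$\gamma(\mathcal L)=\min_{x\ne y:\ \pi_{xy}>0}\frac{\chi_{xy}+\sigma_{xy}}{\pi_{xy}},\qquad \mathrm{gap}_{\rm RW}(\mathcal L)=\inf\Big\{\tfrac12\sum_{x\neq y}\pi_{xy}(\psi(y)-\psi(x))^2:\ \psi\in\mathbb R^V,\ \sum_x\pi_x\big(\psi(x)-\textstyle\sum_y\pi_y\psi(y)\big)^2=1\Big\}.$$ **Theorem (Reversible).** Let $\alpha_x>0$ for $x\in V$, let $\mu={\rm Dir}(\alpha)$ be the Dirichlet distribution on $\Omega$, and assume that $\mathcal L|_{\mathscr P}$ is symmetric in $L^2(\mu)=L^2(\mu;\mathbb C)$,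 i.e. $\int \bar f\,\mathcal Lg\,d\mu=\int\overline{\mathcal Lf}\,g\,d\mu$ for all $f,g\in\mathscr P$. Then there is a unique probability vector $\pi$ on $V$ with $\sum_{y\ne x}\pi_yr_{yx}=\pi_x\sum_{y\ne x}r_{xy}$ for all $x$ and, for this $\pi$, the following holds. 1. The closure in $L^2(\mu)\times L^2(\mu)$ of the graph of $-\mathcal L|_{\mathscr P}$ is the graph of a self-adjoint operator $A$. Its spectrum is contained in $[0,\infty)$ and is pure-point: $L^2(\mu)$ has a complete orthonormal system $(f_i)$ of polynomials satisfying $-\mathcal Lf_i=\lambda_if_i$ on $\Omega$ with $\lambda_i\ge 0$, the set of eigenvalues of $A$ is $\{\lambda_i\}$, and the spectrum of $A$ is the closure of this set. The smallest eigenvalue is $0$, and it is simple. 2. There is a smallest strictly positive eigenvalue $\mathrm{gap}(\mathcal L)$ of $A$ (the second smallest eigenvalue), and $$(1\wedge\gamma(\mathcal L))\,\mathrm{gap}_{\rm RW}(\mathcal L)\ \le\ \mathrm{gap}(\mathcal L)\ \le\ \mathrm{gap}_{\rm RW}(\mathcal L).$$ -/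

import Mathlib

open MeasureTheory
open scoped ENNReal

noncomputable section

namespace ExchangeModel

variable {V : Type*} [DecidableEq V]

/-! ### Configuration space, polynomials and the generator -/

/-- The probability simplex of unit-mass configurations on `V`. -/
abbrev Simplex (V : Type*) [Fintype V] : Type _ := stdSimplex ℝ V

/-- The unit square, in which the pair `(u, v)` of update fractions lives. -/
abbrev Square : Type := unitInterval × unitInterval

/-- The update `η ↦ η R_{xy}^{uv}`. For `x ≠ y` it replaces `(η x, η y)` by
`(u η x + (1 - v) η y, (1 - u) η x + v η y)` and leaves the other coordinates unchanged
(see `exchangeVec_left`, `exchangeVec_right`, `exchangeVec_other`); for `x = y` it is the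
identity. -/
def exchangeVec (x y : V) (p : Square) (η : V → ℝ) : V → ℝ :=
  η + ((1 - (p.2 : ℝ)) * η y - (1 - (p.1 : ℝ)) * η x) • (Pi.single x 1 - Pi.single y 1)

theorem exchangeVec_left {x y : V} (h : x ≠ y) (p : Square) (η : V → ℝ) :
    exchangeVec x y p η x = (p.1 : ℝ) * η x + (1 - (p.2 : ℝ)) * η y := by
  simp [exchangeVec, h]; ring

theorem exchangeVec_right {x y : V} (h : x ≠ y) (p : Square) (η : V → ℝ) :
    exchangeVec x y p η y = (1 - (p.1 : ℝ)) * η x + (p.2 : ℝ) * η y := by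
  simp [exchangeVec, h.symm]; ring

theorem exchangeVec_other {x y z : V} (hx : z ≠ x) (hy : z ≠ y) (p : Square) (η : V → ℝ) :
    exchangeVec x y p η z = η z := by
  simp [exchangeVec, hx, hy]

variable [Fintype V]

theorem exchangeVec_mem (x y : V) (p : Square) {η : V → ℝ} (hη : η ∈ stdSimplex ℝ V) :
    exchangeVec x y p η ∈ stdSimplex ℝ V := by
  obtain ⟨h0, h1⟩ := hη
  have hu0 := p.1.2.1
  have hu1 := p.1.2.2
  have hv0 := p.2.2.1
  have hv1 := p.2.2.2
  refine ⟨fun z => ?_, ?_⟩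
  · by_cases hxy : x = y
    · subst hxy; simpa [exchangeVec] using h0 z
    by_cases hzx : z = x
    · subst hzx; rw [exchangeVec_left hxy]
      have := mul_nonneg hu0 (h0 z)
      have := mul_nonneg (sub_nonneg.2 hv1) (h0 y)
      linarith
    by_cases hzy : z = y
    · subst hzy; rw [exchangeVec_right hxy]
      have := mul_nonneg hv0 (h0 z)
      have := mul_nonneg (sub_nonneg.2 hu1) (h0 x)
      linarith
    rw [exchangeVec_other hzx hzy]; exact h0 z
  · simp [exchangeVec, Finset.sum_add_distrib, ← Finset.mul_sum, Finset.sum_sub_distrib, h1]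

/-- The update as a map of the simplex into itself. -/
def exchange (x y : V) (p : Square) (η : Simplex V) : Simplex V :=
  ⟨exchangeVec x y p η, exchangeVec_mem x y p η.2⟩

/-- The formal generator
`𝓛 f(η) = ∑_{x,y} ∫ β_{xy}(du, dv) (f(η R_{xy}^{uv}) - f(η))`. -/
def generator (β : V → V → Measure Square) (f : Simplex V → ℂ) (η : Simplex V) : ℂ :=
  ∑ x, ∑ y, ∫ p, (f (exchange x y p η) - f η) ∂(β x y)

/-- `f` is (the restriction to the simplex of) a polynomial with complex coefficients. -/
def IsPolynomial (f : Simplex V → ℂ) : Prop :=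
  ∃ P : MvPolynomial V ℂ, ∀ η : Simplex V, f η = MvPolynomial.eval (fun x => ((η.1 x : ℝ) : ℂ)) P

/-- Standing integrability assumption on the exchange measures: `β_{xx} = 0` and
`∫ ((1 - u) + (1 - v)) dβ_{xy} < ∞`. The measures themselves may be infinite. -/
def Admissible (β : V → V → Measure Square) : Prop :=
  (∀ x, β x x = 0) ∧
    ∀ x y, ∫⁻ p, ENNReal.ofReal ((1 - (p.1 : ℝ)) + (1 - (p.2 : ℝ))) ∂(β x y) < ∞

/-! ### The random walk and the constants `gap_RW` and `γ` -/

/-- The measure `β_{xy}(du, dv) + β_{yx}(dv, du)`. -/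
def symMeasure (β : V → V → Measure Square) (x y : V) : Measure Square :=
  β x y + (β y x).map Prod.swap

/-- The rates `r_{xy}` of the random walk, for `x ≠ y`. -/
def rate (β : V → V → Measure Square) (x y : V) : ℝ :=
  ∫ p, (1 - (p.1 : ℝ)) ∂(symMeasure β x y)

/-- The second-order rates `s_{xy}`, for `x ≠ y`. -/
def rate₂ (β : V → V → Measure Square) (x y : V) : ℝ :=
  ∫ p, (p.1 : ℝ) * (1 - (p.1 : ℝ)) ∂(symMeasure β x y)

/-- Any two vertices are joined by a path along which all second-order rates are positive. -/
def Irreducible₂ (β : V → V → Measure Square) : Prop :=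
  ∀ x y, Relation.TransGen (fun a b => a ≠ b ∧ 0 < rate₂ β a b) x y

/-- `π` is an invariant probability vector of the random walk with rates `r`. -/
def IsInvariantVector (β : V → V → Measure Square) (π : V → ℝ) : Prop :=
  (∀ x, 0 ≤ π x) ∧ ∑ x, π x = 1 ∧
    ∀ x, ∑ y ∈ Finset.univ.erase x, π y * rate β y x
      = π x * ∑ y ∈ Finset.univ.erase x, rate β x y

/-- The symmetrized edge weights `π_{xy} = (π_x r_{xy} + π_y r_{yx}) / 2`, for `x ≠ y`. -/
def edgeWeight (β : V → V → Measure Square) (π : V → ℝ) (x y : V) : ℝ :=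
  (π x * rate β x y + π y * rate β y x) / 2

/-- The Dirichlet form of the random walk. -/
def rwForm (β : V → V → Measure Square) (π : V → ℝ) (ψ : V → ℝ) : ℝ :=
  (1 / 2) * ∑ x, ∑ y, edgeWeight β π x y * (ψ y - ψ x) ^ 2

/-- The variance `‖ψ - πψ‖²` in `L²(π)`. -/
def rwVar (π : V → ℝ) (ψ : V → ℝ) : ℝ :=
  ∑ x, π x * (ψ x - ∑ y, π y * ψ y) ^ 2

/-- The spectral gap of the random walk. -/
def gapRW (β : V → V → Measure Square) (π : V → ℝ) : ℝ :=
  sInf {t : ℝ | ∃ ψ : V → ℝ, rwVar π ψ = 1 ∧ t = rwForm β π ψ}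

/-- The quantities `χ_{xy}`, for `x ≠ y`. -/
def chi (β : V → V → Measure Square) (π : V → ℝ) (x y : V) : ℝ :=
  ∫ p, (π x * ((p.1 : ℝ) * (1 - (p.1 : ℝ))) + π y * ((p.2 : ℝ) * (1 - (p.2 : ℝ))))
    ∂(symMeasure β x y)

/-- The quantities `σ_{xy}`, for `x ≠ y`. -/
def sigma (β : V → V → Measure Square) (π : V → ℝ) (x y : V) : ℝ :=
  ∫ p, (π x * (1 - (p.1 : ℝ)) - π y * (1 - (p.2 : ℝ))) ^ 2 ∂(symMeasure β x y)

/-- The constant `γ(𝓛)`: a minimum over the (finitely many) pairs `x ≠ y` with `π_{xy} > 0`. -/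
def gammaConst (β : V → V → Measure Square) (π : V → ℝ) : ℝ :=
  sInf {t : ℝ | ∃ x y : V, x ≠ y ∧ 0 < edgeWeight β π x y ∧
    t = (chi β π x y + sigma β π x y) / edgeWeight β π x y}

/-! ### The Dirichlet distribution -/

/-- The uniform measure `dη` on the simplex, of total mass `1 / (n - 1)!` with `n = |V|` (that is,
Lebesgue measure in any `n - 1` of the coordinates), written as a cone measure: the mass of `A` is
`n` times the Lebesgue measure of `{t η : η ∈ A, 0 < t ≤ 1}`. -/
def uniformMeasure (V : Type*) [Fintype V] : Measure (Simplex V) :=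
  (Fintype.card V : ℝ≥0∞) •
    (((volume : Measure (V → ℝ)).restrict
        {w | (∀ x, 0 ≤ w x) ∧ 0 < ∑ x, w x ∧ ∑ x, w x ≤ 1}).map
      (fun w => (∑ x, w x)⁻¹ • w)).comap Subtype.val

/-- The Dirichlet distribution `Dir(α)`. -/
def dirichlet (α : V → ℝ) : Measure (Simplex V) :=
  (uniformMeasure V).withDensity fun η =>
    ENNReal.ofReal (Real.Gamma (∑ x, α x) / (∏ x, Real.Gamma (α x)) *
      ∏ x, (η.1 x) ^ (α x - 1))

/-! ### Operators on `L²` -/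

/-- The generator, restricted to polynomials, is symmetric in `L²(μ)`. -/
def SymmetricOnPolynomials (β : V → V → Measure Square) (μ : Measure (Simplex V)) : Prop :=
  ∀ f g : Simplex V → ℂ, IsPolynomial f → IsPolynomial g →
    ∫ η, (starRingEnd ℂ) (f η) * generator β g η ∂μ
      = ∫ η, (starRingEnd ℂ) (generator β f η) * g η ∂μ

/-- The graph, in `L²(μ) × L²(μ)`, of `-𝓛` restricted to polynomials. -/
def polynomialGraph (β : V → V → Measure Square) (μ : Measure (Simplex V)) :
    Set (Lp ℂ 2 μ × Lp ℂ 2 μ) :=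
  {FG | ∃ f : Simplex V → ℂ, IsPolynomial f ∧ FG.1 =ᵐ[μ] f ∧
    FG.2 =ᵐ[μ] fun η => -generator β f η}

section Operators

variable {H : Type*} [NormedAddCommGroup H] [NormedSpace ℂ H]

/-- The set of eigenvalues of an unbounded operator. -/
def eigenvalues (A : H →ₗ.[ℂ] H) : Set ℂ :=
  {z | ∃ f : A.domain, (f : H) ≠ 0 ∧ A f = z • (f : H)}

/-- The spectrum of an unbounded operator: `z` is outside of it exactly if `A - z` has a bounded,
everywhere defined two-sided inverse. -/
def unboundedSpectrum (A : H →ₗ.[ℂ] H) : Set ℂ :=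
  {z | ¬ ∃ R : H →L[ℂ] H,
    (∀ h : H, ∃ hR : R h ∈ A.domain, A ⟨R h, hR⟩ - z • R h = h) ∧
      ∀ f : A.domain, R (A f - z • (f : H)) = f}

end Operators

end ExchangeModel

end

open ExchangeModel

/-!
The generator does not raise degrees: on a product of linear forms `η ↦ ∏ j, ⟨χ j, η⟩` it acts by
letting the exchanges act on the coefficient functions `χ j : V → ℝ` simultaneously
(`functional_generator_prodLin`). Being symmetric in `L²(μ)`, it therefore has an orthonormal basis
of polynomial eigenfunctions adapted to the filtration by degree (`exists_polyEigenbasis`;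
polynomials are dense by Stone-Weierstrass). The closure of its graph is the graph of the diagonal
operator in this basis, whose spectral theory is elementary (`diagOp`). An eigenvalue `ev i` equals
half the integral of the carré du champ of the eigenfunction, so it is nonnegative, and if it
vanishes, the eigenfunction is invariant under almost all exchanges, hence constant: a single
exchange with `0 < u < 1` contracts along its edge, and the edges connect `V`
(`poly_mem_zero_of_ev_eq_zero`).

The invariant vector is the mean `π = α / ∑ α` of the Dirichlet distribution. On linear forms the
generator acts as the random walk generator. The Rayleigh quotients of linear forms, computed from
the second moments of the Dirichlet distribution, give `gap ≤ gapRW` (`PolyEigenbasis.le_gapRW`),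
and the eigenvalues of degree one are at least `gapRW` (`PolyEigenbasis.gapRW_le_ev`).

In degree `k ≥ 2` the lower bound comes from a maximum principle (`IsLyapunov.le_rate`). Let `Λ` be
integration against an eigenfunction of degree `k`; it vanishes on polynomials of lower degree, so
`G(ψ, χ) = Λ(⟨ψ, ·⟩² ∏ j, ⟨χ j, ·⟩)` is a quadratic form in `ψ` modulo constants. The exchanges
preserve the cube of functions `χ j` with values in `[0, 1]`. If `W` is a positive quadratic form
modulo constants that decreases at rate at least `c` under the exchanges, then evaluating the
eigenvalue equation where `|G| / W` is maximal shows `c ≤ ev i`. The variance `rwVar π` is such a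
form with `c = γ * gapRW` (`sum_integral_rwVar_act_le`), by an explicit computation of the second
order terms.

That a smallest positive eigenvalue exists does not follow from this bound, as `γ` may vanish and
the spectrum of the higher degrees may accumulate. It follows from the same maximum principle
applied to a resolvent in degree two: if `S` is a positive form, here the sum of the second
differences of `⟨ψ, ·⟩²` between vertices of the simplex, then `W = (-L - t)⁻¹ S` decreases at rate
at least `t`, and it is positive for `0 ≤ t` below the smallest eigenvalue of degree two
(`isLyapunov_resolventForm`). Hence no eigenvalue of higher degree lies below the smallest one of
degree two (`exists_level_two_min`).
-/

set_option linter.unusedSectionVars false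

noncomputable section

namespace ExchangeModel

/-! ### Functions of the exchange fractions -/

/-- The defect `(1 - u) + (1 - v)` of a pair of exchange fractions. -/
def defect (p : Square) : ℝ := (1 - (p.1 : ℝ)) + (1 - (p.2 : ℝ))

theorem defect_nonneg (p : Square) : 0 ≤ defect p :=
  add_nonneg (sub_nonneg.2 p.1.2.2) (sub_nonneg.2 p.2.2.2)

theorem continuous_defect : Continuous defect := by
  unfold defect
  fun_prop

/-- A continuous function on the square whose increments from the corner `(1, 1)` are controlled
by the defect. Such increments are integrable for every admissible exchange measure, although the
measure itself may be infinite. -/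
def Tame (φ : Square → ℝ) : Prop :=
  Continuous φ ∧ ∃ C : ℝ, ∀ p, |φ p - φ 1| ≤ C * defect p

namespace Tame

theorem const (c : ℝ) : Tame fun _ => c := ⟨continuous_const, 0, by simp⟩

theorem fst : Tame fun p => (p.1 : ℝ) := by
  refine ⟨by fun_prop, 1, fun p => ?_⟩
  have h := p.1.2.2
  have h' := p.2.2.2
  have : ((1 : Square).1 : ℝ) = 1 := rfl
  simp only [this]
  rw [abs_sub_comm, abs_of_nonneg (by linarith)]
  unfold defect
  linarith

theorem snd : Tame fun p => (p.2 : ℝ) := by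
  refine ⟨by fun_prop, 1, fun p => ?_⟩
  have h := p.1.2.2
  have h' := p.2.2.2
  have : ((1 : Square).2 : ℝ) = 1 := rfl
  simp only [this]
  rw [abs_sub_comm, abs_of_nonneg (by linarith)]
  unfold defect
  linarith

theorem add {φ ψ : Square → ℝ} (hφ : Tame φ) (hψ : Tame ψ) : Tame fun p => φ p + ψ p := by
  obtain ⟨hφ, C, hC⟩ := hφ
  obtain ⟨hψ, D, hD⟩ := hψ
  refine ⟨hφ.add hψ, C + D, fun p => ?_⟩
  calc |φ p + ψ p - (φ 1 + ψ 1)| = |(φ p - φ 1) + (ψ p - ψ 1)| := by ring_nf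
    _ ≤ |φ p - φ 1| + |ψ p - ψ 1| := abs_add_le _ _
    _ ≤ (C + D) * defect p := by linarith [hC p, hD p]

theorem mul {φ ψ : Square → ℝ} (hφ : Tame φ) (hψ : Tame ψ) : Tame fun p => φ p * ψ p := by
  obtain ⟨hφ, C, hC⟩ := hφ
  obtain ⟨hψ, D, hD⟩ := hψ
  obtain ⟨B, hB⟩ := isCompact_univ.exists_bound_of_continuousOn hψ.continuousOn
  refine ⟨hφ.mul hψ, C * B + |φ 1| * D, fun p => ?_⟩
  have hB' : |ψ p| ≤ B := hB p trivial
  calc |φ p * ψ p - φ 1 * ψ 1| = |(φ p - φ 1) * ψ p + φ 1 * (ψ p - ψ 1)| := by ring_nf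
    _ ≤ |φ p - φ 1| * |ψ p| + |φ 1| * |ψ p - ψ 1| := by
        rw [← abs_mul, ← abs_mul]; exact abs_add_le _ _
    _ ≤ (C * defect p) * B + |φ 1| * (D * defect p) := by
        have h0 : 0 ≤ |φ p - φ 1| := abs_nonneg _
        exact add_le_add (mul_le_mul (hC p) hB' (abs_nonneg _) (h0.trans (hC p)))
          (mul_le_mul_of_nonneg_left (hD p) (abs_nonneg _))
    _ = _ := by ring

theorem neg {φ : Square → ℝ} (hφ : Tame φ) : Tame fun p => -φ p := by
  simpa using (const (-1)).mul hφ

theorem sub {φ ψ : Square → ℝ} (hφ : Tame φ) (hψ : Tame ψ) : Tame fun p => φ p - ψ p := by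
  simpa [sub_eq_add_neg] using hφ.add hψ.neg

theorem pow {φ : Square → ℝ} (hφ : Tame φ) (n : ℕ) : Tame fun p => φ p ^ n := by
  induction n with
  | zero => simpa using const 1
  | succ n ih => simpa [pow_succ] using ih.mul hφ

theorem sum {ι : Type*} (s : Finset ι) {φ : ι → Square → ℝ} (hφ : ∀ i, Tame (φ i)) :
    Tame fun p => ∑ i ∈ s, φ i p := by
  classical
  induction s using Finset.induction_on with
  | empty => simpa using const 0
  | insert a s ha ih => simpa [Finset.sum_insert ha] using (hφ a).add ih

theorem prod {ι : Type*} (s : Finset ι) {φ : ι → Square → ℝ} (hφ : ∀ i, Tame (φ i)) :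
    Tame fun p => ∏ i ∈ s, φ i p := by
  classical
  induction s using Finset.induction_on with
  | empty => simpa using const 1
  | insert a s ha ih => simpa [Finset.prod_insert ha] using (hφ a).mul ih

end Tame

section Integrability

variable {V : Type*} [DecidableEq V] [Fintype V] {β : V → V → Measure Square}

theorem Admissible.integrable_defect (hβ : Admissible β) (x y : V) :
    Integrable defect (β x y) := by
  refine ⟨continuous_defect.aestronglyMeasurable, ?_⟩
  rw [hasFiniteIntegral_iff_ofReal (Filter.Eventually.of_forall defect_nonneg)]
  exact hβ.2 x y

theorem Tame.integrable {φ : Square → ℝ} (hφ : Tame φ) {ν : Measure Square}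
    (hν : Integrable defect ν) {c : ℝ} (hc : φ 1 = c) : Integrable (fun p => φ p - c) ν := by
  subst hc
  obtain ⟨h, C, hC⟩ := hφ
  refine (hν.const_mul C).mono' (h.sub continuous_const).aestronglyMeasurable ?_
  exact Filter.Eventually.of_forall hC

/-- A tame function vanishing at the corner `(1, 1)` is integrable. -/
theorem Tame.integrable_of_zero {φ : Square → ℝ} (hφ : Tame φ) {ν : Measure Square}
    (hν : Integrable defect ν) (hc : φ 1 = 0) : Integrable φ ν := by
  simpa using hφ.integrable hν hc

end Integrability

/-! ### The dual action on functions and products of linear forms -/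

section Polynomials

variable {V : Type*} [DecidableEq V]

/-- The transpose of `η ↦ η R_{xy}^{uv}`, acting on functions `χ : V → ℝ` (see `sum_act`): each of
the two values `χ x`, `χ y` is replaced by an average of both. -/
def act (x y : V) (p : Square) (χ : V → ℝ) : V → ℝ :=
  χ + (χ y - χ x) • ((1 - (p.1 : ℝ)) • Pi.single x 1 - (1 - (p.2 : ℝ)) • Pi.single y 1)

theorem act_one (x y : V) (χ : V → ℝ) : act x y 1 χ = χ := by
  ext z
  simp [act]

theorem tame_act (x y z : V) (χ : V → ℝ) : Tame fun p => act x y p χ z := by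
  simp only [act, Pi.add_apply, Pi.smul_apply, Pi.sub_apply, smul_eq_mul]
  exact (Tame.const _).add ((Tame.const _).mul
    ((((Tame.const 1).sub Tame.fst).mul (Tame.const _)).sub
      (((Tame.const 1).sub Tame.snd).mul (Tame.const _))))

theorem act_swap (x y : V) (p : Square) (χ : V → ℝ) : act y x p.swap χ = act x y p χ := by
  ext z
  simp [act]
  ring

variable [Fintype V]

theorem sum_act (x y : V) (p : Square) (χ η : V → ℝ) :
    ∑ z, χ z * exchangeVec x y p η z = ∑ z, act x y p χ z * η z := by
  simp only [exchangeVec, act, Pi.add_apply, Pi.smul_apply, Pi.sub_apply, smul_eq_mul, mul_add,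
    add_mul, Finset.sum_add_distrib, mul_sub, sub_mul, Finset.sum_sub_distrib, Pi.single_apply,
    mul_ite, ite_mul, mul_one, mul_zero, zero_mul, Finset.sum_ite_eq', Finset.mem_univ, if_true]
  ring

theorem continuous_coord (x : V) : Continuous fun η : Simplex V => η.1 x :=
  (continuous_apply x).comp continuous_subtype_val

theorem continuous_complex_coord :
    Continuous fun (η : Simplex V) (x : V) => ((η.1 x : ℝ) : ℂ) :=
  continuous_pi fun x => Complex.continuous_ofReal.comp (continuous_coord x)

/-- The linear form `η ↦ ∑ χ z η z`, as a complex-valued continuous function on the simplex. -/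
def lin (χ : V → ℝ) : C(Simplex V, ℂ) where
  toFun η := ((∑ z, χ z * η.1 z : ℝ) : ℂ)
  continuous_toFun := Complex.continuous_ofReal.comp
    (continuous_finsetSum _ fun x _ => continuous_const.mul (continuous_coord x))

theorem lin_apply (χ : V → ℝ) (η : Simplex V) : lin χ η = ((∑ z, χ z * η.1 z : ℝ) : ℂ) := rfl

theorem lin_exchange (x y : V) (p : Square) (χ : V → ℝ) (η : Simplex V) :
    lin χ (exchange x y p η) = lin (act x y p χ) η := by
  rw [lin_apply, lin_apply, ← sum_act]
  rfl

theorem lin_add (χ χ' : V → ℝ) : lin (χ + χ') = lin χ + lin χ' := by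
  ext η
  simp [lin_apply, add_mul, Finset.sum_add_distrib]

theorem lin_smul (c : ℝ) (χ : V → ℝ) : lin (c • χ) = (c : ℂ) • lin χ := by
  ext η
  simp [lin_apply, Finset.mul_sum, mul_assoc]

theorem lin_const (c : ℝ) : lin (fun _ : V => c) = (c : ℂ) • 1 := by
  ext η
  simp only [lin_apply, ← Finset.mul_sum, ContinuousMap.smul_apply, ContinuousMap.one_apply]
  rw [η.2.2]
  simp

theorem lin_single (x : V) (η : Simplex V) : lin (Pi.single x 1) η = ((η.1 x : ℝ) : ℂ) := by
  simp [lin_apply, Pi.single_apply]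

theorem lin_eq_sum (χ : V → ℝ) : lin χ = ∑ x, (χ x : ℂ) • lin (Pi.single x 1) := by
  ext η
  rw [ContinuousMap.sum_apply]
  simp only [ContinuousMap.smul_apply, lin_single]
  rw [lin_apply]
  push_cast
  rfl

/-- The product of linear forms `η ↦ ∏ j, ∑ z, χ j z η z`. -/
def prodLin {k : ℕ} (χ : Fin k → V → ℝ) : C(Simplex V, ℂ) := ∏ j, lin (χ j)

/-- The monomial `η ↦ ∏ j, η (y j)`. -/
def mono {k : ℕ} (y : Fin k → V) : C(Simplex V, ℂ) := ∏ j, lin (Pi.single (y j) 1)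

theorem mono_eq {k : ℕ} (y : Fin k → V) : mono y = prodLin fun j => Pi.single (y j) (1 : ℝ) := rfl

theorem prodLin_eq {k : ℕ} (χ : Fin k → V → ℝ) :
    prodLin χ = ∑ y : Fin k → V, ((∏ j, χ j (y j) : ℝ) : ℂ) • mono y := by
  unfold prodLin mono
  conv_lhs => enter [2, j]; rw [lin_eq_sum]
  rw [Finset.prod_univ_sum, Fintype.piFinset_univ]
  refine Finset.sum_congr rfl fun y _ => ?_
  rw [Finset.prod_smul]
  push_cast
  rfl

theorem prodLin_exchange {k : ℕ} (x y : V) (p : Square) (χ : Fin k → V → ℝ) (η : Simplex V) :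
    prodLin χ (exchange x y p η) = prodLin (fun j => act x y p (χ j)) η := by
  simp only [prodLin, ContinuousMap.coe_prod, Finset.prod_apply, lin_exchange]

/-- The polynomials of degree at most `k` on the simplex. As `∑ z, η z = 1`, they are spanned by the
monomials of degree exactly `k`. -/
def polySpace (V : Type*) [DecidableEq V] [Fintype V] (k : ℕ) : Submodule ℂ C(Simplex V, ℂ) :=
  Submodule.span ℂ (Set.range (mono : (Fin k → V) → C(Simplex V, ℂ)))

instance (k : ℕ) : FiniteDimensional ℂ (polySpace V k) :=
  FiniteDimensional.span_of_finite ℂ (Set.finite_range _)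

theorem mono_mem {k : ℕ} (y : Fin k → V) : mono y ∈ polySpace V k :=
  Submodule.subset_span ⟨y, rfl⟩

theorem prodLin_mem {k : ℕ} (χ : Fin k → V → ℝ) : prodLin χ ∈ polySpace V k := by
  rw [prodLin_eq]
  exact Submodule.sum_mem _ fun y _ => Submodule.smul_mem _ _ (mono_mem y)

theorem prodLin_cons {k : ℕ} (ψ : V → ℝ) (χ : Fin k → V → ℝ) :
    prodLin (Fin.cons ψ χ : Fin (k + 1) → V → ℝ) = lin ψ * prodLin χ := by
  simp [prodLin, Fin.prod_univ_succ]

theorem lin_mul_mem {k : ℕ} (ψ : V → ℝ) {f : C(Simplex V, ℂ)} (hf : f ∈ polySpace V k) :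
    lin ψ * f ∈ polySpace V (k + 1) := by
  induction hf using Submodule.span_induction with
  | mem f h =>
    obtain ⟨y, rfl⟩ := h
    rw [mono_eq, ← prodLin_cons]
    exact prodLin_mem _
  | zero => simp
  | add f g _ _ hf hg => rw [mul_add]; exact Submodule.add_mem _ hf hg
  | smul c f _ hf => rw [mul_smul_comm]; exact Submodule.smul_mem _ _ hf

theorem polySpace_mono : Monotone (polySpace V) := by
  refine monotone_nat_of_le_succ fun k f hf => ?_
  have := lin_mul_mem (fun _ => 1) hf
  rwa [lin_const, Complex.ofReal_one, one_smul, one_mul] at this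

theorem one_mem_polySpace (k : ℕ) : (1 : C(Simplex V, ℂ)) ∈ polySpace V k := by
  refine polySpace_mono (Nat.zero_le k) ?_
  have := mono_mem (V := V) (k := 0) Fin.elim0
  simpa [mono] using this

theorem lin_mem_polySpace (ψ : V → ℝ) : lin ψ ∈ polySpace V 1 := by
  simpa using lin_mul_mem ψ (one_mem_polySpace 0)

/-- Membership in `polySpace V 0` means being constant. -/
theorem mem_polySpace_zero {f : C(Simplex V, ℂ)} :
    f ∈ polySpace V 0 ↔ ∃ c : ℂ, f = c • (1 : C(Simplex V, ℂ)) := by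
  have : Set.range (mono : (Fin 0 → V) → C(Simplex V, ℂ)) = {1} := by
    ext g
    constructor
    · rintro ⟨y, rfl⟩
      simp [mono]
    · rintro rfl
      exact ⟨Fin.elim0, by simp [mono]⟩
  rw [polySpace, this, Submodule.mem_span_singleton]
  exact exists_congr fun c => eq_comm

theorem isPolynomial_iff {f : C(Simplex V, ℂ)} : IsPolynomial f ↔ ∃ k, f ∈ polySpace V k := by
  constructor
  · rintro ⟨P, hP⟩
    induction P using MvPolynomial.induction_on generalizing f with
    | C a =>
      refine ⟨0, mem_polySpace_zero.2 ⟨a, ?_⟩⟩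
      ext η
      simp [hP η]
    | add P Q hP' hQ' =>
      have hc : ∀ R : MvPolynomial V ℂ, Continuous fun η : Simplex V =>
          MvPolynomial.eval (fun x => ((η.1 x : ℝ) : ℂ)) R := fun R =>
        (MvPolynomial.continuous_eval R).comp continuous_complex_coord
      obtain ⟨k, hk⟩ := hP' (f := ⟨_, hc P⟩) fun η => rfl
      obtain ⟨l, hl⟩ := hQ' (f := ⟨_, hc Q⟩) fun η => rfl
      refine ⟨max k l, ?_⟩
      have := Submodule.add_mem _ (polySpace_mono (le_max_left k l) hk)
        (polySpace_mono (le_max_right k l) hl)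
      convert this using 1
      ext η
      simp [hP η]
    | mul_X P x hP' =>
      have hc : Continuous fun η : Simplex V =>
          MvPolynomial.eval (fun x => ((η.1 x : ℝ) : ℂ)) P :=
        (MvPolynomial.continuous_eval P).comp continuous_complex_coord
      obtain ⟨k, hk⟩ := hP' (f := ⟨_, hc⟩) fun η => rfl
      refine ⟨k + 1, ?_⟩
      convert lin_mul_mem (Pi.single x 1) hk using 1
      ext η
      rw [ContinuousMap.mul_apply, lin_single, hP η]
      simp [mul_comm]
  · rintro ⟨k, hf⟩
    induction hf using Submodule.span_induction with
    | mem f h =>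
      obtain ⟨y, rfl⟩ := h
      refine ⟨∏ j, MvPolynomial.X (y j), fun η => ?_⟩
      simp only [mono, ContinuousMap.coe_prod, Finset.prod_apply, lin_single, map_prod,
        MvPolynomial.eval_X]
    | zero => exact ⟨0, by simp⟩
    | add f g _ _ hf hg =>
      obtain ⟨P, hP⟩ := hf
      obtain ⟨Q, hQ⟩ := hg
      exact ⟨P + Q, fun η => by simp [hP η, hQ η]⟩
    | smul c f _ hf =>
      obtain ⟨P, hP⟩ := hf
      exact ⟨MvPolynomial.C c * P, fun η => by simp [hP η]⟩

theorem IsPolynomial.continuous {f : Simplex V → ℂ} (hf : IsPolynomial f) : Continuous f := by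
  obtain ⟨P, hP⟩ := hf
  rw [funext hP]
  exact (MvPolynomial.continuous_eval P).comp continuous_complex_coord

theorem IsPolynomial.conj {f : Simplex V → ℂ} (hf : IsPolynomial f) :
    IsPolynomial fun η => (starRingEnd ℂ) (f η) := by
  obtain ⟨P, hP⟩ := hf
  refine ⟨MvPolynomial.map (starRingEnd ℂ) P, fun η => ?_⟩
  beta_reduce
  rw [hP, MvPolynomial.eval_map, ← MvPolynomial.eval₂_id, MvPolynomial.hom_eval₂]
  simp

theorem IsPolynomial.mul {f g : Simplex V → ℂ} (hf : IsPolynomial f) (hg : IsPolynomial g) :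
    IsPolynomial fun η => f η * g η := by
  obtain ⟨P, hP⟩ := hf
  obtain ⟨Q, hQ⟩ := hg
  exact ⟨P * Q, fun η => by simp [hP η, hQ η]⟩

theorem isPolynomial_const (c : ℂ) : IsPolynomial fun _ : Simplex V => c :=
  ⟨MvPolynomial.C c, by simp⟩

/-! ### The generator on polynomials -/

variable {β : V → V → Measure Square}

/-- The coefficient at the monomial `mono y` of the image of `prodLin χ` under the generator. -/
def genCoeff (β : V → V → Measure Square) {k : ℕ} (χ : Fin k → V → ℝ) (y : Fin k → V) : ℝ :=
  ∑ a, ∑ b, ∫ p, (∏ j, act a b p (χ j) (y j) - ∏ j, χ j (y j)) ∂(β a b)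

theorem integrable_prod_act (hβ : Admissible β) {k : ℕ} (χ : Fin k → V → ℝ) (y : Fin k → V)
    (a b : V) :
    Integrable (fun p => ∏ j, act a b p (χ j) (y j) - ∏ j, χ j (y j)) (β a b) :=
  Tame.integrable (Tame.prod _ fun j => tame_act a b (y j) (χ j)) (hβ.integrable_defect a b)
    (by simp [act_one])

theorem prodLin_act_sub {k : ℕ} (χ : Fin k → V → ℝ) (a b : V) (p : Square) :
    prodLin (fun j => act a b p (χ j)) - prodLin χ =
      ∑ y, ((∏ j, act a b p (χ j) (y j) - ∏ j, χ j (y j) : ℝ) : ℂ) • mono y := by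
  rw [prodLin_eq, prodLin_eq, ← Finset.sum_sub_distrib]
  refine Finset.sum_congr rfl fun y _ => ?_
  ext η
  simp only [ContinuousMap.sub_apply, ContinuousMap.smul_apply, smul_eq_mul]
  push_cast
  ring

theorem integrable_exchange_sub (hβ : Admissible β) {f : Simplex V → ℂ} (hf : IsPolynomial f)
    (a b : V) (η : Simplex V) :
    Integrable (fun p => f (exchange a b p η) - f η) (β a b) := by
  obtain ⟨k, hk⟩ := (isPolynomial_iff (f := ⟨f, hf.continuous⟩)).1 hf
  suffices ∀ g ∈ polySpace V k, Integrable (fun p => g (exchange a b p η) - g η) (β a b) from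
    this _ hk
  intro g hg
  induction hg using Submodule.span_induction with
  | mem g h =>
    obtain ⟨y, rfl⟩ := h
    have (p : Square) : mono y (exchange a b p η) - mono y η =
        ∑ z, ((∏ j, act a b p (Pi.single (y j) 1) (z j) -
          ∏ j, (Pi.single (y j) 1 : V → ℝ) (z j) : ℝ) : ℂ) * mono z η := by
      have h := congrArg (fun g => g η) (prodLin_act_sub (fun j => Pi.single (y j) 1) a b p)
      simp only [ContinuousMap.sub_apply] at h
      rw [mono_eq, prodLin_exchange, h, ContinuousMap.sum_apply]
      rfl
    simp only [this]
    exact integrable_finsetSum _ fun z _ =>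
      (integrable_prod_act hβ (fun j => Pi.single (y j) 1) z a b).ofReal.mul_const _
  | zero => simp
  | add f g _ _ hf hg =>
    have h : (fun p => (f + g) (exchange a b p η) - (f + g) η) =
        (fun p => f (exchange a b p η) - f η) + fun p => g (exchange a b p η) - g η := by
      ext p
      rw [ContinuousMap.add_apply, ContinuousMap.add_apply, Pi.add_apply]
      ring
    rw [h]
    exact hf.add hg
  | smul c f _ hf =>
    convert hf.const_mul c using 2
    simp [mul_sub]

theorem generator_add (hβ : Admissible β) {f g : Simplex V → ℂ} (hf : IsPolynomial f)
    (hg : IsPolynomial g) (η : Simplex V) :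
    generator β (fun η => f η + g η) η = generator β f η + generator β g η := by
  simp only [generator, ← Finset.sum_add_distrib]
  refine Finset.sum_congr rfl fun a _ => Finset.sum_congr rfl fun b _ => ?_
  rw [← integral_add (integrable_exchange_sub hβ hf a b η) (integrable_exchange_sub hβ hg a b η)]
  congr 1
  ext p
  ring

theorem generator_smul (c : ℂ) (f : Simplex V → ℂ) (η : Simplex V) :
    generator β (fun η => c * f η) η = c * generator β f η := by
  simp only [generator, Finset.mul_sum, ← integral_const_mul, mul_sub]

theorem generator_const (c : ℂ) (η : Simplex V) : generator β (fun _ => c) η = 0 := by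
  simp [generator]

theorem generator_prodLin (hβ : Admissible β) {k : ℕ} (χ : Fin k → V → ℝ) (η : Simplex V) :
    generator β (prodLin χ) η = (∑ y, (genCoeff β χ y : ℂ) • mono y : C(Simplex V, ℂ)) η := by
  have key (a b : V) : ∫ p, (prodLin χ (exchange a b p η) - prodLin χ η) ∂(β a b) =
      ∑ y, ((∫ p, (∏ j, act a b p (χ j) (y j) - ∏ j, χ j (y j)) ∂(β a b) : ℝ) : ℂ) *
        mono y η := by
    have (p : Square) : prodLin χ (exchange a b p η) - prodLin χ η =
        ∑ z, ((∏ j, act a b p (χ j) (z j) - ∏ j, χ j (z j) : ℝ) : ℂ) * mono z η := by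
      have h := congrArg (fun g => g η) (prodLin_act_sub χ a b p)
      simp only [ContinuousMap.sub_apply] at h
      rw [prodLin_exchange, h, ContinuousMap.sum_apply]
      rfl
    simp only [this]
    rw [integral_finsetSum _ fun z _ => (integrable_prod_act hβ χ z a b).ofReal.mul_const _]
    refine Finset.sum_congr rfl fun z _ => ?_
    rw [integral_mul_const]
    congr 1
    exact integral_ofReal
  simp only [generator, key, ContinuousMap.sum_apply, ContinuousMap.smul_apply, smul_eq_mul,
    genCoeff]
  push_cast
  simp only [Finset.sum_mul]
  rw [Finset.sum_comm (s := Finset.univ (α := Fin k → V))]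
  refine Finset.sum_congr rfl fun a _ => ?_
  rw [Finset.sum_comm]

/-- The generator does not raise the degree. -/
theorem exists_generator_eq (hβ : Admissible β) {k : ℕ} {f : C(Simplex V, ℂ)}
    (hf : f ∈ polySpace V k) : ∃ g ∈ polySpace V k, ∀ η, g η = generator β f η := by
  induction hf using Submodule.span_induction with
  | mem f h =>
    obtain ⟨y, rfl⟩ := h
    exact ⟨_, Submodule.sum_mem _ fun z _ => Submodule.smul_mem _ _ (mono_mem z),
      fun η => (generator_prodLin hβ (fun j => Pi.single (y j) (1 : ℝ)) η).symm⟩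
  | zero => exact ⟨0, zero_mem _, fun η => by simp [generator]⟩
  | add f g hf' hg' hf hg =>
    obtain ⟨F, hF, hF'⟩ := hf
    obtain ⟨G, hG, hG'⟩ := hg
    refine ⟨F + G, Submodule.add_mem _ hF hG, fun η => ?_⟩
    rw [ContinuousMap.add_apply, hF', hG',
      ← generator_add hβ (isPolynomial_iff.2 ⟨k, hf'⟩) (isPolynomial_iff.2 ⟨k, hg'⟩)]
    rfl
  | smul c f _ hf =>
    obtain ⟨F, hF, hF'⟩ := hf
    refine ⟨c • F, Submodule.smul_mem _ _ hF, fun η => ?_⟩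
    rw [ContinuousMap.smul_apply, hF', smul_eq_mul, ← generator_smul]
    rfl

/-- The space of all polynomials on the simplex. -/
def polynomials (V : Type*) [DecidableEq V] [Fintype V] : Submodule ℂ C(Simplex V, ℂ) :=
  ⨆ k, polySpace V k

theorem mem_polynomials_iff {f : C(Simplex V, ℂ)} :
    f ∈ polynomials V ↔ ∃ k, f ∈ polySpace V k :=
  Submodule.mem_iSup_of_directed _ polySpace_mono.directed_le

theorem mem_polynomials {f : C(Simplex V, ℂ)} : f ∈ polynomials V ↔ IsPolynomial f :=
  mem_polynomials_iff.trans isPolynomial_iff.symm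

/-- The generator as a linear map on polynomials. -/
theorem exists_generator_linearMap (hβ : Admissible β) :
    ∃ L : C(Simplex V, ℂ) →ₗ[ℂ] C(Simplex V, ℂ),
      ∀ f ∈ polynomials V, ∀ η, L f η = generator β f η := by
  have h (f : polynomials V) : ∃ g : C(Simplex V, ℂ), ∀ η, g η = generator β f.1 η := by
    obtain ⟨k, hk⟩ := mem_polynomials_iff.1 f.2
    obtain ⟨g, -, hg⟩ := exists_generator_eq hβ hk
    exact ⟨g, hg⟩
  choose g hg using h
  obtain ⟨L, hL⟩ := LinearMap.exists_extend (p := polynomials V)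
    { toFun := g
      map_add' := fun f f' => by
        ext η
        rw [ContinuousMap.add_apply, hg, hg, hg,
          ← generator_add hβ (mem_polynomials.1 f.2) (mem_polynomials.1 f'.2)]
        rfl
      map_smul' := fun c f => by
        ext η
        rw [RingHom.id_apply, ContinuousMap.smul_apply, hg, hg, smul_eq_mul, ← generator_smul]
        rfl }
  refine ⟨L, fun f hf η => ?_⟩
  rw [← hg ⟨f, hf⟩]
  exact congrArg (fun g => g η) (LinearMap.congr_fun hL ⟨f, hf⟩)

/-- **Duality**: a linear functional applied to the image of a product of linear forms under the
generator equals the corresponding generator on tuples of functions. -/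
theorem functional_generator_prodLin (hβ : Admissible β) {k : ℕ} (χ : Fin k → V → ℝ)
    {g : C(Simplex V, ℂ)} (hg : ∀ η, g η = generator β (prodLin χ) η)
    (Λ : C(Simplex V, ℂ) →ₗ[ℝ] ℝ) :
    Λ g = ∑ a, ∑ b, ∫ p, (Λ (prodLin fun j => act a b p (χ j)) - Λ (prodLin χ)) ∂(β a b) := by
  have hg' : g = ∑ y, genCoeff β χ y • mono y := by
    ext η
    rw [hg, generator_prodLin hβ]
    simp only [ContinuousMap.sum_apply, ContinuousMap.smul_apply, Complex.real_smul, smul_eq_mul]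
  have key (a b : V) (p : Square) : Λ (prodLin fun j => act a b p (χ j)) - Λ (prodLin χ) =
      ∑ y, (∏ j, act a b p (χ j) (y j) - ∏ j, χ j (y j)) * Λ (mono y) := by
    rw [← map_sub, prodLin_act_sub, map_sum]
    refine Finset.sum_congr rfl fun y _ => ?_
    rw [← smul_eq_mul, ← map_smul]
    rfl
  simp only [key]
  rw [hg', map_sum]
  simp only [map_smul, smul_eq_mul, genCoeff, Finset.sum_mul]
  rw [Finset.sum_comm]
  refine Finset.sum_congr rfl fun a _ => ?_
  rw [Finset.sum_comm]
  refine Finset.sum_congr rfl fun b _ => ?_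
  rw [integral_finsetSum _ fun z _ => (integrable_prod_act hβ χ z a b).mul_const _]
  simp only [integral_mul_const]

theorem integrable_functional_prodLin (hβ : Admissible β) {k : ℕ} (χ : Fin k → V → ℝ)
    (Λ : C(Simplex V, ℂ) →ₗ[ℝ] ℝ) (a b : V) :
    Integrable (fun p => Λ (prodLin fun j => act a b p (χ j)) - Λ (prodLin χ)) (β a b) := by
  have key (p : Square) : Λ (prodLin fun j => act a b p (χ j)) - Λ (prodLin χ) =
      ∑ y, (∏ j, act a b p (χ j) (y j) - ∏ j, χ j (y j)) * Λ (mono y) := by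
    rw [← map_sub, prodLin_act_sub, map_sum]
    refine Finset.sum_congr rfl fun y _ => ?_
    rw [← smul_eq_mul, ← map_smul]
    rfl
  simp only [key]
  exact integrable_finsetSum _ fun z _ => (integrable_prod_act hβ χ z a b).mul_const _

end Polynomials

/-! ### Diagonal self-adjoint operators -/

section Diagonal

open Filter Topology

variable {H : Type*} [NormedAddCommGroup H] [InnerProductSpace ℂ H] [CompleteSpace H]
  {ι : Type*} (b : HilbertBasis ι ℂ H) (ev : ι → ℝ)

/-- The graph of the maximal operator acting diagonally, with real eigenvalues `ev`, in the
orthonormal basis `b`. -/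
def diagGraph : Submodule ℂ (H × H) where
  carrier := {x | ∀ i, inner ℂ (b i) x.2 = (ev i : ℂ) * inner ℂ (b i) x.1}
  add_mem' {x y} hx hy i := by
    simp only [Prod.snd_add, Prod.fst_add, inner_add_right, hx i, hy i]
    ring
  zero_mem' i := by simp
  smul_mem' c x hx i := by
    simp only [Prod.smul_snd, Prod.smul_fst, inner_smul_right, hx i]
    ring

variable {b ev}

theorem mem_diagGraph {x : H × H} :
    x ∈ diagGraph b ev ↔ ∀ i, inner ℂ (b i) x.2 = (ev i : ℂ) * inner ℂ (b i) x.1 := Iff.rfl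

theorem eq_of_inner_basis {x y : H} (h : ∀ i, inner ℂ (b i) x = inner ℂ (b i) y) : x = y := by
  refine b.repr.injective (lp.ext (funext fun i => ?_))
  rw [b.repr_apply_apply, b.repr_apply_apply, h]

theorem inner_basis_self (i : ι) : inner ℂ (b i) (b i) = 1 := by
  rw [inner_self_eq_norm_sq_to_K, b.orthonormal.1]
  simp

theorem inner_basis_of_ne {i j : ι} (h : i ≠ j) : inner ℂ (b i) (b j) = 0 := b.orthonormal.2 h

theorem basis_mem_diagGraph (i : ι) : (b i, (ev i : ℂ) • b i) ∈ diagGraph b ev := by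
  intro j
  simp only [inner_smul_right]
  by_cases h : j = i
  · rw [h]
  · rw [inner_basis_of_ne h]
    simp

theorem isClosed_diagGraph : IsClosed (diagGraph b ev : Set (H × H)) := by
  have : (diagGraph b ev : Set (H × H)) =
      ⋂ i, {x | inner ℂ (b i) x.2 = (ev i : ℂ) * inner ℂ (b i) x.1} := by
    ext x
    simp [mem_diagGraph]
  rw [this]
  exact isClosed_iInter fun i => isClosed_eq (by fun_prop) (by fun_prop)

variable (b ev) in
/-- The diagonal operator with eigenvalues `ev` in the basis `b`, on its maximal domain. -/
def diagOp : H →ₗ.[ℂ] H := (diagGraph b ev).toLinearPMap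

theorem diagOp_graph : (diagOp b ev).graph = diagGraph b ev := by
  refine Submodule.toLinearPMap_graph_eq _ fun x hx hx' => ?_
  refine eq_of_inner_basis (b := b) fun i => ?_
  rw [hx i, hx']
  simp

theorem mem_diagOp_domain {x y : H} (h : (x, y) ∈ diagGraph b ev) :
    ∃ hx : x ∈ (diagOp b ev).domain, diagOp b ev ⟨x, hx⟩ = y := by
  rw [← diagOp_graph, LinearPMap.mem_graph_iff] at h
  obtain ⟨z, rfl, hz⟩ := h
  exact ⟨z.2, hz⟩

theorem inner_diagOp (f : (diagOp b ev).domain) (i : ι) :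
    inner ℂ (b i) (diagOp b ev f) = (ev i : ℂ) * inner ℂ (b i) (f : H) := by
  have := (diagOp b ev).mem_graph f
  rw [diagOp_graph] at this
  exact this i

theorem diagGraph_subset_closure :
    (diagGraph b ev : Set (H × H)) ⊆
      closure (Submodule.span ℂ (Set.range fun i => (b i, (ev i : ℂ) • b i)) : Set (H × H)) := by
  rintro ⟨x, y⟩ h
  have hx := b.hasSum_repr x
  have hy := b.hasSum_repr y
  have := hx.prodMk hy
  refine mem_closure_of_tendsto this (Eventually.of_forall fun s => ?_)
  refine Submodule.sum_mem _ fun i _ => ?_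
  have hi : (b.repr x i • b i, b.repr y i • b i) = b.repr x i • (b i, (ev i : ℂ) • b i) := by
    rw [b.repr_apply_apply, b.repr_apply_apply, h i, Prod.smul_mk, smul_smul, mul_comm]
  rw [hi]
  exact Submodule.smul_mem _ _ (Submodule.subset_span ⟨i, rfl⟩)

theorem dense_diagOp_domain : Dense ((diagOp b ev).domain : Set H) := by
  have h : Submodule.span ℂ (Set.range b) ≤ (diagOp b ev).domain := by
    rw [Submodule.span_le]
    rintro _ ⟨i, rfl⟩
    exact (mem_diagOp_domain (basis_mem_diagGraph i)).1
  refine Dense.mono h ?_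
  rw [dense_iff_closure_eq, ← Submodule.topologicalClosure_coe, b.dense_span]
  rfl

theorem isSelfAdjoint_diagOp : IsSelfAdjoint (diagOp b ev) := by
  rw [LinearPMap.isSelfAdjoint_def]
  refine LinearPMap.eq_of_eq_graph ?_
  rw [LinearPMap.adjoint_graph_eq_graph_adjoint dense_diagOp_domain, diagOp_graph]
  ext ⟨x, y⟩
  rw [Submodule.mem_adjoint_iff]
  constructor
  · intro h i
    have := h _ _ (basis_mem_diagGraph i)
    rw [inner_smul_left, Complex.conj_ofReal, sub_eq_zero] at this
    exact this.symm
  · intro h f g hfg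
    rw [sub_eq_zero, ← b.tsum_inner_mul_inner, ← b.tsum_inner_mul_inner]
    refine tsum_congr fun i => ?_
    rw [h i, ← inner_conj_symm g, hfg i, ← inner_conj_symm f, map_mul, Complex.conj_ofReal]
    ring

theorem eigenvalues_diagOp : eigenvalues (diagOp b ev) = Set.range fun i => (ev i : ℂ) := by
  ext z
  constructor
  · rintro ⟨f, hf, hz⟩
    by_contra hne
    refine hf (eq_of_inner_basis (b := b) fun i => ?_)
    have h := inner_diagOp f i
    rw [hz, inner_smul_right] at h
    have h' : (z - ev i) * inner ℂ (b i) (f : H) = 0 := by rw [sub_mul, h, sub_self]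
    rcases mul_eq_zero.1 h' with h0 | h0
    · exact absurd ⟨i, (sub_eq_zero.1 h0).symm⟩ hne
    · rw [h0, inner_zero_right]
  · rintro ⟨i, rfl⟩
    obtain ⟨h, hi⟩ := mem_diagOp_domain (basis_mem_diagGraph (b := b) (ev := ev) i)
    exact ⟨⟨b i, h⟩, b.orthonormal.ne_zero i, hi⟩

/-- Bounded diagonal operators. -/
theorem exists_diag_clm {m : ι → ℂ} {C : ℝ} (hm : ∀ i, ‖m i‖ ≤ C) (hC : 0 ≤ C) :
    ∃ R : H →L[ℂ] H, ∀ h i, inner ℂ (b i) (R h) = m i * inner ℂ (b i) h := by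
  have hmem (f : lp (fun _ : ι => ℂ) 2) : Memℓp (fun i => m i * f i) 2 := by
    have h2 : (0 : ℝ) < (2 : ℝ≥0∞).toReal := by norm_num
    have := (memℓp_gen_iff h2).1 (lp.memℓp f)
    refine (memℓp_gen_iff h2).2 (Summable.of_nonneg_of_le (fun i => by positivity) (fun i => ?_)
      (this.mul_left (C ^ (2 : ℝ≥0∞).toReal)))
    rw [norm_mul, ← Real.mul_rpow hC (norm_nonneg _)]
    gcongr
    exact hm i
  let D : lp (fun _ : ι => ℂ) 2 →ₗ[ℂ] lp (fun _ : ι => ℂ) 2 :=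
    { toFun := fun f => ⟨fun i => m i * f i, hmem f⟩
      map_add' := fun f g => by
        ext i
        exact mul_add _ _ _
      map_smul' := fun c f => by
        ext i
        exact mul_left_comm _ _ _ }
  have hD (f : lp (fun _ : ι => ℂ) 2) : ‖D f‖ ≤ C * ‖f‖ := by
    have h2 : (0 : ℝ) < (2 : ℝ≥0∞).toReal := by norm_num
    refine lp.norm_le_of_forall_sum_le h2 (by positivity) fun s => ?_
    rw [Real.mul_rpow hC (norm_nonneg _)]
    refine le_trans ?_ (mul_le_mul_of_nonneg_left (lp.sum_rpow_le_norm_rpow h2 f s) (by positivity))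
    rw [Finset.mul_sum]
    refine Finset.sum_le_sum fun i _ => ?_
    change ‖m i * f i‖ ^ _ ≤ _
    rw [norm_mul, ← Real.mul_rpow hC (norm_nonneg _)]
    gcongr
    exact hm i
  refine ⟨(b.repr.symm.toContinuousLinearEquiv : _ →L[ℂ] H).comp
    ((D.mkContinuous C hD).comp (b.repr.toContinuousLinearEquiv : H →L[ℂ] _)), fun h i => ?_⟩
  rw [← b.repr_apply_apply, ← b.repr_apply_apply]
  simp [D]

theorem unboundedSpectrum_diagOp :
    unboundedSpectrum (diagOp b ev) = closure (Set.range fun i => (ev i : ℂ)) := by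
  ext z
  constructor
  · intro hz
    by_contra hne
    refine hz ?_
    -- at positive distance from the eigenvalues, the resolvent is a bounded diagonal operator
    rw [Metric.mem_closure_iff] at hne
    push Not at hne
    obtain ⟨ε, hε, hd⟩ := hne
    have hd' (i : ι) : ε ≤ ‖(ev i : ℂ) - z‖ := by
      rw [← dist_eq_norm, dist_comm]
      exact hd _ ⟨i, rfl⟩
    have hne (i : ι) : (ev i : ℂ) - z ≠ 0 := norm_pos_iff.1 (hε.trans_le (hd' i))
    obtain ⟨R, hR⟩ := exists_diag_clm (b := b) (m := fun i => ((ev i : ℂ) - z)⁻¹) (C := ε⁻¹)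
      (fun i => by
        rw [norm_inv]
        exact inv_anti₀ hε (hd' i)) (by positivity)
    refine ⟨R, fun h => ?_, fun f => ?_⟩
    · have hg : (R h, h + z • R h) ∈ diagGraph b ev := by
        intro i
        simp only [inner_add_right, inner_smul_right, hR]
        field_simp [hne i]
        ring
      obtain ⟨h1, h2⟩ := mem_diagOp_domain hg
      exact ⟨h1, by rw [h2, add_sub_cancel_right]⟩
    · refine eq_of_inner_basis (b := b) fun i => ?_
      rw [hR, inner_sub_right, inner_diagOp, inner_smul_right, ← sub_mul, ← mul_assoc,
        inv_mul_cancel₀ (hne i), one_mul]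
  · rintro hz ⟨R, -, hR⟩
    -- a resolvent at `z` has norm at least the inverse distance from `z` to each eigenvalue
    rw [Metric.mem_closure_iff] at hz
    obtain ⟨_, ⟨i, rfl⟩, hi⟩ := hz (‖R‖ + 1)⁻¹ (by positivity)
    obtain ⟨h, hA⟩ := mem_diagOp_domain (basis_mem_diagGraph (b := b) (ev := ev) i)
    have h1 := hR ⟨b i, h⟩
    simp only [hA, ← sub_smul, map_smul] at h1
    have h2 : ‖(ev i : ℂ) - z‖ * ‖R (b i)‖ = 1 := by
      rw [← norm_smul, h1, b.orthonormal.1]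
    have h3 : ‖R (b i)‖ ≤ ‖R‖ := by simpa [b.orthonormal.1 i] using R.le_opNorm (b i)
    rw [dist_comm, dist_eq_norm] at hi
    have h4 : ‖(ev i : ℂ) - z‖ * ‖R (b i)‖ ≤ (‖R‖ + 1)⁻¹ * ‖R‖ := by gcongr
    rw [h2, inv_mul_eq_div, le_div_iff₀ (by positivity)] at h4
    linarith

end Diagonal

/-! ### Eigenbases adapted to a filtration -/

section Filtration

variable {H : Type*} [NormedAddCommGroup H] [InnerProductSpace ℂ H] [CompleteSpace H]

/-- The part of the `k`-th filtration step that is orthogonal to the previous step. -/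
def levelSpace (D : ℕ → Submodule ℂ H) : ℕ → Submodule ℂ H
  | 0 => D 0
  | k + 1 => (D k)ᗮ ⊓ D (k + 1)

variable {D : ℕ → Submodule ℂ H}

theorem levelSpace_le (k : ℕ) : levelSpace D k ≤ D k := by
  cases k with
  | zero => exact le_rfl
  | succ k => exact inf_le_right

theorem levelSpace_le_orthogonal (hmono : Monotone D) {j k : ℕ} (h : j < k) :
    levelSpace D k ≤ (D j)ᗮ := by
  cases k with
  | zero => omega
  | succ k => exact inf_le_left.trans (Submodule.orthogonal_le (hmono (Nat.lt_succ_iff.1 h)))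

theorem iSup_levelSpace [∀ k, FiniteDimensional ℂ (D k)] (hmono : Monotone D) (k : ℕ) :
    ⨆ j : Finset.range (k + 1), levelSpace D j = D k := by
  induction k with
  | zero =>
    refine le_antisymm (iSup_le fun j => ?_) ?_
    · have : (j : ℕ) = 0 := by have := Finset.mem_range.1 j.2; omega
      rw [this]
      exact levelSpace_le 0
    · exact le_iSup (fun j : Finset.range 1 => levelSpace D j) ⟨0, by simp⟩
  | succ k ih =>
    refine le_antisymm (iSup_le fun j => (levelSpace_le _).trans
      (hmono (Nat.lt_succ_iff.1 (Finset.mem_range.1 j.2)))) ?_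
    rw [← Submodule.sup_orthogonal_inf_of_hasOrthogonalProjection (hmono (Nat.le_succ k))]
    refine sup_le ?_ (le_iSup (fun j : Finset.range (k + 2) => levelSpace D j) ⟨k + 1, by simp⟩)
    rw [← ih]
    refine iSup_le fun j => le_iSup (fun j : Finset.range (k + 2) => levelSpace D j)
      ⟨j, Finset.mem_range.2 (by have := Finset.mem_range.1 j.2; omega)⟩

/-- A symmetric operator that preserves an exhausting filtration by finite-dimensional subspaces
has an orthonormal basis of eigenvectors adapted to the filtration. -/
theorem exists_adapted_hilbertBasis [∀ k, FiniteDimensional ℂ (D k)] (hmono : Monotone D)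
    (hdense : (⨆ k, D k).topologicalClosure = ⊤) (T : H →ₗ[ℂ] H)
    (hT : ∀ k, ∀ h ∈ D k, T h ∈ D k)
    (hsymm : ∀ f ∈ ⨆ k, D k, ∀ g ∈ ⨆ k, D k, inner ℂ (T f) g = inner ℂ f (T g)) :
    ∃ (d : ℕ → ℕ) (b : HilbertBasis (Σ k, Fin (d k)) ℂ H) (ev : (Σ k, Fin (d k)) → ℝ),
      (∀ i, b i ∈ D i.1 ∧ (∀ j < i.1, b i ∈ (D j)ᗮ) ∧ T (b i) = (ev i : ℂ) • b i) ∧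
      ∀ k, D k = Submodule.span ℂ (b '' {i | i.1 ≤ k}) := by
  have hD (k : ℕ) : D k ≤ ⨆ k, D k := le_iSup D k
  have hE (k : ℕ) : ∀ h ∈ levelSpace D k, T h ∈ levelSpace D k := by
    intro h hh
    cases k with
    | zero => exact hT 0 h hh
    | succ k =>
      refine ⟨fun g hg => ?_, hT _ h hh.2⟩
      rw [← hsymm g (hD _ hg) h (hD _ hh.2)]
      exact hh.1 _ (hT k g hg)
  have (k : ℕ) : FiniteDimensional ℂ (levelSpace D k) :=
    Submodule.finiteDimensional_of_le (levelSpace_le k)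
  let S (k : ℕ) : levelSpace D k →ₗ[ℂ] levelSpace D k := T.restrict (hE k)
  have hS (k : ℕ) : (S k).IsSymmetric := fun f g =>
    hsymm f (hD _ (levelSpace_le k f.2)) g (hD _ (levelSpace_le k g.2))
  let d (k : ℕ) : ℕ := Module.finrank ℂ (levelSpace D k)
  let e (k : ℕ) : OrthonormalBasis (Fin (d k)) ℂ (levelSpace D k) := (hS k).eigenvectorBasis rfl
  let v (i : Σ k, Fin (d k)) : H := (e i.1 i.2 : H)
  have horth : Orthonormal ℂ v := by
    constructor
    · rintro ⟨k, i⟩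
      exact (e k).orthonormal.1 i
    · rintro ⟨k, i⟩ ⟨l, j⟩ hne
      rcases lt_trichotomy k l with h | rfl | h
      · exact levelSpace_le_orthogonal hmono h (e l j).2 _ (levelSpace_le k (e k i).2)
      · exact (e k).orthonormal.2 (fun h => hne (congrArg (Sigma.mk k) h))
      · exact inner_eq_zero_symm.1
          (levelSpace_le_orthogonal hmono h (e k i).2 _ (levelSpace_le l (e l j).2))
  have hlevel (k : ℕ) : levelSpace D k ≤ Submodule.span ℂ (v '' {i | i.1 = k}) := by
    intro h hh
    have := (e k).sum_repr ⟨h, hh⟩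
    have h' := congrArg (Submodule.subtype _) this
    rw [map_sum] at h'
    change _ = h at h'
    rw [← h']
    refine Submodule.sum_mem _ fun i _ => ?_
    rw [map_smul]
    exact Submodule.smul_mem _ _ (Submodule.subset_span ⟨⟨k, i⟩, rfl, rfl⟩)
  have hspan (k : ℕ) : D k = Submodule.span ℂ (v '' {i | i.1 ≤ k}) := by
    refine le_antisymm ?_ (Submodule.span_le.2 ?_)
    · rw [← iSup_levelSpace hmono k]
      refine iSup_le fun j => (hlevel j).trans (Submodule.span_mono (Set.image_mono ?_))
      intro i hi
      have := Finset.mem_range.1 j.2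
      simp only [Set.mem_ofPred_eq] at hi ⊢
      omega
    · rintro _ ⟨i, hi, rfl⟩
      exact hmono hi (levelSpace_le _ (e i.1 i.2).2)
  have htop : ⊤ ≤ (Submodule.span ℂ (Set.range v)).topologicalClosure := by
    rw [← hdense]
    refine Submodule.topologicalClosure_mono (iSup_le fun k => ?_)
    rw [hspan k]
    exact Submodule.span_mono (Set.image_subset_range _ _)
  refine ⟨d, HilbertBasis.mk horth htop, fun i => (hS i.1).eigenvalues rfl i.2, ?_, ?_⟩
  · intro i
    rw [HilbertBasis.coe_mk]
    refine ⟨levelSpace_le _ (e i.1 i.2).2,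
      fun j hj => levelSpace_le_orthogonal hmono hj (e i.1 i.2).2, ?_⟩
    exact congrArg Subtype.val ((hS i.1).apply_eigenvectorBasis rfl i.2)
  · intro k
    rw [HilbertBasis.coe_mk]
    exact hspan k

end Filtration

/-! ### Moments of the Dirichlet distribution -/

section Dirichlet

open Set

theorem lintegral_comp_smul_pos {E : Type*} [NormedAddCommGroup E] [NormedSpace ℝ E]
    [MeasurableSpace E] [BorelSpace E] [FiniteDimensional ℝ E] (μ : Measure E) [μ.IsAddHaarMeasure]
    (f : E → ℝ≥0∞) {t : ℝ} (ht : 0 < t) :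
    ∫⁻ w, f w ∂μ = ENNReal.ofReal (t ^ Module.finrank ℝ E) * ∫⁻ w, f (t • w) ∂μ := by
  have h := lintegral_map_equiv f (MeasurableEquiv.smul₀ t ht.ne') (μ := μ)
  rw [MeasurableEquiv.coe_smul₀] at h
  rw [← h, Measure.map_addHaar_smul μ ht.ne', lintegral_smul_measure, smul_eq_mul, ← mul_assoc,
    ← ENNReal.ofReal_mul (by positivity), abs_of_pos (by positivity),
    mul_inv_cancel₀ (by positivity), ENNReal.ofReal_one, one_mul]

/-- The weight that spreads a vector of coordinate sum `r` over the scales `t > r` is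
normalized. -/
theorem lintegral_tail_power {n : ℕ} (hn : 0 < n) {r : ℝ} (hr : 0 < r) :
    ∫⁻ t in Ioi r, ENNReal.ofReal (n * r ^ n / t ^ (n + 1)) = 1 := by
  have hn' : (0 : ℝ) < n := by exact_mod_cast hn
  have ha : (-((n : ℝ) + 1)) < -1 := by linarith
  have heq : ∀ t ∈ Ioi r, n * r ^ n / t ^ (n + 1) = n * r ^ n * t ^ (-((n : ℝ) + 1)) := by
    intro t ht
    have ht0 : 0 < t := hr.trans ht
    rw [Real.rpow_neg ht0.le, div_eq_mul_inv]
    congr 2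
    exact_mod_cast (Real.rpow_natCast t (n + 1)).symm
  rw [setLIntegral_congr_fun measurableSet_Ioi fun t ht => by rw [heq t ht],
    ← ofReal_integral_eq_lintegral_ofReal ((integrableOn_Ioi_rpow_of_lt ha hr).const_mul _)
      ((ae_restrict_mem measurableSet_Ioi).mono fun t ht => by
        have : 0 < t := hr.trans ht
        positivity),
    integral_const_mul, integral_Ioi_rpow_of_lt ha hr]
  have : -((n : ℝ) + 1) + 1 = -n := by ring
  rw [this, Real.rpow_neg hr.le, Real.rpow_natCast]
  have hrn : r ^ n ≠ 0 := by positivity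
  rw [show (n : ℝ) * r ^ n * (-(r ^ n)⁻¹ / -(n : ℝ)) = 1 by field_simp, ENNReal.ofReal_one]

variable {V : Type*} [Fintype V] [Nonempty V]

/-- The open positive orthant. -/
def orthant (V : Type*) : Set (V → ℝ) := {w | ∀ x, 0 < w x}

theorem sum_pos_of_mem_orthant {w : V → ℝ} (hw : w ∈ orthant V) : 0 < ∑ x, w x :=
  Finset.sum_pos (fun x _ => hw x) Finset.univ_nonempty

theorem isOpen_orthant : IsOpen (orthant V) := by
  simp only [orthant, ofPred_forall]
  exact isOpen_iInter_of_finite fun x => isOpen_lt continuous_const (continuous_apply x)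

theorem smul_mem_orthant {w : V → ℝ} {t : ℝ} (ht : 0 < t) : t • w ∈ orthant V ↔ w ∈ orthant V := by
  simp [orthant, ht]

/-- Polar integration with respect to the coordinate sum, for a function that is homogeneous of
degree zero. The radial part is compared with the cone `∑ w ≤ 1` by inserting the integral
`∫_{t > ∑ w} n (∑ w) ^ n / t ^ (n + 1) dt = 1` and rescaling. -/
theorem lintegral_polar {J : (V → ℝ) → ℝ≥0∞} (hJ : Measurable J)
    (hhom : ∀ t : ℝ, 0 < t → ∀ w, J (t • w) = J w) (hsupp : ∀ w ∉ orthant V, J w = 0)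
    {g : ℝ → ℝ≥0∞} (hg : Measurable g) :
    ∫⁻ w, J w * g (∑ x, w x) =
      (Fintype.card V : ℝ≥0∞) * (∫⁻ w in {w | ∑ x, w x ≤ 1}, J w) *
        ∫⁻ t in Ioi 0, ENNReal.ofReal (t ^ (Fintype.card V - 1)) * g t := by
  set n := Fintype.card V with hn
  have hn0 : 0 < n := Fintype.card_pos
  let K (w : V → ℝ) (t : ℝ) : ℝ≥0∞ := J w * g (∑ x, w x) *
    (Ici (∑ x, w x)).indicator (fun t => ENNReal.ofReal (n * (∑ x, w x) ^ n / t ^ (n + 1))) t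
  have hsum : Measurable fun w : V → ℝ => ∑ x, w x := by fun_prop
  have hK : Measurable (Function.uncurry K) := by
    refine ((hJ.comp measurable_fst).mul (hg.comp (hsum.comp measurable_fst))).mul ?_
    have : (fun q : (V → ℝ) × ℝ => (Ici (∑ x, q.1 x)).indicator
        (fun t => ENNReal.ofReal (n * (∑ x, q.1 x) ^ n / t ^ (n + 1))) q.2) =
        {q : (V → ℝ) × ℝ | ∑ x, q.1 x ≤ q.2}.indicator
          (fun q => ENNReal.ofReal (n * (∑ x, q.1 x) ^ n / q.2 ^ (n + 1))) := by
      ext q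
      simp [indicator]
    rw [this]
    refine Measurable.indicator (by fun_prop) ?_
    exact measurableSet_le (hsum.comp measurable_fst) measurable_snd
  -- the kernel integrates to one in the second variable
  have h1 (w : V → ℝ) : ∫⁻ t in Ioi 0, K w t = J w * g (∑ x, w x) := by
    by_cases hw : w ∈ orthant V
    · have hs := sum_pos_of_mem_orthant hw
      simp only [K]
      rw [lintegral_const_mul _ (Measurable.indicator (by fun_prop) measurableSet_Ici),
        lintegral_indicator measurableSet_Ici, Measure.restrict_restrict measurableSet_Ici,
        inter_eq_left.2 (Ici_subset_Ioi.2 hs), setLIntegral_congr Ioi_ae_eq_Ici.symm,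
        lintegral_tail_power hn0 hs, mul_one]
    · simp [K, hsupp w hw]
  -- rescaling `w` by `t` turns the condition `∑ w ≤ t` into `∑ w ≤ 1`
  have h2 (t : ℝ) (ht : 0 < t) : ∫⁻ w, K w t = ∫⁻ w, {w : V → ℝ | ∑ x, w x ≤ 1}.indicator J w *
      (n * ENNReal.ofReal (t ^ (n - 1) * (∑ x, w x) ^ n) * g (t * ∑ x, w x)) := by
    rw [lintegral_comp_smul_pos volume _ ht, Module.finrank_fintype_fun_eq_card, ← hn,
      ← lintegral_const_mul _ (by fun_prop)]
    refine lintegral_congr fun w => ?_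
    by_cases hw : w ∈ orthant V
    · have hs := sum_pos_of_mem_orthant hw
      have hsm : ∑ x, (t • w) x = t * ∑ x, w x := by simp [Finset.mul_sum]
      simp only [K, hhom t ht, hsm]
      by_cases h : ∑ x, w x ≤ 1
      · have h' : t * ∑ x, w x ≤ t := by nlinarith
        rw [indicator_of_mem (show t ∈ Ici (t * ∑ x, w x) from h'),
          indicator_of_mem (show w ∈ {w : V → ℝ | ∑ x, w x ≤ 1} from h)]
        have : ENNReal.ofReal (t ^ n) *
            ENNReal.ofReal (n * (t * ∑ x, w x) ^ n / t ^ (n + 1)) =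
            n * ENNReal.ofReal (t ^ (n - 1) * (∑ x, w x) ^ n) := by
          rw [← ENNReal.ofReal_mul (by positivity), ← ENNReal.ofReal_natCast n,
            ← ENNReal.ofReal_mul (by positivity)]
          congr 1
          obtain ⟨m, hm⟩ : ∃ m, n = m + 1 := ⟨n - 1, by omega⟩
          rw [hm, Nat.add_sub_cancel]
          field_simp
          ring
        rw [← this]
        ring
      · have h' : ¬ t * ∑ x, w x ≤ t := by nlinarith
        rw [indicator_of_notMem (show t ∉ Ici (t * ∑ x, w x) from h'),
          indicator_of_notMem (show w ∉ {w : V → ℝ | ∑ x, w x ≤ 1} from h)]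
        simp
    · have : t • w ∉ orthant V := by rwa [smul_mem_orthant ht]
      simp [K, hsupp _ this, hsupp w hw, indicator]
  -- rescaling `t` by `∑ w` removes the dependence on `w`
  have h3 (w : V → ℝ) (hw : w ∈ orthant V) :
      ∫⁻ t in Ioi 0, (n * ENNReal.ofReal (t ^ (n - 1) * (∑ x, w x) ^ n) * g (t * ∑ x, w x)) =
        n * ∫⁻ t in Ioi 0, ENNReal.ofReal (t ^ (n - 1)) * g t := by
    have hs := sum_pos_of_mem_orthant hw
    simp only [mul_assoc]
    rw [lintegral_const_mul _ (by fun_prop), ← lintegral_indicator measurableSet_Ioi,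
      ← lintegral_indicator measurableSet_Ioi]
    conv_rhs => rw [lintegral_comp_smul_pos volume _ hs, Module.finrank_self, pow_one,
      ← lintegral_const_mul _ (by
        refine Measurable.comp (g := indicator _ _) ?_ (measurable_const_smul _)
        exact Measurable.indicator (by fun_prop) measurableSet_Ioi)]
    congr 1
    refine lintegral_congr fun t => ?_
    by_cases ht : 0 < t
    · have hst : 0 < (∑ x, w x) * t := by positivity
      rw [indicator_of_mem (show t ∈ Ioi (0 : ℝ) from ht), smul_eq_mul,
        indicator_of_mem (show _ ∈ Ioi (0 : ℝ) from hst), ← mul_assoc,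
        ← ENNReal.ofReal_mul hs.le, mul_comm t]
      congr 2
      obtain ⟨m, hm⟩ : ∃ m, n = m + 1 := ⟨n - 1, by omega⟩
      rw [hm, Nat.add_sub_cancel]
      ring
    · have hst : ¬ 0 < (∑ x, w x) * t := by
        rw [mul_pos_iff_of_pos_left hs]
        exact ht
      rw [indicator_of_notMem (show t ∉ Ioi (0 : ℝ) from ht), smul_eq_mul,
        indicator_of_notMem (show _ ∉ Ioi (0 : ℝ) from hst), mul_zero]
  calc ∫⁻ w, J w * g (∑ x, w x) = ∫⁻ w, ∫⁻ t in Ioi 0, K w t := by simp only [h1]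
    _ = ∫⁻ t in Ioi 0, ∫⁻ w, K w t := lintegral_lintegral_swap hK.aemeasurable
    _ = ∫⁻ t in Ioi 0, ∫⁻ w, {w : V → ℝ | ∑ x, w x ≤ 1}.indicator J w *
      (n * ENNReal.ofReal (t ^ (n - 1) * (∑ x, w x) ^ n) * g (t * ∑ x, w x)) :=
        setLIntegral_congr_fun measurableSet_Ioi fun t ht => h2 t ht
    _ = ∫⁻ w, ∫⁻ t in Ioi 0, {w : V → ℝ | ∑ x, w x ≤ 1}.indicator J w *
      (n * ENNReal.ofReal (t ^ (n - 1) * (∑ x, w x) ^ n) * g (t * ∑ x, w x)) := by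
        refine lintegral_lintegral_swap (Measurable.aemeasurable ?_)
        have hJ' : Measurable ({w : V → ℝ | ∑ x, w x ≤ 1}.indicator J) :=
          hJ.indicator (measurableSet_le hsum measurable_const)
        simp only [Function.uncurry_def]
        fun_prop
    _ = ∫⁻ w, {w : V → ℝ | ∑ x, w x ≤ 1}.indicator J w *
          (n * ∫⁻ t in Ioi 0, ENNReal.ofReal (t ^ (n - 1)) * g t) := by
        refine lintegral_congr fun w => ?_
        rw [lintegral_const_mul _ (by fun_prop)]
        by_cases hw : w ∈ orthant V
        · rw [h3 w hw]
        · simp [indicator, hsupp w hw]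
    _ = _ := by
        rw [lintegral_mul_const _ (hJ.indicator (measurableSet_le hsum measurable_const)),
          lintegral_indicator (measurableSet_le hsum measurable_const)]
        ring

/-! ### Gamma integrals over the orthant -/

theorem lintegral_prod_rpow_exp {a : V → ℝ} (ha : ∀ x, 0 < a x) :
    ∫⁻ w in orthant V, ENNReal.ofReal (∏ x, (w x ^ (a x - 1)) * Real.exp (-w x)) =
      ENNReal.ofReal (∏ x, Real.Gamma (a x)) := by
  let f (x : V) : ℝ → ℝ := (Ioi 0).indicator fun t => Real.exp (-t) * t ^ (a x - 1)
  have hf (x : V) : Integrable (f x) :=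
    (integrable_indicator_iff measurableSet_Ioi).2 (Real.GammaIntegral_convergent (ha x))
  have hf0 (x : V) (t : ℝ) : 0 ≤ f x t := by
    refine indicator_nonneg (fun t ht => ?_) t
    have : 0 < t := ht
    positivity
  have hG (x : V) : ∫ t, f x t = Real.Gamma (a x) := by
    rw [Real.Gamma_eq_integral (ha x), integral_indicator measurableSet_Ioi]
  have hprod := integral_fintype_prod_volume_eq_prod (𝕜 := ℝ) f
  simp only [hG] at hprod
  have hint : Integrable fun w : V → ℝ => ∏ x, f x (w x) := Integrable.fintype_prod hf
  rw [← hprod, ofReal_integral_eq_lintegral_ofReal hint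
    (Filter.Eventually.of_forall fun w => Finset.prod_nonneg fun x _ => hf0 x _),
    ← lintegral_indicator isOpen_orthant.measurableSet]
  refine lintegral_congr fun w => ?_
  by_cases hw : w ∈ orthant V
  · rw [indicator_of_mem hw]
    congr 1
    refine Finset.prod_congr rfl fun x _ => ?_
    have : w x ∈ Ioi (0 : ℝ) := hw x
    simp only [f, indicator_of_mem this]
    ring
  · rw [indicator_of_notMem hw]
    obtain ⟨x, hx⟩ : ∃ x, ¬ 0 < w x := by simpa [orthant] using hw
    have : f x (w x) = 0 := indicator_of_notMem hx _
    rw [Finset.prod_eq_zero (Finset.mem_univ x) this, ENNReal.ofReal_zero]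

theorem orthant_ae_eq : orthant V =ᵐ[volume] {w : V → ℝ | (∀ x, 0 ≤ w x) ∧ 0 < ∑ x, w x} := by
  have h (x : V) : ∀ᵐ w : V → ℝ, w x ≠ 0 := by
    rw [ae_iff]
    simp only [ne_eq, not_not]
    exact Measure.pi_hyperplane (fun _ : V => (volume : Measure ℝ)) x 0
  filter_upwards [ae_all_iff.2 h] with w hw
  refine propext ⟨fun hw' => ⟨fun x => (hw' x).le, sum_pos_of_mem_orthant hw'⟩, fun hw' x => ?_⟩
  exact lt_of_le_of_ne (hw'.1 x) (hw x).symm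

theorem measurable_sum : Measurable fun w : V → ℝ => ∑ x, w x := by fun_prop

/-- The normalization `w ↦ w / ∑ w`. -/
def normalize (w : V → ℝ) : V → ℝ := (∑ x, w x)⁻¹ • w

theorem measurable_normalize : Measurable (normalize : (V → ℝ) → V → ℝ) := by
  unfold normalize
  fun_prop

theorem normalize_mem {w : V → ℝ} (hw : ∀ x, 0 ≤ w x) (hs : 0 < ∑ x, w x) :
    normalize w ∈ stdSimplex ℝ V := by
  refine ⟨fun x => mul_nonneg (inv_nonneg.2 hs.le) (hw x), ?_⟩
  simp only [normalize, Pi.smul_apply, smul_eq_mul, ← Finset.mul_sum]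
  exact inv_mul_cancel₀ hs.ne'

theorem normalize_smul {t : ℝ} (ht : 0 < t) (w : V → ℝ) : normalize (t • w) = normalize w := by
  ext x
  simp only [normalize, Pi.smul_apply, smul_eq_mul, ← Finset.mul_sum]
  field_simp

/-- Integrals over the simplex as integrals of functions of degree zero over a truncated cone. The
boundary of the orthant is a null set. -/
theorem lintegral_uniformMeasure {h : (V → ℝ) → ℝ≥0∞} (hh : Measurable h) :
    ∫⁻ η, h η.1 ∂(uniformMeasure V) = (Fintype.card V : ℝ≥0∞) *
      ∫⁻ w in {w | ∑ x, w x ≤ 1}, (orthant V).indicator (fun w => h (normalize w)) w := by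
  have hms : MeasurableSet (stdSimplex ℝ V) := (isClosed_stdSimplex ℝ V).measurableSet
  have hC : MeasurableSet {w : V → ℝ | (∀ x, 0 ≤ w x) ∧ 0 < ∑ x, w x ∧ ∑ x, w x ≤ 1} := by
    have h1 : MeasurableSet {w : V → ℝ | ∀ x, 0 ≤ w x} := by
      simp only [ofPred_forall]
      exact MeasurableSet.iInter fun x => measurableSet_le measurable_const (measurable_pi_apply x)
    exact h1.inter ((measurableSet_lt measurable_const measurable_sum).inter
      (measurableSet_le measurable_sum measurable_const))
  rw [uniformMeasure, lintegral_smul_measure, smul_eq_mul,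
    ← (MeasurableEmbedding.subtype_coe hms).lintegral_map (μ := Measure.comap _ _) h,
    (MeasurableEmbedding.subtype_coe hms).map_comap, Subtype.range_coe]
  congr 1
  rw [show (fun w : V → ℝ => (∑ x, w x)⁻¹ • w) = normalize from rfl,
    Measure.restrict_map measurable_normalize hms,
    Measure.restrict_restrict (measurable_normalize hms), lintegral_map hh measurable_normalize,
    lintegral_indicator isOpen_orthant.measurableSet,
    Measure.restrict_restrict isOpen_orthant.measurableSet]
  refine setLIntegral_congr ?_
  have : normalize ⁻¹' stdSimplex ℝ V ∩
      {w | (∀ x, 0 ≤ w x) ∧ 0 < ∑ x, w x ∧ ∑ x, w x ≤ 1} =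
      {w : V → ℝ | (∀ x, 0 ≤ w x) ∧ 0 < ∑ x, w x} ∩ {w | ∑ x, w x ≤ 1} := by
    ext w
    constructor
    · rintro ⟨-, h1, h2, h3⟩
      exact ⟨⟨h1, h2⟩, h3⟩
    · rintro ⟨⟨h1, h2⟩, h3⟩
      exact ⟨normalize_mem h1 h2, h1, h2, h3⟩
  rw [this]
  exact (orthant_ae_eq.symm).inter (ae_eq_refl _)

/-- The Dirichlet integral. It follows from `lintegral_polar` and the Gamma integral over the
orthant, whose integrand is the product of a function of degree zero and a function of `∑ w`. -/
theorem lintegral_rpow_uniformMeasure {a : V → ℝ} (ha : ∀ x, 0 < a x) (k : V → ℕ) :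
    ∫⁻ η, ENNReal.ofReal ((∏ x, η.1 x ^ (a x - 1)) * ∏ x, η.1 x ^ k x) ∂(uniformMeasure V) =
      ENNReal.ofReal ((∏ x, Real.Gamma (a x + k x)) / Real.Gamma (∑ x, (a x + k x))) := by
  set n := Fintype.card V with hn
  set s := ∑ x, (a x + k x) with hs
  have ha' (x : V) : 0 < a x + k x := by have := ha x; positivity
  have hs0 : 0 < s := Finset.sum_pos (fun x _ => ha' x) Finset.univ_nonempty
  have hn0 : 0 < n := Fintype.card_pos
  let h (w : V → ℝ) : ℝ≥0∞ := ENNReal.ofReal ((∏ x, w x ^ (a x - 1)) * ∏ x, w x ^ k x)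
  have hh : Measurable h := by fun_prop
  let J : (V → ℝ) → ℝ≥0∞ := (orthant V).indicator fun w => h (normalize w)
  have hJ : Measurable J :=
    (hh.comp measurable_normalize).indicator isOpen_orthant.measurableSet
  have hhom (t : ℝ) (ht : 0 < t) (w : V → ℝ) : J (t • w) = J w := by
    by_cases hw : w ∈ orthant V
    · have hw' := (smul_mem_orthant ht).2 hw
      simp only [J, indicator_of_mem hw, indicator_of_mem hw', normalize_smul ht]
    · have hw' : t • w ∉ orthant V := by rwa [smul_mem_orthant ht]
      simp only [J, indicator_of_notMem hw, indicator_of_notMem hw']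
  -- the integrand of the Gamma integral has degree `s - n`, so this is its radial part
  let g (t : ℝ) : ℝ≥0∞ := ENNReal.ofReal (t ^ (s - n) * Real.exp (-t))
  have hpolar := lintegral_polar hJ hhom (fun w hw => indicator_of_notMem hw _)
    (g := g) (by fun_prop)
  have h1 : ∫⁻ t in Ioi 0, ENNReal.ofReal (t ^ (n - 1)) * g t =
      ENNReal.ofReal (Real.Gamma s) := by
    rw [Real.Gamma_eq_integral hs0, ofReal_integral_eq_lintegral_ofReal
      (Real.GammaIntegral_convergent hs0) ((ae_restrict_mem measurableSet_Ioi).mono fun t ht => by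
        have : 0 < t := ht
        positivity)]
    refine setLIntegral_congr_fun measurableSet_Ioi fun t ht => ?_
    have ht : 0 < t := ht
    simp only [g]
    rw [← ENNReal.ofReal_mul (by positivity), ← mul_assoc, ← Real.rpow_natCast, ← Real.rpow_add ht,
      mul_comm]
    congr 3
    push_cast [Nat.cast_sub (Nat.one_le_of_lt hn0)]
    ring
  have h2 : ∫⁻ w, J w * g (∑ x, w x) = ENNReal.ofReal (∏ x, Real.Gamma (a x + k x)) := by
    rw [← lintegral_prod_rpow_exp ha', ← lintegral_indicator isOpen_orthant.measurableSet]
    refine lintegral_congr fun w => ?_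
    by_cases hw : w ∈ orthant V
    · have hσ := sum_pos_of_mem_orthant hw
      simp only [J, indicator_of_mem hw, h, g]
      set σ := ∑ x, w x with hσ'
      have hnorm (x : V) : normalize w x = w x / σ := by
        simp [normalize, ← hσ', div_eq_inv_mul]
      have hpos (x : V) : 0 < w x / σ := div_pos (hw x) hσ
      simp only [hnorm]
      rw [← ENNReal.ofReal_mul (mul_nonneg
        (Finset.prod_nonneg fun x _ => Real.rpow_nonneg (hpos x).le _)
        (Finset.prod_nonneg fun x _ => pow_nonneg (hpos x).le _))]
      congr 1
      have hx (x : V) : (w x / σ) ^ (a x - 1) * (w x / σ) ^ k x =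
          w x ^ (a x + k x - 1) * σ ^ (-(a x + k x - 1)) := by
        rw [← Real.rpow_natCast, ← Real.rpow_add (hpos x), Real.div_rpow (hw x).le hσ.le,
          Real.rpow_neg hσ.le, div_eq_mul_inv]
        ring_nf
      rw [← Finset.prod_mul_distrib, Finset.prod_congr rfl fun x _ => hx x,
        Finset.prod_mul_distrib, Finset.prod_mul_distrib, ← Real.rpow_sum_of_pos hσ,
        ← Real.exp_sum, Finset.sum_neg_distrib, Finset.sum_neg_distrib, ← hσ', mul_assoc,
        ← mul_assoc (σ ^ _), ← Real.rpow_add hσ]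
      have : -∑ x, (a x + k x - 1) + (s - n) = 0 := by
        rw [Finset.sum_sub_distrib, ← hs]
        simp [hn]
      rw [this, Real.rpow_zero, one_mul]
    · simp [J, hw]
  rw [h2, h1, ← lintegral_uniformMeasure hh] at hpolar
  have hΓ : 0 < Real.Gamma s := Real.Gamma_pos_of_pos hs0
  rw [ENNReal.ofReal_div_of_pos hΓ, ENNReal.eq_div_iff (by simpa using hΓ) ENNReal.ofReal_ne_top,
    mul_comm]
  exact hpolar.symm

variable {α : V → ℝ}

theorem measurable_monomial (k : V → ℕ) : Measurable fun η : Simplex V => ∏ x, η.1 x ^ k x :=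
  (show Measurable fun w : V → ℝ => ∏ x, w x ^ k x by fun_prop).comp measurable_subtype_coe

theorem measurable_rpow_monomial (α : V → ℝ) :
    Measurable fun η : Simplex V => ∏ x, η.1 x ^ (α x - 1) :=
  (show Measurable fun w : V → ℝ => ∏ x, w x ^ (α x - 1) by fun_prop).comp measurable_subtype_coe

theorem lintegral_dirichlet_monomial (hα : ∀ x, 0 < α x) (k : V → ℕ) :
    ∫⁻ η, ENNReal.ofReal (∏ x, η.1 x ^ k x) ∂(dirichlet α) =
      ENNReal.ofReal (Real.Gamma (∑ x, α x) / (∏ x, Real.Gamma (α x)) *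
        ((∏ x, Real.Gamma (α x + k x)) / Real.Gamma (∑ x, (α x + k x)))) := by
  have hm := measurable_monomial k
  have hm' := measurable_rpow_monomial α
  have hc : 0 ≤ Real.Gamma (∑ x, α x) / (∏ x, Real.Gamma (α x)) :=
    div_nonneg (Real.Gamma_nonneg_of_nonneg (Finset.sum_nonneg fun x _ => (hα x).le))
      (Finset.prod_nonneg fun x _ => (Real.Gamma_pos_of_pos (hα x)).le)
  rw [dirichlet, lintegral_withDensity_eq_lintegral_mul _ (by fun_prop) (by fun_prop),
    ENNReal.ofReal_mul hc, ← lintegral_rpow_uniformMeasure hα k,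
    ← lintegral_const_mul _ (by fun_prop)]
  refine lintegral_congr fun η => ?_
  have h1 : 0 ≤ ∏ x, η.1 x ^ (α x - 1) :=
    Finset.prod_nonneg fun x _ => Real.rpow_nonneg (η.2.1 x) _
  rw [Pi.mul_apply, ← ENNReal.ofReal_mul (mul_nonneg hc h1), ← ENNReal.ofReal_mul hc,
    mul_assoc]

theorem isProbabilityMeasure_dirichlet (hα : ∀ x, 0 < α x) :
    IsProbabilityMeasure (dirichlet α) := by
  constructor
  have h := lintegral_dirichlet_monomial hα 0
  have h1 : (∏ x, Real.Gamma (α x)) ≠ 0 :=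
    Finset.prod_ne_zero_iff.2 fun x _ => (Real.Gamma_pos_of_pos (hα x)).ne'
  have h2 : Real.Gamma (∑ x, α x) ≠ 0 :=
    (Real.Gamma_pos_of_pos (Finset.sum_pos (fun x _ => hα x) Finset.univ_nonempty)).ne'
  simp only [Pi.zero_apply, pow_zero, Finset.prod_const_one, ENNReal.ofReal_one, lintegral_one,
    Nat.cast_zero, add_zero] at h
  rw [h, div_mul_div_cancel₀ h1, div_self h2, ENNReal.ofReal_one]

theorem integral_dirichlet_monomial (hα : ∀ x, 0 < α x) (k : V → ℕ) :
    ∫ η, ∏ x, η.1 x ^ k x ∂(dirichlet α) =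
      Real.Gamma (∑ x, α x) / (∏ x, Real.Gamma (α x)) *
        ((∏ x, Real.Gamma (α x + k x)) / Real.Gamma (∑ x, (α x + k x))) := by
  have hm := measurable_monomial k
  rw [integral_eq_lintegral_of_nonneg_ae
    (Filter.Eventually.of_forall fun η => Finset.prod_nonneg fun x _ => pow_nonneg (η.2.1 x) _)
    hm.aestronglyMeasurable, lintegral_dirichlet_monomial hα,
    ENNReal.toReal_ofReal]
  have hG {t : ℝ} (ht : 0 ≤ t) := Real.Gamma_nonneg_of_nonneg ht
  have h0 (x : V) : 0 ≤ α x + k x := by have := hα x; positivity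
  have := hG (Finset.sum_nonneg fun x (_ : x ∈ Finset.univ) => (hα x).le)
  have := hG (Finset.sum_nonneg fun x (_ : x ∈ Finset.univ) => h0 x)
  have := Finset.prod_nonneg fun x (_ : x ∈ Finset.univ) => hG (hα x).le
  have := Finset.prod_nonneg fun x (_ : x ∈ Finset.univ) => hG (h0 x)
  positivity

variable [DecidableEq V]

theorem prod_Gamma_add_single (hα : ∀ x, 0 < α x) (z : V) :
    ∏ x, Real.Gamma (α x + (Pi.single z 1 : V → ℕ) x) = α z * ∏ x, Real.Gamma (α x) := by
  rw [← Finset.mul_prod_erase _ _ (Finset.mem_univ z),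
    ← Finset.mul_prod_erase (a := z) _ (fun x => Real.Gamma (α x)) (Finset.mem_univ z),
    ← mul_assoc, ← Real.Gamma_add_one (hα z).ne']
  congr 1
  · simp
  · refine Finset.prod_congr rfl fun x hx => ?_
    simp [(Finset.mem_erase.1 hx).1]

theorem integral_dirichlet_coord (hα : ∀ x, 0 < α x) (z : V) :
    ∫ η, η.1 z ∂(dirichlet α) = α z / ∑ x, α x := by
  have hs : 0 < ∑ x, α x := Finset.sum_pos (fun x _ => hα x) Finset.univ_nonempty
  have h := integral_dirichlet_monomial hα (Pi.single z 1)
  have h1 : (∏ x, Real.Gamma (α x)) ≠ 0 :=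
    Finset.prod_ne_zero_iff.2 fun x _ => (Real.Gamma_pos_of_pos (hα x)).ne'
  have h2 := (Real.Gamma_pos_of_pos hs).ne'
  rw [prod_Gamma_add_single hα, Finset.sum_add_distrib] at h
  have h3 : ∑ x, (((Pi.single z 1 : V → ℕ) x : ℕ) : ℝ) = 1 := by
    simp [Pi.single_apply]
  rw [h3, Real.Gamma_add_one hs.ne'] at h
  have h4 (η : Simplex V) : ∏ x, η.1 x ^ (Pi.single z 1 : V → ℕ) x = η.1 z := by
    rw [Finset.prod_eq_single z]
    · simp
    · intro x _ hx
      simp [hx]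
    · simp
  simp only [h4] at h
  rw [h]
  field_simp

theorem integral_dirichlet_coord_mul (hα : ∀ x, 0 < α x) (y z : V) :
    ∫ η, η.1 y * η.1 z ∂(dirichlet α) =
      (α y * α z + if y = z then α y else 0) / ((∑ x, α x) * (∑ x, α x + 1)) := by
  have hs : 0 < ∑ x, α x := Finset.sum_pos (fun x _ => hα x) Finset.univ_nonempty
  have h := integral_dirichlet_monomial hα (Pi.single y 1 + Pi.single z 1)
  have h1 : (∏ x, Real.Gamma (α x)) ≠ 0 :=
    Finset.prod_ne_zero_iff.2 fun x _ => (Real.Gamma_pos_of_pos (hα x)).ne'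
  have h2 := (Real.Gamma_pos_of_pos hs).ne'
  have hα' (x : V) : 0 < α x + (Pi.single y 1 : V → ℕ) x := by have := hα x; positivity
  simp only [Pi.add_apply, Nat.cast_add, ← add_assoc] at h
  rw [prod_Gamma_add_single hα', prod_Gamma_add_single hα, Finset.sum_add_distrib,
    Finset.sum_add_distrib] at h
  have h3 (z : V) : ∑ x, (((Pi.single z 1 : V → ℕ) x : ℕ) : ℝ) = 1 := by
    simp [Pi.single_apply]
  rw [h3, h3, Real.Gamma_add_one (by positivity), Real.Gamma_add_one hs.ne'] at h
  have h4 (η : Simplex V) (z : V) : ∏ x, η.1 x ^ (Pi.single z 1 : V → ℕ) x = η.1 z := by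
    rw [Finset.prod_eq_single z]
    · simp
    · intro x _ hx
      simp [hx]
    · simp
  simp only [pow_add, Finset.prod_mul_distrib, h4] at h
  rw [h]
  by_cases hyz : y = z
  · subst hyz
    simp only [Pi.single_eq_same, if_true, Nat.cast_one]
    field_simp
  · have hzy : (Pi.single y 1 : V → ℕ) z = 0 := by simp [Ne.symm hyz]
    simp only [hzy, if_neg hyz, Nat.cast_zero, add_zero]
    field_simp

/-- The Dirichlet distribution charges every nonempty open set. -/
theorem isOpenPosMeasure_dirichlet (hα : ∀ x, 0 < α x) :
    (dirichlet α).IsOpenPosMeasure := by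
  refine ⟨fun U hU ⟨η, hη⟩ hzero => ?_⟩
  obtain ⟨U', hU', rfl⟩ := isOpen_induced_iff.1 hU
  set c := Real.Gamma (∑ x, α x) / (∏ x, Real.Gamma (α x)) with hc
  have hc0 : 0 < c :=
    div_pos (Real.Gamma_pos_of_pos (Finset.sum_pos (fun x _ => hα x) Finset.univ_nonempty))
      (Finset.prod_pos fun x _ => Real.Gamma_pos_of_pos (hα x))
  let h (w : V → ℝ) : ℝ≥0∞ := U'.indicator
    (fun w => ENNReal.ofReal (c * ∏ x, w x ^ (α x - 1))) w
  have hh : Measurable h := Measurable.indicator (by fun_prop) hU'.measurableSet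
  have h0 : ∫⁻ η, h η.1 ∂(uniformMeasure V) = 0 := by
    rw [← hzero, dirichlet, withDensity_apply _ hU.measurableSet,
      ← lintegral_indicator hU.measurableSet]
    rfl
  rw [lintegral_uniformMeasure hh] at h0
  have hn : (Fintype.card V : ℝ≥0∞) ≠ 0 := by simp
  have h0' := (mul_eq_zero.1 h0).resolve_left hn
  rw [lintegral_eq_zero_iff (show Measurable ((orthant V).indicator fun w => h (normalize w)) from
    (hh.comp measurable_normalize).indicator isOpen_orthant.measurableSet)] at h0'
  have h1 := (ae_restrict_iff' (measurableSet_le measurable_sum measurable_const)).1 h0'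
  -- an open subset of the cone on which the integrand is positive
  let W : Set (V → ℝ) := {w | w ∈ orthant V ∧ normalize w ∈ U' ∧ ∑ x, w x < 1}
  have hnorm : ContinuousOn (normalize : (V → ℝ) → V → ℝ) (orthant V) := by
    have hc : Continuous fun w : V → ℝ => ∑ x, w x := by fun_prop
    exact (hc.continuousOn.inv₀ fun w hw => (sum_pos_of_mem_orthant hw).ne').smul continuousOn_id
  have hW : IsOpen W := by
    have h2 := hnorm.isOpen_inter_preimage isOpen_orthant hU'
    have h3 : IsOpen {w : V → ℝ | ∑ x, w x < 1} := isOpen_lt (by fun_prop) continuous_const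
    convert h2.inter h3 using 1
    ext w
    exact and_assoc.symm
  have hWne : W.Nonempty := by
    have hN : (0 : ℝ) < Fintype.card V := by exact_mod_cast Fintype.card_pos
    let γ (t : ℝ) : V → ℝ := fun x => (1 - t) * η.1 x + t * (Fintype.card V : ℝ)⁻¹
    have hγ : Continuous γ := by fun_prop
    have hγ0 : γ 0 = η.1 := by
      ext x
      simp [γ]
    have hev : ∀ᶠ t in nhds (0 : ℝ), γ t ∈ U' :=
      hγ.continuousAt.eventually_mem (by rw [hγ0]; exact hU'.mem_nhds hη)
    obtain ⟨ε, hε, hball⟩ := Metric.eventually_nhds_iff.1 hev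
    let t := min (ε / 2) (1 / 2)
    have ht0 : 0 < t := lt_min (by linarith) (by norm_num)
    have ht1 : t ≤ 1 / 2 := min_le_right _ _
    have ht2 : t < ε := (min_le_left _ _).trans_lt (by linarith)
    have hmem : γ t ∈ U' := hball (by rw [Real.dist_eq, sub_zero, abs_of_pos ht0]; exact ht2)
    have hpos : γ t ∈ orthant V := fun x => by
      have := η.2.1 x
      have h1t : 0 ≤ 1 - t := by linarith
      have : 0 ≤ (1 - t) * η.1 x := mul_nonneg h1t this
      have : 0 < t * (Fintype.card V : ℝ)⁻¹ := by positivity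
      simp only [γ]
      linarith
    have hsum : ∑ x, γ t x = 1 := by
      simp only [γ, Finset.sum_add_distrib, ← Finset.mul_sum]
      rw [η.2.2]
      simp
    refine ⟨(1 / 2 : ℝ) • γ t, (smul_mem_orthant (by norm_num)).2 hpos, ?_, ?_⟩
    · rw [normalize_smul (by norm_num), normalize, hsum, inv_one, one_smul]
      exact hmem
    · simp only [Pi.smul_apply, smul_eq_mul, ← Finset.mul_sum, hsum]
      norm_num
  refine (hW.measure_pos volume hWne).ne' (measure_mono_null (fun w hw => ?_) (ae_iff.1 h1))
  simp only [mem_ofPred_eq, Classical.not_imp]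
  refine ⟨hw.2.2.le, ?_⟩
  rw [indicator_of_mem hw.1]
  simp only [h]
  rw [indicator_of_mem hw.2.1, Pi.zero_apply, ENNReal.ofReal_eq_zero, not_le]
  refine mul_pos hc0 (Finset.prod_pos fun x _ => Real.rpow_pos_of_pos ?_ _)
  exact mul_pos (inv_pos.2 (sum_pos_of_mem_orthant hw.1)) (hw.1 x)

end Dirichlet

/-! ### The random walk -/

section RandomWalk

variable {V : Type*} [DecidableEq V] [Fintype V] {β : V → V → Measure Square}

theorem continuous_swap_square : Continuous (Prod.swap : Square → Square) := continuous_swap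

theorem Tame.swap {φ : Square → ℝ} (hφ : Tame φ) : Tame fun p => φ p.swap := by
  obtain ⟨h, C, hC⟩ := hφ
  refine ⟨h.comp continuous_swap_square, C, fun p => ?_⟩
  have : defect p = defect p.swap := by
    simp only [defect, Prod.fst_swap, Prod.snd_swap]
    ring
  rw [this]
  exact hC p.swap

theorem Admissible.integrable_defect_symMeasure (hβ : Admissible β) (x y : V) :
    Integrable defect (symMeasure β x y) := by
  refine (hβ.integrable_defect x y).add_measure ?_
  rw [integrable_map_measure continuous_defect.aestronglyMeasurable
    continuous_swap_square.aemeasurable]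
  refine (hβ.integrable_defect y x).congr (Filter.Eventually.of_forall fun p => ?_)
  simp only [defect, Function.comp_apply, Prod.fst_swap, Prod.snd_swap]
  ring

theorem Tame.integrable_symMeasure (hβ : Admissible β) {φ : Square → ℝ} (hφ : Tame φ)
    (h1 : φ 1 = 0) (x y : V) : Integrable φ (symMeasure β x y) :=
  hφ.integrable_of_zero (hβ.integrable_defect_symMeasure x y) h1

theorem integral_symMeasure (hβ : Admissible β) {φ : Square → ℝ} (hφ : Tame φ) (h1 : φ 1 = 0)
    (x y : V) :
    ∫ p, φ p ∂(symMeasure β x y) = ∫ p, φ p ∂(β x y) + ∫ p, φ p.swap ∂(β y x) := by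
  have h := hφ.integrable_symMeasure hβ h1 x y
  rw [symMeasure, integrable_add_measure] at h
  rw [symMeasure, integral_add_measure h.1 h.2,
    integral_map continuous_swap_square.aemeasurable hφ.1.aestronglyMeasurable]

theorem integral_symMeasure_swap (hβ : Admissible β) {φ : Square → ℝ} (hφ : Tame φ) (h1 : φ 1 = 0)
    (x y : V) :
    ∫ p, φ p.swap ∂(symMeasure β x y) = ∫ p, φ p ∂(symMeasure β y x) := by
  rw [integral_symMeasure hβ hφ.swap h1, integral_symMeasure hβ hφ h1]
  simp only [Prod.swap_swap]
  ring

/-- Sums over ordered pairs may be symmetrized. -/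
theorem sum_integral_eq_symMeasure (hβ : Admissible β) {h : V → V → Square → ℝ}
    (hh : ∀ x y, Tame (h x y)) (h1 : ∀ x y, h x y 1 = 0)
    (hsymm : ∀ x y p, h y x p.swap = h x y p) :
    ∑ x, ∑ y, ∫ p, h x y p ∂(β x y) = (1 / 2) * ∑ x, ∑ y, ∫ p, h x y p ∂(symMeasure β x y) := by
  have (x y : V) : ∫ p, h x y p ∂(symMeasure β x y) =
      ∫ p, h x y p ∂(β x y) + ∫ p, h y x p ∂(β y x) := by
    rw [integral_symMeasure hβ (hh x y) (h1 x y)]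
    simp only [hsymm]
  simp only [this, Finset.sum_add_distrib]
  rw [Finset.sum_comm (f := fun x y => ∫ p, h y x p ∂(β y x))]
  ring

theorem tame_one_sub_fst : Tame fun p => 1 - (p.1 : ℝ) := (Tame.const 1).sub Tame.fst

theorem tame_one_sub_snd : Tame fun p => 1 - (p.2 : ℝ) := (Tame.const 1).sub Tame.snd

theorem integral_one_sub_snd (hβ : Admissible β) (x y : V) :
    ∫ p, (1 - (p.2 : ℝ)) ∂(symMeasure β x y) = rate β y x :=
  integral_symMeasure_swap hβ tame_one_sub_fst (by simp) x y

theorem symMeasure_self (hβ : Admissible β) (x : V) : symMeasure β x x = 0 := by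
  simp [symMeasure, hβ.1 x]

theorem rate_self (hβ : Admissible β) (x : V) : rate β x x = 0 := by
  simp [rate, symMeasure_self hβ]

theorem rate_nonneg (x y : V) : 0 ≤ rate β x y :=
  integral_nonneg fun p => sub_nonneg.2 p.1.2.2

theorem rate₂_le_rate (hβ : Admissible β) (x y : V) : rate₂ β x y ≤ rate β x y := by
  refine integral_mono
    ((Tame.fst.mul tame_one_sub_fst).integrable_symMeasure hβ (by simp) x y)
    (tame_one_sub_fst.integrable_symMeasure hβ (by simp) x y) fun p => ?_
  exact mul_le_of_le_one_left (sub_nonneg.2 p.1.2.2) p.1.2.2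

/-- The generator of the random walk. -/
def walkGen (β : V → V → Measure Square) (ψ : V → ℝ) (x : V) : ℝ :=
  ∑ y, rate β x y * (ψ y - ψ x)

/-- The generator acting on a linear form is the random walk generator acting on its
coefficients. -/
theorem sum_integral_act (hβ : Admissible β) (ψ : V → ℝ) (z : V) :
    ∑ a, ∑ b, ∫ p, (act a b p ψ z - ψ z) ∂(β a b) = walkGen β ψ z := by
  rw [sum_integral_eq_symMeasure hβ (fun a b => (tame_act a b z ψ).sub (Tame.const _))
    (fun a b => by simp [act_one]) (fun a b p => by rw [act_swap])]
  have h (a b : V) : ∫ p, (act a b p ψ z - ψ z) ∂(symMeasure β a b) =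
      (ψ b - ψ a) * (if z = a then rate β a b else 0) +
        (ψ a - ψ b) * (if z = b then rate β b a else 0) := by
    have h' (p : Square) : act a b p ψ z - ψ z =
        ((ψ b - ψ a) * if z = a then 1 else 0) * (1 - (p.1 : ℝ)) +
          ((ψ a - ψ b) * if z = b then 1 else 0) * (1 - (p.2 : ℝ)) := by
      simp only [act, Pi.add_apply, Pi.smul_apply, Pi.sub_apply, smul_eq_mul, Pi.single_apply]
      ring
    simp only [h']
    rw [integral_add ((tame_one_sub_fst.integrable_symMeasure hβ (by simp) a b).const_mul _)
      ((tame_one_sub_snd.integrable_symMeasure hβ (by simp) a b).const_mul _),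
      integral_const_mul, integral_const_mul, integral_one_sub_snd hβ, ← rate]
    split_ifs <;> ring
  simp only [h, Finset.sum_add_distrib]
  rw [Finset.sum_comm (f := fun a b => (ψ a - ψ b) * (if z = b then rate β b a else 0))]
  simp only [mul_ite, mul_zero, Finset.sum_ite_irrel, Finset.sum_const_zero, Finset.sum_ite_eq,
    Finset.mem_univ, if_true, walkGen]
  rw [← two_mul, ← mul_assoc]
  norm_num
  exact Finset.sum_congr rfl fun y _ => mul_comm _ _

/-- Invariance of `π`, tested against functions. -/
def Stationary (β : V → V → Measure Square) (π : V → ℝ) : Prop :=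
  ∀ ψ : V → ℝ, ∑ x, π x * walkGen β ψ x = 0

theorem sum_mul_walkGen (π ψ : V → ℝ) : ∑ x, π x * walkGen β ψ x =
    ∑ x, ψ x * (∑ y, π y * rate β y x - π x * ∑ y, rate β x y) := by
  have h1 : ∑ x, π x * walkGen β ψ x =
      ∑ x, ∑ y, π x * rate β x y * ψ y - ∑ x, ∑ y, π x * rate β x y * ψ x := by
    rw [← Finset.sum_sub_distrib]
    refine Finset.sum_congr rfl fun x _ => ?_
    rw [walkGen, Finset.mul_sum, ← Finset.sum_sub_distrib]
    exact Finset.sum_congr rfl fun y _ => by ring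
  rw [h1, Finset.sum_comm, ← Finset.sum_sub_distrib]
  refine Finset.sum_congr rfl fun x _ => ?_
  rw [mul_sub, Finset.mul_sum, Finset.mul_sum, Finset.mul_sum]
  congr 1 <;> exact Finset.sum_congr rfl fun y _ => by ring

theorem sum_erase_rate (hβ : Admissible β) (π : V → ℝ) (x : V) :
    ∑ y ∈ Finset.univ.erase x, π y * rate β y x = ∑ y, π y * rate β y x :=
  Finset.sum_erase _ (by rw [rate_self hβ, mul_zero])

theorem sum_erase_rate' (hβ : Admissible β) (x : V) :
    ∑ y ∈ Finset.univ.erase x, rate β x y = ∑ y, rate β x y :=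
  Finset.sum_erase _ (rate_self hβ x)

theorem isInvariantVector_iff (hβ : Admissible β) {π : V → ℝ} :
    IsInvariantVector β π ↔ (∀ x, 0 ≤ π x) ∧ ∑ x, π x = 1 ∧ Stationary β π := by
  unfold IsInvariantVector
  simp only [sum_erase_rate hβ, sum_erase_rate' hβ]
  refine and_congr_right fun _ => and_congr_right fun _ => ⟨fun h ψ => ?_, fun h x => ?_⟩
  · rw [sum_mul_walkGen]
    exact Finset.sum_eq_zero fun x _ => by rw [h x, sub_self, mul_zero]
  · have := h (Pi.single x 1)
    rw [sum_mul_walkGen] at this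
    simp only [Pi.single_apply, ite_mul, one_mul, zero_mul, Finset.sum_ite_eq', Finset.mem_univ,
      if_true] at this
    linarith

variable {π : V → ℝ}

theorem edgeWeight_nonneg (hπ : ∀ x, 0 ≤ π x) (x y : V) : 0 ≤ edgeWeight β π x y := by
  have := mul_nonneg (hπ x) (rate_nonneg (β := β) x y)
  have := mul_nonneg (hπ y) (rate_nonneg (β := β) y x)
  unfold edgeWeight
  linarith

theorem rwForm_eq (ψ : V → ℝ) :
    rwForm β π ψ = (1 / 2) * ∑ x, ∑ y, π x * rate β x y * (ψ y - ψ x) ^ 2 := by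
  have h : ∑ x, ∑ y, edgeWeight β π x y * (ψ y - ψ x) ^ 2 =
      (1 / 2) * ∑ x, ∑ y, π x * rate β x y * (ψ y - ψ x) ^ 2 +
        (1 / 2) * ∑ x, ∑ y, π y * rate β y x * (ψ y - ψ x) ^ 2 := by
    simp only [Finset.mul_sum, ← Finset.sum_add_distrib]
    refine Finset.sum_congr rfl fun x _ => Finset.sum_congr rfl fun y _ => ?_
    unfold edgeWeight
    ring
  rw [rwForm, h, Finset.sum_comm (f := fun x y => π y * rate β y x * (ψ y - ψ x) ^ 2)]
  have h' : ∑ x, ∑ y, π x * rate β x y * (ψ x - ψ y) ^ 2 =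
      ∑ x, ∑ y, π x * rate β x y * (ψ y - ψ x) ^ 2 :=
    Finset.sum_congr rfl fun x _ => Finset.sum_congr rfl fun y _ => by ring
  rw [h']
  ring

theorem Stationary.sum_rate_sub (hπ : Stationary β π) (g : V → ℝ) :
    ∑ x, ∑ y, π x * rate β x y * (g y - g x) = 0 := by
  rw [← hπ g]
  refine Finset.sum_congr rfl fun x _ => ?_
  rw [walkGen, Finset.mul_sum]
  exact Finset.sum_congr rfl fun y _ => by ring

/-- The random walk generator has the quadratic form `-rwForm`, for stationary but not necessarily
reversible weights. -/
theorem Stationary.sum_mul_walkGen_self (hπ : Stationary β π) (ψ : V → ℝ) :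
    ∑ x, π x * ψ x * walkGen β ψ x = -rwForm β π ψ := by
  have h1 := hπ.sum_rate_sub fun x => ψ x ^ 2
  have h2 : ∑ x, π x * ψ x * walkGen β ψ x =
      ∑ x, ∑ y, π x * rate β x y * (ψ x * (ψ y - ψ x)) := by
    refine Finset.sum_congr rfl fun x _ => ?_
    rw [walkGen, Finset.mul_sum]
    exact Finset.sum_congr rfl fun y _ => by ring
  have h3 : ∑ x, ∑ y, π x * rate β x y * (ψ y - ψ x) ^ 2 =
      ∑ x, ∑ y, π x * rate β x y * (ψ y ^ 2 - ψ x ^ 2) -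
        2 * ∑ x, ∑ y, π x * rate β x y * (ψ x * (ψ y - ψ x)) := by
    simp only [Finset.mul_sum, ← Finset.sum_sub_distrib]
    exact Finset.sum_congr rfl fun x _ => Finset.sum_congr rfl fun y _ => by ring
  rw [rwForm_eq, h3, h1, h2]
  ring

theorem rwForm_nonneg (hπ : ∀ x, 0 ≤ π x) (ψ : V → ℝ) : 0 ≤ rwForm β π ψ :=
  mul_nonneg (by norm_num) (Finset.sum_nonneg fun x _ => Finset.sum_nonneg fun y _ =>
    mul_nonneg (edgeWeight_nonneg hπ x y) (sq_nonneg _))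

/-- A function with zero Dirichlet form is constant, by irreducibility. -/
theorem eq_of_rwForm_eq_zero (hβ : Admissible β) (hirr : Irreducible₂ β) (hπ : ∀ x, 0 < π x)
    {ψ : V → ℝ} (h : rwForm β π ψ = 0) (x y : V) : ψ x = ψ y := by
  have hnn (x y : V) : 0 ≤ edgeWeight β π x y * (ψ y - ψ x) ^ 2 :=
    mul_nonneg (edgeWeight_nonneg (fun x => (hπ x).le) x y) (sq_nonneg _)
  have h' : ∑ x, ∑ y, edgeWeight β π x y * (ψ y - ψ x) ^ 2 = 0 := by
    unfold rwForm at h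
    linarith
  have hstep (a b : V) (hab : 0 < rate₂ β a b) : ψ a = ψ b := by
    have h1 := (Finset.sum_eq_zero_iff_of_nonneg fun x _ =>
      Finset.sum_nonneg fun y _ => hnn x y).1 h' a (Finset.mem_univ a)
    have h2 := (Finset.sum_eq_zero_iff_of_nonneg fun y _ => hnn a y).1 h1 b (Finset.mem_univ b)
    have h3 : 0 < edgeWeight β π a b := by
      have := mul_pos (hπ a) (hab.trans_le (rate₂_le_rate hβ a b))
      have := mul_nonneg (hπ b).le (rate_nonneg (β := β) b a)
      unfold edgeWeight
      linarith
    have h4 := (mul_eq_zero.1 h2).resolve_left h3.ne'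
    have := pow_eq_zero_iff (two_ne_zero) |>.1 h4
    linarith
  induction hirr x y with
  | single h => exact hstep _ _ h.2
  | tail _ h ih => exact ih.trans (hstep _ _ h.2)

theorem isInvariantVector_unique (hβ : Admissible β) (hirr : Irreducible₂ β) (hpos : ∀ x, 0 < π x)
    (hπ : IsInvariantVector β π) {π' : V → ℝ} (hπ' : IsInvariantVector β π') : π' = π := by
  obtain ⟨-, hsum, hst⟩ := (isInvariantVector_iff hβ).1 hπ
  obtain ⟨-, hsum', hst'⟩ := (isInvariantVector_iff hβ).1 hπ'
  have h1 := hst.sum_mul_walkGen_self fun x => π' x / π x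
  have h2 := hst' fun x => π' x / π x
  have h3 (x : V) : π x * (π' x / π x) = π' x := mul_div_cancel₀ _ (hpos x).ne'
  simp only [h3] at h1
  rw [h2] at h1
  have hc := eq_of_rwForm_eq_zero hβ hirr hpos (neg_eq_zero.1 h1.symm)
  ext x
  have h4 (y : V) : π' y = π y * (π' x / π x) := by rw [← hc y x, h3]
  have h5 : π' x / π x = 1 := by
    have : ∑ y, π' y = (∑ y, π y) * (π' x / π x) := by
      rw [Finset.sum_mul]
      exact Finset.sum_congr rfl fun y _ => h4 y
    rw [hsum, hsum', one_mul] at this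
    exact this.symm
  rw [h4 x, h5, mul_one]

/-! ### The variance as a Lyapunov function of the dual action -/

theorem rwVar_eq (h1 : ∑ x, π x = 1) (ψ : V → ℝ) :
    rwVar π ψ = ∑ x, π x * ψ x ^ 2 - (∑ x, π x * ψ x) ^ 2 := by
  set m := ∑ x, π x * ψ x with hm
  have (x : V) : π x * (ψ x - m) ^ 2 = π x * ψ x ^ 2 - 2 * m * (π x * ψ x) + m ^ 2 * π x := by ring
  simp only [rwVar, ← hm, this, Finset.sum_add_distrib, Finset.sum_sub_distrib, ← Finset.mul_sum,
    h1]
  ring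

theorem act_self (x : V) (p : Square) (ψ : V → ℝ) : act x x p ψ = ψ := by simp [act]

/-- Change of the variance under a single exchange: two terms that are linear in the defects `1 - u`
and `1 - v`, and the negative terms that integrate to `chi` and `sigma`. -/
theorem rwVar_act_sub (h1 : ∑ x, π x = 1) (a b : V) (p : Square) (ψ : V → ℝ) :
    rwVar π (act a b p ψ) - rwVar π ψ =
      π a * ((ψ b - ∑ x, π x * ψ x) ^ 2 - (ψ a - ∑ x, π x * ψ x) ^ 2) * (1 - (p.1 : ℝ)) +
      π b * ((ψ a - ∑ x, π x * ψ x) ^ 2 - (ψ b - ∑ x, π x * ψ x) ^ 2) * (1 - (p.2 : ℝ)) -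
      (ψ b - ψ a) ^ 2 *
        (π a * ((p.1 : ℝ) * (1 - (p.1 : ℝ))) + π b * ((p.2 : ℝ) * (1 - (p.2 : ℝ)))) -
      (ψ b - ψ a) ^ 2 * (π a * (1 - (p.1 : ℝ)) - π b * (1 - (p.2 : ℝ))) ^ 2 := by
  by_cases hab : a = b
  · subst hab
    rw [act_self]
    ring
  set c := ψ b - ψ a with hc
  have hsq : ∑ x, π x * act a b p ψ x ^ 2 = ∑ x, π x * ψ x ^ 2 +
      2 * c * (π a * ψ a * (1 - (p.1 : ℝ)) - π b * ψ b * (1 - (p.2 : ℝ))) +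
      c ^ 2 * (π a * (1 - (p.1 : ℝ)) ^ 2 + π b * (1 - (p.2 : ℝ)) ^ 2) := by
    have (x : V) : π x * act a b p ψ x ^ 2 = π x * ψ x ^ 2 +
        (if x = a then 2 * c * (π a * ψ a * (1 - (p.1 : ℝ))) + c ^ 2 * (π a * (1 - (p.1 : ℝ)) ^ 2)
          else 0) +
        (if x = b then -(2 * c * (π b * ψ b * (1 - (p.2 : ℝ)))) +
          c ^ 2 * (π b * (1 - (p.2 : ℝ)) ^ 2) else 0) := by
      simp only [act, Pi.add_apply, Pi.smul_apply, Pi.sub_apply, smul_eq_mul, Pi.single_apply, ← hc]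
      by_cases hxa : x = a
      · subst hxa
        simp only [if_neg hab, if_true]
        ring
      · by_cases hxb : x = b
        · subst hxb
          simp only [if_neg hxa, if_true]
          ring
        · simp only [if_neg hxa, if_neg hxb]
          ring
    simp only [this, Finset.sum_add_distrib, Finset.sum_ite_eq', Finset.mem_univ, if_true]
    ring
  have hmean : ∑ x, π x * act a b p ψ x = ∑ x, π x * ψ x +
      c * (π a * (1 - (p.1 : ℝ)) - π b * (1 - (p.2 : ℝ))) := by
    have (x : V) : π x * act a b p ψ x = π x * ψ x +
        (if x = a then c * (π a * (1 - (p.1 : ℝ))) else 0) -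
        (if x = b then c * (π b * (1 - (p.2 : ℝ))) else 0) := by
      simp only [act, Pi.add_apply, Pi.smul_apply, Pi.sub_apply, smul_eq_mul, Pi.single_apply, ← hc]
      by_cases hxa : x = a
      · subst hxa
        simp only [if_neg hab, if_true]
        ring
      · by_cases hxb : x = b
        · subst hxb
          simp only [if_neg hxa, if_true]
          ring
        · simp only [if_neg hxa, if_neg hxb]
          ring
    simp only [this, Finset.sum_add_distrib, Finset.sum_sub_distrib, Finset.sum_ite_eq',
      Finset.mem_univ, if_true]
    ring
  rw [rwVar_eq h1, rwVar_eq h1, hsq, hmean]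
  rw [hc]
  ring

theorem tame_rwVar_act (h1 : ∑ x, π x = 1) (a b : V) (ψ : V → ℝ) :
    Tame fun p => rwVar π (act a b p ψ) := by
  simp only [rwVar_eq h1]
  exact (Tame.sum _ fun x => (Tame.const _).mul ((tame_act a b x ψ).pow 2)).sub
    ((Tame.sum _ fun x => (Tame.const _).mul (tame_act a b x ψ)).pow 2)

/-- Under the dual action, the variance decreases at the rate given by `chi` and `sigma`. The
first-order terms cancel by stationarity. -/
theorem sum_integral_rwVar_act (hβ : Admissible β) (hπ : Stationary β π) (h1 : ∑ x, π x = 1)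
    (ψ : V → ℝ) :
    ∑ a, ∑ b, ∫ p, (rwVar π (act a b p ψ) - rwVar π ψ) ∂(β a b) =
      -((1 / 2) * ∑ a, ∑ b, (chi β π a b + sigma β π a b) * (ψ b - ψ a) ^ 2) := by
  rw [sum_integral_eq_symMeasure hβ (fun a b => (tame_rwVar_act h1 a b ψ).sub (Tame.const _))
    (fun a b => by simp [act_one]) (fun a b p => by rw [act_swap])]
  set g : V → ℝ := fun x => (ψ x - ∑ y, π y * ψ y) ^ 2 with hg
  have h (a b : V) : ∫ p, (rwVar π (act a b p ψ) - rwVar π ψ) ∂(symMeasure β a b) =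
      π a * rate β a b * (g b - g a) + π b * rate β b a * (g a - g b) -
        (chi β π a b + sigma β π a b) * (ψ b - ψ a) ^ 2 := by
    have t1 := (tame_one_sub_fst.integrable_symMeasure hβ (by simp) a b).const_mul
      (π a * (g b - g a))
    have t2 := (tame_one_sub_snd.integrable_symMeasure hβ (by simp) a b).const_mul
      (π b * (g a - g b))
    have t3 := ((((Tame.const (π a)).mul (Tame.fst.mul tame_one_sub_fst)).add
      ((Tame.const (π b)).mul (Tame.snd.mul tame_one_sub_snd))).integrable_symMeasure hβ
        (by simp) a b).const_mul ((ψ b - ψ a) ^ 2)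
    have t4 := (((((Tame.const (π a)).mul tame_one_sub_fst).sub
      ((Tame.const (π b)).mul tame_one_sub_snd)).pow 2).integrable_symMeasure hβ
        (by simp) a b).const_mul ((ψ b - ψ a) ^ 2)
    simp only [rwVar_act_sub h1]
    have e1 := integral_sub ((t1.add t2).sub t3) t4
    have e2 := integral_sub (t1.add t2) t3
    simp only [Pi.add_apply, Pi.sub_apply] at e1 e2
    rw [e1, e2, integral_add t1 t2, integral_const_mul, integral_const_mul, integral_const_mul,
      integral_const_mul, integral_one_sub_snd hβ, ← rate, ← chi, ← sigma]
    ring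
  have h0 := hπ.sum_rate_sub g
  simp only [h, Finset.sum_add_distrib, Finset.sum_sub_distrib, h0]
  rw [Finset.sum_comm (f := fun a b => π b * rate β b a * (g a - g b)), h0]
  ring

theorem chi_nonneg (hπ : ∀ x, 0 ≤ π x) (x y : V) : 0 ≤ chi β π x y := by
  refine integral_nonneg fun p => add_nonneg ?_ ?_
  · exact mul_nonneg (hπ x) (mul_nonneg p.1.2.1 (sub_nonneg.2 p.1.2.2))
  · exact mul_nonneg (hπ y) (mul_nonneg p.2.2.1 (sub_nonneg.2 p.2.2.2))

theorem sigma_nonneg (x y : V) : 0 ≤ sigma β π x y := integral_nonneg fun _ => sq_nonneg _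

theorem gammaConst_nonneg (hπ : ∀ x, 0 ≤ π x) : 0 ≤ gammaConst β π := by
  refine Real.sInf_nonneg ?_
  rintro _ ⟨x, y, -, hxy, rfl⟩
  exact div_nonneg (add_nonneg (chi_nonneg hπ x y) (sigma_nonneg x y)) hxy.le

theorem gammaConst_mul_le (hπ : ∀ x, 0 ≤ π x) {x y : V} (hne : x ≠ y) :
    gammaConst β π * edgeWeight β π x y ≤ chi β π x y + sigma β π x y := by
  rcases (edgeWeight_nonneg (β := β) hπ x y).eq_or_lt with h | h
  · rw [← h, mul_zero]
    exact add_nonneg (chi_nonneg hπ x y) (sigma_nonneg x y)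
  · rw [← le_div_iff₀ h]
    refine csInf_le ⟨0, ?_⟩ ⟨x, y, hne, h, rfl⟩
    rintro _ ⟨x, y, -, hxy, rfl⟩
    exact div_nonneg (add_nonneg (chi_nonneg hπ x y) (sigma_nonneg x y)) hxy.le

theorem rwVar_nonneg (hπ : ∀ x, 0 ≤ π x) (ψ : V → ℝ) : 0 ≤ rwVar π ψ :=
  Finset.sum_nonneg fun x _ => mul_nonneg (hπ x) (sq_nonneg _)

theorem rwVar_smul (t : ℝ) (ψ : V → ℝ) : rwVar π (t • ψ) = t ^ 2 * rwVar π ψ := by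
  simp only [rwVar, Pi.smul_apply, smul_eq_mul, Finset.mul_sum]
  refine Finset.sum_congr rfl fun x _ => ?_
  have : ∑ y, π y * (t * ψ y) = t * ∑ y, π y * ψ y := by
    rw [Finset.mul_sum]
    exact Finset.sum_congr rfl fun y _ => by ring
  rw [this]
  ring

theorem rwForm_smul (t : ℝ) (ψ : V → ℝ) : rwForm β π (t • ψ) = t ^ 2 * rwForm β π ψ := by
  simp only [rwForm, Pi.smul_apply, smul_eq_mul, Finset.mul_sum]
  exact Finset.sum_congr rfl fun x _ => Finset.sum_congr rfl fun y _ => by ring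

theorem gapRW_nonneg (hπ : ∀ x, 0 ≤ π x) : 0 ≤ gapRW β π := by
  refine Real.sInf_nonneg ?_
  rintro _ ⟨ψ, -, rfl⟩
  exact rwForm_nonneg hπ ψ

theorem gapRW_mul_rwVar_le (hπ : ∀ x, 0 ≤ π x) (ψ : V → ℝ) :
    gapRW β π * rwVar π ψ ≤ rwForm β π ψ := by
  rcases (rwVar_nonneg hπ ψ).eq_or_lt with h | h
  · rw [← h, mul_zero]
    exact rwForm_nonneg hπ ψ
  · rw [← le_div_iff₀ h]
    refine csInf_le ⟨0, ?_⟩ ⟨(Real.sqrt (rwVar π ψ))⁻¹ • ψ, ?_, ?_⟩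
    · rintro _ ⟨ψ, -, rfl⟩
      exact rwForm_nonneg hπ ψ
    · rw [rwVar_smul, inv_pow, Real.sq_sqrt h.le, inv_mul_cancel₀ h.ne']
    · rw [rwForm_smul, inv_pow, Real.sq_sqrt h.le, div_eq_inv_mul]

theorem sum_integral_rwVar_act_le (hβ : Admissible β) (hπ0 : ∀ x, 0 ≤ π x) (hπ : Stationary β π)
    (h1 : ∑ x, π x = 1) (ψ : V → ℝ) :
    ∑ a, ∑ b, ∫ p, (rwVar π (act a b p ψ) - rwVar π ψ) ∂(β a b) ≤
      -(gammaConst β π * gapRW β π * rwVar π ψ) := by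
  rw [sum_integral_rwVar_act hβ hπ h1]
  have h2 : gammaConst β π * rwForm β π ψ ≤
      (1 / 2) * ∑ a, ∑ b, (chi β π a b + sigma β π a b) * (ψ b - ψ a) ^ 2 := by
    unfold rwForm
    rw [mul_left_comm, Finset.mul_sum]
    refine mul_le_mul_of_nonneg_left (Finset.sum_le_sum fun a _ => ?_) (by norm_num)
    rw [Finset.mul_sum]
    refine Finset.sum_le_sum fun b _ => ?_
    by_cases hab : a = b
    · simp [hab]
    · rw [← mul_assoc]
      exact mul_le_mul_of_nonneg_right (gammaConst_mul_le hπ0 hab) (sq_nonneg _)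
  have h3 := mul_le_mul_of_nonneg_left (gapRW_mul_rwVar_le (β := β) hπ0 ψ)
    (gammaConst_nonneg (β := β) hπ0)
  rw [mul_assoc]
  linarith

end RandomWalk

/-! ### The dual maximum principle -/

section MaximumPrinciple

variable {V : Type*} [DecidableEq V] [Fintype V] {β : V → V → Measure Square}

/-- A function behaving like a positive definite quadratic form on functions modulo constants,
on which the dual action decreases at rate at least `c`. -/
structure IsLyapunov (β : V → V → Measure Square) (W : (V → ℝ) → ℝ) (c : ℝ) : Prop where
  continuous : Continuous W
  smul : ∀ (t : ℝ) (ψ : V → ℝ), W (t • ψ) = t ^ 2 * W ψ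
  shift : ∀ (ψ : V → ℝ) (t : ℝ), W (ψ + fun _ => t) = W ψ
  pos : ∀ ψ : V → ℝ, (∃ x y, ψ x ≠ ψ y) → 0 < W ψ
  integrable : ∀ a b ψ, Integrable (fun p => W (act a b p ψ) - W ψ) (β a b)
  sum_integral_le : ∀ ψ, ∑ a, ∑ b, ∫ p, (W (act a b p ψ) - W ψ) ∂(β a b) ≤ -(c * W ψ)

/-- A compact set of representatives of the nonconstant functions, up to shifts and scaling. -/
def unitSection (o : V) : Set (V → ℝ) := {ψ | ψ o = 0 ∧ ∑ x, ψ x ^ 2 = 1}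

theorem isCompact_unitSection (o : V) : IsCompact (unitSection o) := by
  refine (isCompact_univ_pi fun _ : V => isCompact_Icc (a := (-1 : ℝ)) (b := 1)).of_isClosed_subset
    ((isClosed_eq (by fun_prop) (by fun_prop)).inter (isClosed_eq (by fun_prop) (by fun_prop)))
    fun ψ hψ x _ => ?_
  have : ψ x ^ 2 ≤ 1 := by
    rw [← hψ.2]
    exact Finset.single_le_sum (fun y _ => sq_nonneg (ψ y)) (Finset.mem_univ x)
  exact abs_le.1 (by rwa [sq_le_one_iff_abs_le_one] at this)

theorem exists_ne_of_mem_unitSection {o : V} {ψ : V → ℝ} (h : ψ ∈ unitSection o) :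
    ∃ x y, ψ x ≠ ψ y := by
  by_contra! hc
  have : ∑ x, ψ x ^ 2 = 0 := Finset.sum_eq_zero fun x _ => by rw [hc x o, h.1]; norm_num
  rw [h.2] at this
  norm_num at this

theorem exists_mem_unitSection (o : V) {ψ : V → ℝ} (h : ∃ x y, ψ x ≠ ψ y) :
    ∃ r : ℝ, 0 < r ∧ ∃ φ ∈ unitSection o, ψ = r • φ + fun _ => ψ o := by
  set S := ∑ x, (ψ x - ψ o) ^ 2 with hS
  have hS0 : 0 < S := by
    obtain ⟨x, y, hxy⟩ := h
    refine lt_of_le_of_ne (Finset.sum_nonneg fun x _ => sq_nonneg _) fun h0 => hxy ?_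
    have h1 (x : V) : ψ x = ψ o := by
      have := (Finset.sum_eq_zero_iff_of_nonneg fun x _ => sq_nonneg (ψ x - ψ o)).1 h0.symm x
        (Finset.mem_univ x)
      have := pow_eq_zero_iff (two_ne_zero) |>.1 this
      linarith
    rw [h1 x, h1 y]
  have hr : 0 < Real.sqrt S := Real.sqrt_pos.2 hS0
  refine ⟨Real.sqrt S, hr, fun x => (Real.sqrt S)⁻¹ * (ψ x - ψ o), ⟨by simp, ?_⟩, ?_⟩
  · simp only [mul_pow, ← Finset.mul_sum, inv_pow, Real.sq_sqrt hS0.le]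
    exact inv_mul_cancel₀ hS0.ne'
  · ext x
    simp only [Pi.add_apply, Pi.smul_apply, smul_eq_mul]
    rw [mul_inv_cancel_left₀ hr.ne', sub_add_cancel]

theorem unitSection_nonempty [Nontrivial V] (o : V) : (unitSection o).Nonempty := by
  obtain ⟨z, hz⟩ := exists_ne o
  obtain ⟨r, -, φ, hφ, -⟩ := exists_mem_unitSection o (ψ := Pi.single z 1)
    ⟨z, o, by simp [hz.symm]⟩
  exact ⟨φ, hφ⟩

/-- The tuples of functions with values in `[0, 1]`. The dual action preserves this set. -/
def cube (m : ℕ) (V : Type*) : Set (Fin m → V → ℝ) := Set.Icc 0 1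

theorem act_mem_cube {m : ℕ} {χ : Fin m → V → ℝ} (hχ : χ ∈ cube m V) (a b : V) (p : Square) :
    (fun j => act a b p (χ j)) ∈ cube m V := by
  have h0 (j : Fin m) (z : V) : 0 ≤ χ j z := hχ.1 j z
  have h1 (j : Fin m) (z : V) : χ j z ≤ 1 := hχ.2 j z
  have hu0 := p.1.2.1
  have hu1 := p.1.2.2
  have hv0 := p.2.2.1
  have hv1 := p.2.2.2
  suffices ∀ j z, 0 ≤ act a b p (χ j) z ∧ act a b p (χ j) z ≤ 1 from
    ⟨fun j z => (this j z).1, fun j z => (this j z).2⟩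
  intro j z
  by_cases hab : a = b
  · subst hab
    rw [act_self]
    exact ⟨h0 j z, h1 j z⟩
  have hz : act a b p (χ j) z = if z = a then p.1 * χ j a + (1 - p.1) * χ j b
      else if z = b then p.2 * χ j b + (1 - p.2) * χ j a else χ j z := by
    simp only [act, Pi.add_apply, Pi.smul_apply, Pi.sub_apply, smul_eq_mul, Pi.single_apply]
    by_cases hza : z = a
    · subst hza
      simp only [if_neg hab, if_true]
      ring
    · by_cases hzb : z = b
      · subst hzb
        simp only [if_neg hza, if_true]
        ring
      · simp only [if_neg hza, if_neg hzb]
        ring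
  rw [hz]
  have ha0 := h0 j a
  have hb0 := h0 j b
  have ha1 := h1 j a
  have hb1 := h1 j b
  split_ifs
  · constructor
    · have := mul_nonneg hu0 ha0
      have := mul_nonneg (sub_nonneg.2 hu1) hb0
      linarith
    · have := mul_le_mul_of_nonneg_left ha1 hu0
      have := mul_le_mul_of_nonneg_left hb1 (sub_nonneg.2 hu1)
      linarith
  · constructor
    · have := mul_nonneg hv0 hb0
      have := mul_nonneg (sub_nonneg.2 hv1) ha0
      linarith
    · have := mul_le_mul_of_nonneg_left hb1 hv0
      have := mul_le_mul_of_nonneg_left ha1 (sub_nonneg.2 hv1)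
      linarith
  · exact ⟨h0 j z, h1 j z⟩

theorem act_cons {k : ℕ} (a b : V) (p : Square) (ψ : V → ℝ) (χ : Fin k → V → ℝ) :
    (fun j => act a b p ((Fin.cons ψ χ : Fin (k + 1) → V → ℝ) j)) =
      Fin.cons (act a b p ψ) fun j => act a b p (χ j) := by
  ext j
  refine Fin.cases ?_ (fun j => ?_) j <;> simp

/-- The tuple consisting of `ψ`, `ψ` and `χ`. -/
def doubled {m : ℕ} (ψ : V → ℝ) (χ : Fin m → V → ℝ) : Fin (m + 2) → V → ℝ :=
  Fin.cons ψ (Fin.cons ψ χ : Fin (m + 1) → V → ℝ)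

theorem act_doubled {m : ℕ} (a b : V) (p : Square) (ψ : V → ℝ) (χ : Fin m → V → ℝ) :
    (fun j => act a b p (doubled ψ χ j)) = doubled (act a b p ψ) fun j => act a b p (χ j) := by
  unfold doubled
  rw [act_cons, act_cons]

theorem prodLin_doubled {m : ℕ} (ψ : V → ℝ) (χ : Fin m → V → ℝ) :
    prodLin (doubled ψ χ) = lin ψ * (lin ψ * prodLin χ) := by
  rw [doubled, prodLin_cons, prodLin_cons]

theorem continuous_doubled {m : ℕ} :
    Continuous fun q : (V → ℝ) × (Fin m → V → ℝ) => doubled q.1 q.2 := by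
  refine continuous_pi fun j => ?_
  refine Fin.cases ?_ (fun j => ?_) j
  · exact continuous_fst
  · refine Fin.cases ?_ (fun j => ?_) j
    · exact continuous_fst
    · exact (continuous_apply j).comp continuous_snd

theorem continuous_functional_prodLin {k : ℕ} (Λ : C(Simplex V, ℂ) →ₗ[ℝ] ℝ) :
    Continuous fun χ : Fin k → V → ℝ => Λ (prodLin χ) := by
  have (χ : Fin k → V → ℝ) : Λ (prodLin χ) = ∑ y, (∏ j, χ j (y j)) * Λ (mono y) := by
    rw [prodLin_eq, map_sum]
    refine Finset.sum_congr rfl fun y _ => ?_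
    rw [← smul_eq_mul, ← map_smul]
    rfl
  simp only [this]
  fun_prop

theorem mono_eq_cons {k : ℕ} (y : Fin (k + 1) → V) :
    mono y = lin (Pi.single (y 0) 1) * mono (fun j => y j.succ) := by
  simp [mono, Fin.prod_univ_succ]

theorem smul_real_eq (t : ℝ) (f : C(Simplex V, ℂ)) : (t : ℂ) • f = t • f := rfl

/-- A real functional that vanishes on polynomials of smaller degree only sees `ψ` up to constants,
and scales quadratically in it. -/
theorem functional_doubled {m : ℕ} {Λ : C(Simplex V, ℂ) →ₗ[ℝ] ℝ}
    (h0 : ∀ f ∈ polySpace V (m + 1), Λ f = 0) (χ : Fin m → V → ℝ) (r t : ℝ) (φ : V → ℝ) :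
    Λ (prodLin (doubled (r • φ + fun _ => t) χ)) = r ^ 2 * Λ (prodLin (doubled φ χ)) := by
  have hm := lin_mul_mem φ (prodLin_mem χ)
  have hm' : prodLin χ ∈ polySpace V (m + 1) := polySpace_mono (Nat.le_succ m) (prodLin_mem χ)
  have : prodLin (doubled (r • φ + fun _ => t) χ) =
      (r ^ 2) • prodLin (doubled φ χ) + ((2 * r * t) • (lin φ * prodLin χ) +
        (t ^ 2) • prodLin χ) := by
    rw [prodLin_doubled, prodLin_doubled, lin_add, lin_smul, lin_const]
    ext η
    simp only [ContinuousMap.mul_apply, ContinuousMap.add_apply, ContinuousMap.smul_apply,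
      ContinuousMap.one_apply, smul_eq_mul, Complex.real_smul]
    push_cast
    ring
  rw [this, map_add, map_add, map_smul, map_smul, map_smul, h0 _ hm, h0 _ hm']
  simp

/-- A real functional on polynomials of degree `m + 2` is determined by its values on products
`(lin ψ) ^ 2 * prodLin χ`, with `χ` in the cube. -/
theorem exists_doubled_ne_zero {m : ℕ} {Λ : C(Simplex V, ℂ) →ₗ[ℝ] ℝ}
    (hne : ∃ y : Fin (m + 2) → V, Λ (mono y) ≠ 0) :
    ∃ ψ : V → ℝ, ∃ χ ∈ cube m V, Λ (prodLin (doubled ψ χ)) ≠ 0 := by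
  obtain ⟨y, hy⟩ := hne
  by_contra! h
  let χ : Fin m → V → ℝ := fun j => Pi.single (y j.succ.succ) 1
  have hχ : χ ∈ cube m V := by
    refine ⟨fun j z => ?_, fun j z => ?_⟩ <;> by_cases hz : z = y j.succ.succ <;>
      simp [χ, hz]
  set e : V → ℝ := Pi.single (y 0) 1
  set e' : V → ℝ := Pi.single (y 1) 1
  have h1 := h (e + e') χ hχ
  have h2 := h e χ hχ
  have h3 := h e' χ hχ
  have : prodLin (doubled (e + e') χ) =
      prodLin (doubled e χ) + prodLin (doubled e' χ) + (2 : ℝ) • mono y := by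
    rw [prodLin_doubled, prodLin_doubled, prodLin_doubled, mono_eq_cons, mono_eq_cons, lin_add]
    ext η
    simp only [ContinuousMap.mul_apply, ContinuousMap.add_apply, ContinuousMap.smul_apply,
      Complex.real_smul]
    change (lin e η + lin e' η) * ((lin e η + lin e' η) * prodLin χ η) =
      lin e η * (lin e η * prodLin χ η) + lin e' η * (lin e' η * prodLin χ η) +
        ((2 : ℝ) : ℂ) * (lin e η * (lin e' η * prodLin χ η))
    push_cast
    ring
  rw [this, map_add, map_add, map_smul, h2, h3] at h1
  simp only [zero_add, smul_eq_mul, mul_eq_zero, OfNat.ofNat_ne_zero, false_or] at h1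
  exact hy h1

/-- **Dual maximum principle**: a Lyapunov function for the dual action on quadratic forms bounds
from below the decay rate of eigenfunctionals of every degree `≥ 2`. One compares with the Lyapunov
function at the point where the ratio is maximal; the additional factors stay in the cube. -/
theorem IsLyapunov.le_rate [Nontrivial V] (hβ : Admissible β) {W : (V → ℝ) → ℝ} {c lam : ℝ}
    (hW : IsLyapunov β W c) {m : ℕ} {Λ : C(Simplex V, ℂ) →ₗ[ℝ] ℝ}
    (h0 : ∀ f ∈ polySpace V (m + 1), Λ f = 0) (hne : ∃ y : Fin (m + 2) → V, Λ (mono y) ≠ 0)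
    (heig : ∀ χ : Fin (m + 2) → V → ℝ,
      ∑ a, ∑ b, ∫ p, (Λ (prodLin fun j => act a b p (χ j)) - Λ (prodLin χ)) ∂(β a b) =
        -(lam * Λ (prodLin χ))) : c ≤ lam := by
  obtain ⟨o⟩ : Nonempty V := inferInstance
  set G : (V → ℝ) → (Fin m → V → ℝ) → ℝ := fun ψ χ => Λ (prodLin (doubled ψ χ)) with hG
  have hGc : Continuous fun q : (V → ℝ) × (Fin m → V → ℝ) => G q.1 q.2 :=
    (continuous_functional_prodLin Λ).comp continuous_doubled
  have hWpos (ψ) (hψ : ψ ∈ unitSection o) : 0 < W ψ :=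
    hW.pos ψ (exists_ne_of_mem_unitSection hψ)
  have hWhom (r t : ℝ) (φ : V → ℝ) : W (r • φ + fun _ => t) = r ^ 2 * W φ := by
    rw [hW.shift, hW.smul]
  have hK : IsCompact (unitSection o ×ˢ cube m V) := by
    refine (isCompact_unitSection o).prod ?_
    have : cube m V = Set.univ.pi fun _ => Set.univ.pi fun _ => Set.Icc (0 : ℝ) 1 := by
      ext χ
      simp only [cube, Set.mem_Icc, Set.mem_univ_pi, Pi.le_def, Pi.zero_apply, Pi.one_apply]
      exact ⟨fun h j z => ⟨h.1 j z, h.2 j z⟩, fun h => ⟨fun j z => (h j z).1, fun j z => (h j z).2⟩⟩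
    rw [this]
    exact isCompact_univ_pi fun _ => isCompact_univ_pi fun _ => isCompact_Icc
  have hKne : (unitSection o ×ˢ cube m V).Nonempty :=
    (unitSection_nonempty o).prod ⟨0, le_rfl, fun _ _ => zero_le_one⟩
  have hcont : ContinuousOn (fun q : (V → ℝ) × (Fin m → V → ℝ) => |G q.1 q.2| / W q.1)
      (unitSection o ×ˢ cube m V) := by
    have hW1 : Continuous fun q : (V → ℝ) × (Fin m → V → ℝ) => W q.1 :=
      hW.continuous.comp continuous_fst
    exact (continuous_abs.comp hGc).continuousOn.div hW1.continuousOn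
      fun q hq => (hWpos q.1 hq.1).ne'
  -- the ratio is invariant under scaling and shifting, so its maximum over this compact set bounds
  -- it for all functions
  obtain ⟨⟨ψ, χ⟩, ⟨hψ, hχ⟩, hmax⟩ := hK.exists_isMaxOn hKne hcont
  have hmax' (φ : V → ℝ) (hφ : φ ∈ unitSection o) (ξ : Fin m → V → ℝ) (hξ : ξ ∈ cube m V) :
      |G φ ξ| / W φ ≤ |G ψ χ| / W ψ := isMaxOn_iff.1 hmax (φ, ξ) ⟨hφ, hξ⟩
  set M := |G ψ χ| / W ψ with hM
  have hWψ := hWpos ψ hψ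
  have hbound (φ : V → ℝ) (ξ : Fin m → V → ℝ) (hξ : ξ ∈ cube m V) : |G φ ξ| ≤ M * W φ := by
    by_cases hφ : ∃ x y, φ x ≠ φ y
    · obtain ⟨r, hr, φ', hφ', heq⟩ := exists_mem_unitSection o hφ
      have h1 : |G φ' ξ| / W φ' ≤ M := hmax' φ' hφ' ξ hξ
      rw [div_le_iff₀ (hWpos φ' hφ')] at h1
      have h2 : G φ ξ = r ^ 2 * G φ' ξ := by
        rw [heq]
        exact functional_doubled h0 ξ r (φ o) φ'
      rw [h2]
      conv_rhs => rw [heq, hWhom]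
      rw [abs_mul, abs_of_pos (pow_pos hr 2)]
      calc r ^ 2 * |G φ' ξ| ≤ r ^ 2 * (M * W φ') :=
            mul_le_mul_of_nonneg_left h1 (sq_nonneg r)
        _ = M * (r ^ 2 * W φ') := by ring
    · push Not at hφ
      have heq : φ = (0 : ℝ) • (0 : V → ℝ) + fun _ => φ o := by
        ext x
        simp [hφ x o]
      have h2 : G φ ξ = 0 := by
        rw [heq]
        exact (functional_doubled h0 ξ 0 (φ o) 0).trans (by ring)
      have h3 : W φ = 0 := by
        rw [heq, hWhom]
        ring
      rw [h2, h3, abs_zero, mul_zero]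
  have hGM : |G ψ χ| = M * W ψ := by rw [hM, div_mul_cancel₀ _ hWψ.ne']
  have hMpos : 0 < M := by
    obtain ⟨φ, ξ, hξ, hne'⟩ := exists_doubled_ne_zero hne
    have h1 : 0 < |G φ ξ| := abs_pos.2 hne'
    have h2 : 0 ≤ M := div_nonneg (abs_nonneg _) hWψ.le
    refine lt_of_le_of_ne h2 fun h3 => ?_
    have := hbound φ ξ hξ
    rw [← h3, zero_mul] at this
    linarith
  obtain ⟨ε, hε, hεG⟩ : ∃ ε : ℝ, |ε| = 1 ∧ ε * G ψ χ = M * W ψ := by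
    rcases abs_cases (G ψ χ) with ⟨h, -⟩ | ⟨h, -⟩
    · exact ⟨1, abs_one, by rw [one_mul, ← h, hGM]⟩
    · exact ⟨-1, by simp, by rw [neg_one_mul, ← h, hGM]⟩
  -- as `ε * G ≤ M * W` with equality at `(ψ, χ)`, the same inequality holds between the increments
  have h1 := heig (doubled ψ χ)
  have h2 : ε * (∑ a, ∑ b, ∫ p, (Λ (prodLin fun j => act a b p (doubled ψ χ j)) -
      Λ (prodLin (doubled ψ χ))) ∂(β a b)) ≤
      M * ∑ a, ∑ b, ∫ p, (W (act a b p ψ) - W ψ) ∂(β a b) := by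
    simp only [Finset.mul_sum]
    refine Finset.sum_le_sum fun a _ => Finset.sum_le_sum fun b _ => ?_
    rw [← integral_const_mul, ← integral_const_mul]
    refine integral_mono ((integrable_functional_prodLin hβ _ Λ a b).const_mul ε)
      ((hW.integrable a b ψ).const_mul M) fun p => ?_
    simp only [act_doubled]
    have h3 : ε * G (act a b p ψ) (fun j => act a b p (χ j)) ≤ M * W (act a b p ψ) := by
      refine (le_abs_self _).trans ?_
      rw [abs_mul, hε, one_mul]
      exact hbound _ _ (act_mem_cube hχ a b p)
    rw [mul_sub, mul_sub]
    have h4 : ε * Λ (prodLin (doubled ψ χ)) = M * W ψ := hεG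
    rw [h4]
    exact sub_le_sub_right h3 _
  rw [h1] at h2
  have h3 := mul_le_mul_of_nonneg_left (hW.sum_integral_le ψ) hMpos.le
  have h4 : ε * -(lam * Λ (prodLin (doubled ψ χ))) = -(lam * (M * W ψ)) := by
    rw [← hεG, hG]
    ring
  rw [h4] at h2
  have h5 : c * (M * W ψ) ≤ lam * (M * W ψ) := by linarith
  exact le_of_mul_le_mul_right h5 (mul_pos hMpos hWψ)

/-! ### Lyapunov functions -/

theorem rwVar_pos {π : V → ℝ} (hπ : ∀ x, 0 < π x) {ψ : V → ℝ} (h : ∃ x y, ψ x ≠ ψ y) :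
    0 < rwVar π ψ := by
  refine lt_of_le_of_ne (rwVar_nonneg (fun x => (hπ x).le) ψ) fun h0 => ?_
  obtain ⟨x, y, hxy⟩ := h
  have h1 (x : V) : ψ x = ∑ y, π y * ψ y := by
    have := (Finset.sum_eq_zero_iff_of_nonneg fun x _ =>
      mul_nonneg (hπ x).le (sq_nonneg (ψ x - ∑ y, π y * ψ y))).1 h0.symm x (Finset.mem_univ x)
    have := (mul_eq_zero.1 this).resolve_left (hπ x).ne'
    have := pow_eq_zero_iff (two_ne_zero) |>.1 this
    linarith
  exact hxy ((h1 x).trans (h1 y).symm)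

theorem isLyapunov_rwVar (hβ : Admissible β) {π : V → ℝ} (hπ : ∀ x, 0 < π x)
    (h1 : ∑ x, π x = 1) (hst : Stationary β π) :
    IsLyapunov β (rwVar π) (gammaConst β π * gapRW β π) where
  continuous := by
    unfold rwVar
    fun_prop
  smul := rwVar_smul
  shift ψ t := by
    have : ∑ x, π x * (ψ x + t) = ∑ x, π x * ψ x + t := by
      simp only [mul_add, Finset.sum_add_distrib, ← Finset.sum_mul, h1, one_mul]
    simp only [rwVar, Pi.add_apply, this, add_sub_add_right_eq_sub]
  pos _ := rwVar_pos hπ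
  integrable a b ψ :=
    (tame_rwVar_act h1 a b ψ).integrable (hβ.integrable_defect a b) (by simp [act_one])
  sum_integral_le := sum_integral_rwVar_act_le hβ (fun x => (hπ x).le) hst h1

end MaximumPrinciple

/-! ### Resolvents as Lyapunov functions -/

section Resolvent

open Filter Topology

variable {V : Type*} [DecidableEq V] [Fintype V] {β : V → V → Measure Square}
  {I : Type*} [Fintype I]

/-- The square of a linear form. -/
def linSq (ψ : V → ℝ) : C(Simplex V, ℂ) := prodLin (doubled ψ (0 : Fin 0 → V → ℝ))

theorem linSq_apply (ψ : V → ℝ) (η : Simplex V) : linSq ψ η = lin ψ η * lin ψ η := by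
  rw [linSq, prodLin_doubled]
  simp [prodLin]

theorem linSq_mem (ψ : V → ℝ) : linSq ψ ∈ polySpace V 2 := prodLin_mem _

theorem act_doubled_zero (a b : V) (p : Square) (ψ : V → ℝ) :
    (fun j => act a b p (doubled ψ (0 : Fin 0 → V → ℝ) j)) = doubled (act a b p ψ) 0 := by
  rw [act_doubled]
  congr 1
  exact Subsingleton.elim _ _

/-- The quadratic form obtained by applying the resolvent at `-t` to `∑ i, Θ i`, where the
functionals `Θ i` are eigenfunctionals of the generator with decay rates `lam i`. -/
def resolventForm (Θ : I → C(Simplex V, ℂ) →ₗ[ℝ] ℝ) (lam : I → ℝ) (t : ℝ) (ψ : V → ℝ) : ℝ :=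
  ∑ i, (lam i - t)⁻¹ * Θ i (linSq ψ)

variable {Θ : I → C(Simplex V, ℂ) →ₗ[ℝ] ℝ} {lam : I → ℝ}

theorem resolventForm_eq (t : ℝ) (ψ : V → ℝ) :
    resolventForm Θ lam t ψ = (∑ i, (lam i - t)⁻¹ • Θ i) (linSq ψ) := by
  simp [resolventForm, LinearMap.sum_apply]

theorem continuous_resolventForm (t : ℝ) : Continuous (resolventForm Θ lam t) := by
  have h : Continuous fun ψ : V → ℝ => (ψ, (0 : Fin 0 → V → ℝ)) := by fun_prop
  have := ((continuous_functional_prodLin (∑ i, (lam i - t)⁻¹ • Θ i)).comp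
    continuous_doubled).comp h
  exact this.congr fun ψ => (resolventForm_eq t ψ).symm

theorem resolventForm_hom (h0 : ∀ i, ∀ f ∈ polySpace V 1, Θ i f = 0) (t r s : ℝ) (φ : V → ℝ) :
    resolventForm Θ lam t (r • φ + fun _ => s) = r ^ 2 * resolventForm Θ lam t φ := by
  simp only [resolventForm, Finset.mul_sum]
  refine Finset.sum_congr rfl fun i _ => ?_
  have := functional_doubled (m := 0) (h0 i) 0 r s φ
  unfold linSq
  rw [this]
  ring

theorem integrable_resolventForm (hβ : Admissible β) (t : ℝ) (a b : V) (ψ : V → ℝ) :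
    Integrable (fun p => resolventForm Θ lam t (act a b p ψ) - resolventForm Θ lam t ψ)
      (β a b) := by
  have := integrable_functional_prodLin hβ (doubled ψ (0 : Fin 0 → V → ℝ))
    (∑ i, (lam i - t)⁻¹ • Θ i) a b
  simp only [act_doubled_zero] at this
  simp only [resolventForm_eq]
  exact this

/-- The resolvent form `W` satisfies `L W = -S - t W`, where `S = ∑ i, Θ i`. -/
theorem sum_integral_resolventForm (hβ : Admissible β)
    (heig : ∀ i, ∀ χ : Fin 2 → V → ℝ,
      ∑ a, ∑ b, ∫ p, (Θ i (prodLin fun j => act a b p (χ j)) - Θ i (prodLin χ)) ∂(β a b) =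
        -(lam i * Θ i (prodLin χ)))
    {t : ℝ} (ht : ∀ i, t < lam i) (ψ : V → ℝ) :
    ∑ a, ∑ b, ∫ p, (resolventForm Θ lam t (act a b p ψ) - resolventForm Θ lam t ψ) ∂(β a b) =
      -(∑ i, Θ i (linSq ψ)) - t * resolventForm Θ lam t ψ := by
  have h1 (a b : V) :
      ∫ p, (resolventForm Θ lam t (act a b p ψ) - resolventForm Θ lam t ψ) ∂(β a b) =
      ∑ i, (lam i - t)⁻¹ * ∫ p, (Θ i (linSq (act a b p ψ)) - Θ i (linSq ψ)) ∂(β a b) := by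
    have h (i : I) :
        Integrable (fun p => Θ i (linSq (act a b p ψ)) - Θ i (linSq ψ)) (β a b) := by
      have := integrable_functional_prodLin hβ (doubled ψ (0 : Fin 0 → V → ℝ)) (Θ i) a b
      simp only [act_doubled_zero] at this
      exact this
    simp only [resolventForm, ← Finset.sum_sub_distrib, ← mul_sub]
    rw [integral_finsetSum _ fun i _ => (h i).const_mul _]
    simp only [integral_const_mul]
  have h2 (i : I) : ∑ a, ∑ b, ∫ p, (Θ i (linSq (act a b p ψ)) - Θ i (linSq ψ)) ∂(β a b) =
      -(lam i * Θ i (linSq ψ)) := by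
    have := heig i (doubled ψ 0)
    simp only [act_doubled_zero] at this
    exact this
  have h3 : ∑ a, ∑ b, ∑ i, (lam i - t)⁻¹ *
      ∫ p, (Θ i (linSq (act a b p ψ)) - Θ i (linSq ψ)) ∂(β a b) =
      ∑ i, (lam i - t)⁻¹ *
        ∑ a, ∑ b, ∫ p, (Θ i (linSq (act a b p ψ)) - Θ i (linSq ψ)) ∂(β a b) := by
    simp only [Finset.mul_sum]
    rw [Finset.sum_comm (s := Finset.univ (α := I))]
    refine Finset.sum_congr rfl fun a _ => ?_
    rw [Finset.sum_comm]
  simp only [h1, h3, h2]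
  rw [resolventForm, Finset.mul_sum, ← Finset.sum_neg_distrib, ← Finset.sum_sub_distrib]
  refine Finset.sum_congr rfl fun i _ => ?_
  have : lam i - t ≠ 0 := (sub_pos.2 (ht i)).ne'
  field_simp
  ring

theorem resolventForm_nonneg_of (h0 : ∀ i, ∀ f ∈ polySpace V 1, Θ i f = 0) {t : ℝ} (o : V)
    (h : ∀ φ ∈ unitSection o, 0 ≤ resolventForm Θ lam t φ) (ψ : V → ℝ) :
    0 ≤ resolventForm Θ lam t ψ := by
  by_cases hψ : ∃ x y, ψ x ≠ ψ y
  · obtain ⟨r, hr, φ, hφ, heq⟩ := exists_mem_unitSection o hψ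
    rw [heq, resolventForm_hom h0]
    exact mul_nonneg (sq_nonneg r) (h φ hφ)
  · push Not at hψ
    have heq : ψ = (0 : ℝ) • (0 : V → ℝ) + fun _ => ψ o := by
      ext x
      simp [hψ x o]
    rw [heq, resolventForm_hom h0]
    simp

/-- At `t = 0` the resolvent form is positive: otherwise compare with a nonincreasing positive form
at the point where the ratio is minimal. -/
theorem resolventForm_zero_pos [Nontrivial V] (hβ : Admissible β) {U : (V → ℝ) → ℝ}
    (hU : IsLyapunov β U 0) (h0 : ∀ i, ∀ f ∈ polySpace V 1, Θ i f = 0)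
    (heig : ∀ i, ∀ χ : Fin 2 → V → ℝ,
      ∑ a, ∑ b, ∫ p, (Θ i (prodLin fun j => act a b p (χ j)) - Θ i (prodLin χ)) ∂(β a b) =
        -(lam i * Θ i (prodLin χ)))
    (hS : ∀ ψ : V → ℝ, (∃ x y, ψ x ≠ ψ y) → 0 < ∑ i, Θ i (linSq ψ))
    (hlam : ∀ i, 0 < lam i) (o : V) :
    ∀ φ ∈ unitSection o, 0 < resolventForm Θ lam 0 φ := by
  have hUpos (ψ) (hψ : ψ ∈ unitSection o) : 0 < U ψ := hU.pos ψ (exists_ne_of_mem_unitSection hψ)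
  obtain ⟨ψ, hψ, hmin⟩ := (isCompact_unitSection o).exists_isMinOn (unitSection_nonempty o)
    ((continuous_resolventForm (Θ := Θ) (lam := lam) 0).continuousOn.div hU.continuous.continuousOn
      fun q hq => (hUpos q hq).ne')
  have hmin' (φ : V → ℝ) (hφ : φ ∈ unitSection o) :
      resolventForm Θ lam 0 ψ / U ψ ≤ resolventForm Θ lam 0 φ / U φ := isMinOn_iff.1 hmin φ hφ
  set m := resolventForm Θ lam 0 ψ / U ψ with hm
  by_contra! hneg
  obtain ⟨φ, hφ, hφneg⟩ := hneg
  have hm0 : m ≤ 0 := (hmin' φ hφ).trans (div_nonpos_of_nonpos_of_nonneg hφneg (hUpos φ hφ).le)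
  have hbound (φ : V → ℝ) : m * U φ ≤ resolventForm Θ lam 0 φ := by
    by_cases hφ : ∃ x y, φ x ≠ φ y
    · obtain ⟨r, hr, φ', hφ', heq⟩ := exists_mem_unitSection o hφ
      have h1 := hmin' φ' hφ'
      rw [le_div_iff₀ (hUpos φ' hφ')] at h1
      rw [heq, resolventForm_hom h0, hU.shift, hU.smul, mul_left_comm]
      exact mul_le_mul_of_nonneg_left h1 (sq_nonneg r)
    · push Not at hφ
      have heq : φ = (0 : ℝ) • (0 : V → ℝ) + fun _ => φ o := by
        ext x
        simp [hφ x o]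
      rw [heq, resolventForm_hom h0, hU.shift, hU.smul]
      simp
  have heq : resolventForm Θ lam 0 ψ = m * U ψ := by rw [hm, div_mul_cancel₀ _ (hUpos ψ hψ).ne']
  have h1 := sum_integral_resolventForm hβ heig hlam ψ
  -- as `m * U` lies below the resolvent form, with equality at `ψ`, so do its increments; since
  -- `m ≤ 0` and `U` decreases, the form would not strictly decrease at `ψ`
  have h2 : m * ∑ a, ∑ b, ∫ p, (U (act a b p ψ) - U ψ) ∂(β a b) ≤
      ∑ a, ∑ b, ∫ p, (resolventForm Θ lam 0 (act a b p ψ) - resolventForm Θ lam 0 ψ) ∂(β a b) := by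
    simp only [Finset.mul_sum]
    refine Finset.sum_le_sum fun a _ => Finset.sum_le_sum fun b _ => ?_
    rw [← integral_const_mul]
    refine integral_mono ((hU.integrable a b ψ).const_mul m) (integrable_resolventForm hβ 0 a b ψ)
      fun p => ?_
    have := hbound (act a b p ψ)
    rw [heq]
    dsimp only
    rw [mul_sub]
    exact sub_le_sub_right this _
  have h3 := hU.sum_integral_le ψ
  have h4 := mul_nonneg_of_nonpos_of_nonpos hm0 (h3.trans (by simp))
  have h5 := hS ψ (exists_ne_of_mem_unitSection hψ)
  rw [h1] at h2
  linarith

/-- Below the smallest decay rate, the resolvent form stays positive: at the first `t` where it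
degenerates, it would be nonnegative and vanish at some point where it strictly decreases. -/
theorem resolventForm_pos [Nontrivial V] (hβ : Admissible β) {U : (V → ℝ) → ℝ}
    (hU : IsLyapunov β U 0) (h0 : ∀ i, ∀ f ∈ polySpace V 1, Θ i f = 0)
    (heig : ∀ i, ∀ χ : Fin 2 → V → ℝ,
      ∑ a, ∑ b, ∫ p, (Θ i (prodLin fun j => act a b p (χ j)) - Θ i (prodLin χ)) ∂(β a b) =
        -(lam i * Θ i (prodLin χ)))
    (hS : ∀ ψ : V → ℝ, (∃ x y, ψ x ≠ ψ y) → 0 < ∑ i, Θ i (linSq ψ))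
    {t : ℝ} (ht0 : 0 ≤ t) (ht : ∀ i, t < lam i) (o : V) :
    ∀ φ ∈ unitSection o, 0 < resolventForm Θ lam t φ := by
  have hzero := resolventForm_zero_pos hβ hU h0 heig hS (fun i => ht0.trans_lt (ht i)) o
  by_contra! hneg
  have hcont : ContinuousOn (fun q : ℝ × (V → ℝ) => resolventForm Θ lam q.1 q.2)
      (Set.Icc 0 t ×ˢ unitSection o) := by
    unfold resolventForm
    refine continuousOn_finsetSum _ fun i _ => ContinuousOn.mul ?_ ?_
    · refine ContinuousOn.inv₀ (by fun_prop) fun q hq => ?_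
      have := hq.1.2.trans_lt (ht i)
      exact (sub_pos.2 this).ne'
    · have h : Continuous fun q : ℝ × (V → ℝ) => (q.2, (0 : Fin 0 → V → ℝ)) := by fun_prop
      exact (((continuous_functional_prodLin (Θ i)).comp continuous_doubled).comp h).continuousOn
  have hK : IsCompact (Set.Icc 0 t ×ˢ unitSection o) := isCompact_Icc.prod (isCompact_unitSection o)
  have hB : IsCompact ((Set.Icc 0 t ×ˢ unitSection o) ∩
      (fun q : ℝ × (V → ℝ) => resolventForm Θ lam q.1 q.2) ⁻¹' Set.Iic 0) :=
    hK.of_isClosed_subset (hcont.preimage_isClosed_of_isClosed hK.isClosed isClosed_Iic)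
      Set.inter_subset_left
  -- `s` is the first parameter at which the form fails to be positive, and `ψ` a zero of it
  obtain ⟨φ, hφ, hφneg⟩ := hneg
  obtain ⟨s, ⟨⟨⟨s, ψ⟩, ⟨⟨hs, hψ⟩, hsψ⟩, rfl⟩, hleast⟩⟩ :=
    (hB.image continuous_fst).exists_isLeast ⟨t, (t, φ), ⟨⟨⟨ht0, le_rfl⟩, hφ⟩, hφneg⟩, rfl⟩
  simp only at hs hψ hsψ hleast
  have hs0 : 0 < s := by
    refine lt_of_le_of_ne hs.1 fun h => ?_
    have := hzero ψ hψ
    have h' : resolventForm Θ lam s ψ ≤ 0 := hsψ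
    rw [← h] at h'
    exact absurd h' (not_le.2 this)
  have hbefore (r : ℝ) (hr : r ∈ Set.Ioo 0 s) (φ) (hφ : φ ∈ unitSection o) :
      0 < resolventForm Θ lam r φ := by
    by_contra! h
    have := hleast ⟨(r, φ), ⟨⟨⟨hr.1.le, hr.2.le.trans hs.2⟩, hφ⟩, h⟩, rfl⟩
    exact absurd hr.2 (not_lt.2 this)
  have hnn : ∀ φ ∈ unitSection o, 0 ≤ resolventForm Θ lam s φ := by
    intro φ hφ
    by_contra! h
    have hc : ContinuousAt (fun r => resolventForm Θ lam r φ) s := by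
      unfold resolventForm
      refine tendsto_finsetSum _ fun i _ => Tendsto.mul_const _ ?_
      have : lam i - s ≠ 0 := (sub_pos.2 (hs.2.trans_lt (ht i))).ne'
      exact ContinuousAt.inv₀ (by fun_prop) this
    have hev : ∀ᶠ r in 𝓝[<] s, resolventForm Θ lam r φ < 0 :=
      (hc.eventually (gt_mem_nhds h)).filter_mono nhdsWithin_le_nhds
    obtain ⟨r, hr1, hr2⟩ := (hev.and (Ioo_mem_nhdsLT hs0)).exists
    exact absurd hr1 (not_lt.2 (hbefore r hr2 φ hφ).le)
  have hall := resolventForm_nonneg_of h0 o hnn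
  have hψ0 : resolventForm Θ lam s ψ = 0 := le_antisymm hsψ (hnn ψ hψ)
  have h1 := sum_integral_resolventForm hβ heig (fun i => hs.2.trans_lt (ht i)) ψ
  -- at a zero of a nonnegative form all increments are nonnegative
  have h2 : 0 ≤ ∑ a, ∑ b,
      ∫ p, (resolventForm Θ lam s (act a b p ψ) - resolventForm Θ lam s ψ) ∂(β a b) := by
    refine Finset.sum_nonneg fun a _ => Finset.sum_nonneg fun b _ => integral_nonneg fun p => ?_
    rw [hψ0]
    simpa using hall (act a b p ψ)
  have h5 := hS ψ (exists_ne_of_mem_unitSection hψ)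
  rw [h1, hψ0] at h2
  linarith

/-- The resolvent form is a Lyapunov function; its rate may be chosen arbitrarily close to the
smallest decay rate `lam i`. -/
theorem isLyapunov_resolventForm [Nontrivial V] (hβ : Admissible β) {U : (V → ℝ) → ℝ}
    (hU : IsLyapunov β U 0) (h0 : ∀ i, ∀ f ∈ polySpace V 1, Θ i f = 0)
    (heig : ∀ i, ∀ χ : Fin 2 → V → ℝ,
      ∑ a, ∑ b, ∫ p, (Θ i (prodLin fun j => act a b p (χ j)) - Θ i (prodLin χ)) ∂(β a b) =
        -(lam i * Θ i (prodLin χ)))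
    (hS : ∀ ψ : V → ℝ, (∃ x y, ψ x ≠ ψ y) → 0 < ∑ i, Θ i (linSq ψ))
    {t : ℝ} (ht0 : 0 ≤ t) (ht : ∀ i, t < lam i) :
    IsLyapunov β (resolventForm Θ lam t) t where
  continuous := continuous_resolventForm t
  smul r ψ := by
    have := resolventForm_hom h0 (lam := lam) t r 0 ψ
    rw [← this]
    congr 1
    ext x
    simp
  shift ψ s := by
    have := resolventForm_hom h0 (lam := lam) t 1 s ψ
    rwa [one_smul, one_pow, one_mul] at this
  pos ψ hψ := by
    obtain ⟨o⟩ : Nonempty V := inferInstance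
    obtain ⟨r, hr, φ, hφ, heq⟩ := exists_mem_unitSection o hψ
    rw [heq, resolventForm_hom h0]
    exact mul_pos (pow_pos hr 2) (resolventForm_pos hβ hU h0 heig hS ht0 ht o φ hφ)
  integrable := integrable_resolventForm hβ t
  sum_integral_le ψ := by
    rw [sum_integral_resolventForm hβ heig ht]
    have : 0 ≤ ∑ i, Θ i (linSq ψ) := by
      by_cases hψ : ∃ x y, ψ x ≠ ψ y
      · exact (hS ψ hψ).le
      · push Not at hψ
        obtain ⟨o⟩ : Nonempty V := inferInstance
        have heq : ψ = (0 : ℝ) • (0 : V → ℝ) + fun _ => ψ o := by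
          ext x
          simp [hψ x o]
        refine (Finset.sum_eq_zero fun i _ => ?_).ge
        have := functional_doubled (m := 0) (h0 i) 0 0 (ψ o) 0
        rw [← heq] at this
        unfold linSq
        rw [this]
        ring
    linarith

end Resolvent

/-! ### Orthonormal bases of polynomial eigenfunctions -/

section Eigenbasis

open ComplexConjugate

variable {V : Type*} [DecidableEq V] [Fintype V] {β : V → V → Measure Square}
  {μ : Measure (Simplex V)} [IsFiniteMeasure μ]

/-- The polynomials as a star subalgebra of the continuous functions. -/
def polynomialAlgebra (V : Type*) [DecidableEq V] [Fintype V] :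
    StarSubalgebra ℂ C(Simplex V, ℂ) where
  carrier := {f | IsPolynomial f}
  mul_mem' hf hg := hf.mul hg
  add_mem' hf hg := mem_polynomials.1
    (Submodule.add_mem _ (mem_polynomials.2 hf) (mem_polynomials.2 hg))
  algebraMap_mem' c := isPolynomial_const c
  star_mem' hf := hf.conj

/-- Polynomials are dense in the continuous functions, by the Stone-Weierstrass theorem. -/
theorem polynomials_topologicalClosure : (polynomials V).topologicalClosure = ⊤ := by
  have h := ContinuousMap.starSubalgebra_topologicalClosure_eq_top_of_separatesPoints
    (polynomialAlgebra V) ?_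
  · rw [eq_top_iff]
    intro f _
    have hf : f ∈ (polynomialAlgebra V).topologicalClosure := by
      rw [h]
      exact StarSubalgebra.mem_top
    have hset : ((polynomials V : Submodule ℂ C(Simplex V, ℂ)) : Set C(Simplex V, ℂ)) =
        (polynomialAlgebra V : Set C(Simplex V, ℂ)) := by
      ext g
      exact mem_polynomials
    change f ∈ closure ((polynomials V : Submodule ℂ C(Simplex V, ℂ)) : Set C(Simplex V, ℂ))
    rw [hset]
    exact hf
  · intro η ζ hne
    obtain ⟨x, hx⟩ : ∃ x, η.1 x ≠ ζ.1 x := by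
      by_contra! hcon
      exact hne (Subtype.ext (funext hcon))
    refine ⟨_, ⟨lin (Pi.single x 1), isPolynomial_iff.2 ⟨1, lin_mem_polySpace _⟩, rfl⟩, ?_⟩
    change lin (Pi.single x 1) η ≠ lin (Pi.single x 1) ζ
    rw [lin_single, lin_single]
    exact fun h => hx (Complex.ofReal_injective h)

variable (μ) in
/-- The inner product of `L²(μ)` on continuous functions, as a linear functional of its second
argument. -/
def pairing (f : C(Simplex V, ℂ)) : C(Simplex V, ℂ) →ₗ[ℂ] ℂ :=
  (innerSL ℂ (ContinuousMap.toLp 2 μ ℂ f)).toLinearMap ∘ₗ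
    (ContinuousMap.toLp 2 μ ℂ : C(Simplex V, ℂ) →L[ℂ] Lp ℂ 2 μ).toLinearMap

theorem pairing_eq_inner (f g : C(Simplex V, ℂ)) :
    pairing μ f g = inner ℂ (ContinuousMap.toLp 2 μ ℂ f) (ContinuousMap.toLp 2 μ ℂ g) := rfl

theorem pairing_apply (f g : C(Simplex V, ℂ)) : pairing μ f g = ∫ η, conj (f η) * g η ∂μ := by
  rw [pairing_eq_inner, ContinuousMap.inner_toLp]
  simp only [mul_comm]

theorem pairing_conj (f g : C(Simplex V, ℂ)) : conj (pairing μ f g) = pairing μ g f := by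
  rw [pairing_eq_inner, inner_conj_symm, pairing_eq_inner]

/-- An orthonormal basis of `L²(μ)` consisting of polynomial eigenfunctions of the generator,
graded by the degree: the basis elements of level at most `k` span the polynomials of degree at
most `k`. -/
structure PolyEigenbasis (β : V → V → Measure Square) (μ : Measure (Simplex V))
    [IsFiniteMeasure μ] where
  /-- The number of basis elements on each level. -/
  dim : ℕ → ℕ
  /-- The basis. -/
  basis : HilbertBasis (Σ k, Fin (dim k)) ℂ (Lp ℂ 2 μ)
  /-- Polynomials representing the basis elements. -/
  poly : (Σ k, Fin (dim k)) → C(Simplex V, ℂ)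
  /-- The eigenvalues of the negative generator. -/
  ev : (Σ k, Fin (dim k)) → ℝ
  mem : ∀ i, poly i ∈ polySpace V i.1
  toLp_poly : ∀ i, ContinuousMap.toLp 2 μ ℂ (poly i) = basis i
  generator_poly : ∀ i η, generator β (poly i) η = -((ev i : ℂ) * poly i η)
  span_poly : ∀ k, polySpace V k = Submodule.span ℂ (poly '' {i | i.1 ≤ k})

theorem SymmetricOnPolynomials.pairing_eq (hsymm : SymmetricOnPolynomials β μ)
    {f g Lf Lg : C(Simplex V, ℂ)} (hf : f ∈ polynomials V) (hg : g ∈ polynomials V)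
    (hLf : ∀ η, Lf η = generator β f η) (hLg : ∀ η, Lg η = generator β g η) :
    pairing μ f Lg = pairing μ Lf g := by
  have := hsymm f g (mem_polynomials.1 hf) (mem_polynomials.1 hg)
  simp only [pairing_apply, hLf, hLg]
  exact this

/-- The symmetric generator preserves the finite-dimensional spaces `polySpace V k`, so it can be
diagonalized on each of them compatibly. -/
theorem exists_polyEigenbasis [μ.IsOpenPosMeasure] (hβ : Admissible β)
    (hsymm : SymmetricOnPolynomials β μ) : Nonempty (PolyEigenbasis β μ) := by
  obtain ⟨L, hL⟩ := exists_generator_linearMap hβ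
  have hLk (k : ℕ) (f) (hf : f ∈ polySpace V k) : L f ∈ polySpace V k := by
    obtain ⟨g, hg, hg'⟩ := exists_generator_eq hβ hf
    have : L f = g := by
      ext η
      rw [hL f (mem_polynomials_iff.2 ⟨k, hf⟩), hg']
    rwa [this]
  let J : C(Simplex V, ℂ) →L[ℂ] Lp ℂ 2 μ := ContinuousMap.toLp 2 μ ℂ
  have hJ : Function.Injective J := ContinuousMap.toLp_injective μ
  obtain ⟨J', hJ'⟩ := J.toLinearMap.exists_leftInverse_of_injective (LinearMap.ker_eq_bot.2 hJ)
  have hJ'' (f) : J' (J f) = f := LinearMap.congr_fun hJ' f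
  let D (k : ℕ) : Submodule ℂ (Lp ℂ 2 μ) := (polySpace V k).map J.toLinearMap
  have hDsup : ⨆ k, D k = (polynomials V).map J.toLinearMap := (Submodule.map_iSup _ _).symm
  -- the negative generator on `L²`, extended arbitrarily beyond the polynomials
  let T : Lp ℂ 2 μ →ₗ[ℂ] Lp ℂ 2 μ := -(J.toLinearMap ∘ₗ L ∘ₗ J')
  have hT (f) : T (J f) = -J (L f) := by
    change -J (L (J' (J f))) = _
    rw [hJ'']
  have (k : ℕ) : FiniteDimensional ℂ (D k) :=
    inferInstanceAs (FiniteDimensional ℂ ((polySpace V k).map J.toLinearMap))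
  obtain ⟨d, b, ev, hb, hspan⟩ := exists_adapted_hilbertBasis (D := D)
    (fun j k h => Submodule.map_mono (polySpace_mono h))
    (by
      rw [hDsup]
      exact (ContinuousMap.toLp_denseRange ℂ μ ℂ (by simp)).topologicalClosure_map_submodule
        polynomials_topologicalClosure) T
    (by
      rintro k _ ⟨f, hf, rfl⟩
      exact ⟨-L f, neg_mem (hLk k f hf), by
        rw [map_neg]
        exact (hT f).symm⟩)
    (by
      rw [hDsup]
      rintro _ ⟨f, hf, rfl⟩ _ ⟨g, hg, rfl⟩
      have h := hsymm.pairing_eq hf hg (hL f hf) (hL g hg)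
      rw [pairing_eq_inner, pairing_eq_inner] at h
      change inner ℂ (T (J f)) (J g) = inner ℂ (J f) (T (J g))
      rw [hT, hT, inner_neg_left, inner_neg_right]
      exact congrArg _ h.symm)
  choose hbD _ hbT using hb
  choose f hf hfb using hbD
  refine ⟨⟨d, b, f, ev, hf, hfb, fun i η => ?_, fun k => ?_⟩⟩
  · have h : J (L (f i)) = J (-((ev i : ℂ) • f i)) := by
      have h1 := hT (f i)
      have h2 := hbT i
      have h3 : J (f i) = b i := hfb i
      rw [h3, h2] at h1
      rw [map_neg, map_smul, h3, h1, neg_neg]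
    have := congrArg (fun g => g η) (hJ h)
    rw [← hL _ (mem_polynomials_iff.2 ⟨_, hf i⟩)]
    exact this
  · refine Submodule.map_injective_of_injective (f := J.toLinearMap) hJ ?_
    rw [Submodule.map_span, Set.image_image]
    have h : (fun i => J.toLinearMap (f i)) = b := funext hfb
    rw [h]
    exact hspan k

namespace PolyEigenbasis

variable (E : PolyEigenbasis β μ)

theorem pairing_self (i) : pairing μ (E.poly i) (E.poly i) = 1 := by
  rw [pairing_eq_inner, E.toLp_poly, inner_basis_self]

theorem pairing_of_ne {i j} (h : i ≠ j) : pairing μ (E.poly i) (E.poly j) = 0 := by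
  rw [pairing_eq_inner, E.toLp_poly, E.toLp_poly, inner_basis_of_ne h]

theorem pairing_of_lt {i} {j : ℕ} (h : j < i.1) {g : C(Simplex V, ℂ)} (hg : g ∈ polySpace V j) :
    pairing μ (E.poly i) g = 0 := by
  rw [E.span_poly] at hg
  refine Submodule.span_le (p := LinearMap.ker (pairing μ (E.poly i))).2 ?_ hg
  rintro _ ⟨l, hl, rfl⟩
  refine E.pairing_of_ne ?_
  rintro rfl
  exact absurd h (not_lt.2 hl)

/-- A functional that vanishes on polynomials of degree at most `k` is determined on polynomials of
degree at most `k + 1` by its values on the basis elements of level `k + 1`. -/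
theorem map_eq_sum_pairing {k : ℕ} {ℓ : C(Simplex V, ℂ) →ₗ[ℂ] ℂ}
    (hℓ : ∀ f ∈ polySpace V k, ℓ f = 0) {g : C(Simplex V, ℂ)} (hg : g ∈ polySpace V (k + 1)) :
    ℓ g = ∑ l : Fin (E.dim (k + 1)),
      ℓ (E.poly ⟨k + 1, l⟩) * pairing μ (E.poly ⟨k + 1, l⟩) g := by
  rw [E.span_poly] at hg
  induction hg using Submodule.span_induction with
  | mem g h =>
    obtain ⟨⟨j, l⟩, hl, rfl⟩ := h
    rcases Nat.le_succ_iff.1 (show j ≤ k + 1 from hl) with h | rfl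
    · rw [hℓ _ (polySpace_mono h (E.mem ⟨j, l⟩))]
      refine (Finset.sum_eq_zero fun n _ => ?_).symm
      rw [E.pairing_of_lt (Nat.lt_succ_of_le h) (E.mem ⟨j, l⟩), mul_zero]
    · rw [Finset.sum_eq_single_of_mem l (Finset.mem_univ l), E.pairing_self, mul_one]
      intro m _ hm
      rw [E.pairing_of_ne (by simpa using hm), mul_zero]
  | zero => simp
  | add f g _ _ hf hg =>
    rw [map_add, hf, hg, ← Finset.sum_add_distrib]
    exact Finset.sum_congr rfl fun l _ => by rw [map_add, mul_add]
  | smul c f _ hf =>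
    rw [map_smul, hf, smul_eq_mul, Finset.mul_sum]
    exact Finset.sum_congr rfl fun l _ => by rw [map_smul, smul_eq_mul, mul_left_comm]

theorem pairing_generator (hsymm : SymmetricOnPolynomials β μ) (i) {g Lg : C(Simplex V, ℂ)}
    (hg : g ∈ polynomials V) (hLg : ∀ η, Lg η = generator β g η) :
    pairing μ (E.poly i) Lg = -((E.ev i : ℂ) * pairing μ (E.poly i) g) := by
  rw [hsymm.pairing_eq (Lf := (-(E.ev i : ℂ)) • E.poly i)
    (mem_polynomials_iff.2 ⟨_, E.mem i⟩) hg ?_ hLg]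
  · rw [← pairing_conj, map_smul, smul_eq_mul, map_mul, pairing_conj]
    simp
  · intro η
    rw [E.generator_poly]
    simp

/-- The real part of a multiple of the functional `⟨E.poly i, ·⟩`. -/
def functional (c : ℂ) (i : Σ k, Fin (E.dim k)) : C(Simplex V, ℂ) →ₗ[ℝ] ℝ :=
  Complex.reLm ∘ₗ (c • pairing μ (E.poly i)).restrictScalars ℝ

theorem functional_apply (c : ℂ) (i) (g : C(Simplex V, ℂ)) :
    E.functional c i g = (c * pairing μ (E.poly i) g).re := rfl

theorem functional_of_lt (c : ℂ) {i} {j : ℕ} (h : j < i.1) {g : C(Simplex V, ℂ)}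
    (hg : g ∈ polySpace V j) : E.functional c i g = 0 := by
  rw [functional_apply, E.pairing_of_lt h hg, mul_zero, Complex.zero_re]

/-- Pairing with an eigenfunction gives an eigenfunctional of the dual action. -/
theorem sum_integral_functional (hβ : Admissible β) (hsymm : SymmetricOnPolynomials β μ) (c : ℂ)
    (i) {k : ℕ} (χ : Fin k → V → ℝ) :
    ∑ a, ∑ b, ∫ p, (E.functional c i (prodLin fun j => act a b p (χ j)) -
      E.functional c i (prodLin χ)) ∂(β a b) = -(E.ev i * E.functional c i (prodLin χ)) := by
  obtain ⟨g, -, hg⟩ := exists_generator_eq hβ (prodLin_mem χ)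
  rw [← functional_generator_prodLin hβ χ hg, functional_apply, functional_apply,
    E.pairing_generator hsymm i (mem_polynomials_iff.2 ⟨k, prodLin_mem χ⟩) hg]
  rw [mul_neg, Complex.neg_re, mul_left_comm, Complex.re_ofReal_mul]

theorem exists_functional_mono_ne (i) :
    ∃ (c : ℂ) (y : Fin i.1 → V), E.functional c i (mono y) ≠ 0 := by
  obtain ⟨y, hy⟩ : ∃ y : Fin i.1 → V, pairing μ (E.poly i) (mono y) ≠ 0 := by
    by_contra! h
    have h1 : E.poly i ∈ LinearMap.ker (pairing μ (E.poly i)) := by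
      refine Submodule.span_le.2 ?_ (E.mem i)
      rintro _ ⟨y, rfl⟩
      exact h y
    rw [LinearMap.mem_ker, E.pairing_self] at h1
    exact one_ne_zero h1
  refine ⟨conj (pairing μ (E.poly i) (mono y)), y, ?_⟩
  rw [functional_apply, ← Complex.normSq_eq_conj_mul_self, Complex.ofReal_re]
  exact (Complex.normSq_pos.2 hy).ne'

/-- A Lyapunov function bounds the eigenvalues on the levels `≥ 2`. -/
theorem le_ev_of_isLyapunov [Nontrivial V] (hβ : Admissible β)
    (hsymm : SymmetricOnPolynomials β μ) {W : (V → ℝ) → ℝ} {c : ℝ} (hW : IsLyapunov β W c)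
    {i} (hi : 2 ≤ i.1) : c ≤ E.ev i := by
  obtain ⟨k, l⟩ := i
  obtain ⟨m, rfl⟩ : ∃ m, k = m + 2 := ⟨k - 2, by have : 2 ≤ k := hi; omega⟩
  obtain ⟨z, y, hy⟩ := E.exists_functional_mono_ne ⟨m + 2, l⟩
  exact hW.le_rate hβ (Λ := E.functional z ⟨m + 2, l⟩)
    (fun f hf => E.functional_of_lt z (Nat.lt_succ_self _) hf) ⟨y, hy⟩
    (fun χ => E.sum_integral_functional hβ hsymm z _ χ)

end PolyEigenbasis

end Eigenbasis

/-! ### Functions invariant under the exchanges are constant -/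

section Invariant

variable {V : Type*} [DecidableEq V] [Fintype V] {β : V → V → Measure Square}

theorem exchange_val (x y : V) (p : Square) (η : Simplex V) : (exchange x y p η).1 =
    η.1 + ((1 - (p.2 : ℝ)) * η.1 y - (1 - (p.1 : ℝ)) * η.1 x) •
      (Pi.single x 1 - Pi.single y 1) := rfl

theorem exchange_swap (x y : V) (p : Square) (η : Simplex V) :
    exchange y x p.swap η = exchange x y p η := by
  refine Subtype.ext ?_
  simp only [exchange, exchangeVec, Prod.fst_swap, Prod.snd_swap]
  rw [← neg_sub (Pi.single x (1 : ℝ) : V → ℝ), smul_neg, ← neg_smul, neg_sub]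

theorem continuous_exchange (x y : V) (p : Square) : Continuous (exchange x y p) := by
  refine continuous_induced_rng.2 ?_
  have hx := continuous_coord (V := V) x
  have hy := continuous_coord (V := V) y
  have : Continuous fun η : Simplex V => η.1 := continuous_subtype_val
  exact this.add (((continuous_const.mul hy).sub (continuous_const.mul hx)).smul continuous_const)

/-- An exchange multiplies differences along the exchange direction by `u + v - 1`. -/
theorem exchange_sub_exchange {x y : V} (hxy : x ≠ y) (p : Square) {η ζ : Simplex V} {c : ℝ}
    (h : η.1 = ζ.1 + c • (Pi.single x 1 - Pi.single y 1)) :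
    (exchange x y p η).1 = (exchange x y p ζ).1 +
      (((p.1 : ℝ) + (p.2 : ℝ) - 1) * c) • (Pi.single x 1 - Pi.single y 1) := by
  have hx : η.1 x = ζ.1 x + c := by simp [h, hxy]
  have hy : η.1 y = ζ.1 y - c := by simp [h, hxy.symm]; ring
  rw [exchange_val, exchange_val, hx, hy, h]
  module

/-- If a continuous function is invariant under one exchange with `0 < u < 1`, then it is invariant
under any redistribution of mass between the two vertices: the iterates of the exchange contract
along the exchange direction. -/
theorem eq_of_exchange_invariant {f : Simplex V → ℂ} (hf : Continuous f) {x y : V} (hxy : x ≠ y)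
    {p : Square} (h0 : 0 < (p.1 : ℝ)) (h1 : (p.1 : ℝ) < 1)
    (hinv : ∀ η, f (exchange x y p η) = f η) {η ζ : Simplex V} {c : ℝ}
    (h : η.1 = ζ.1 + c • (Pi.single x 1 - Pi.single y 1)) : f η = f ζ := by
  set ρ : ℝ := (p.1 : ℝ) + (p.2 : ℝ) - 1 with hρ
  have hρ1 : |ρ| < 1 := by
    have := p.2.2.1
    have := p.2.2.2
    rw [abs_lt]
    constructor <;> linarith
  have hiter (n : ℕ) : ∃ η' ζ' : Simplex V, f η' = f η ∧ f ζ' = f ζ ∧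
      η'.1 = ζ'.1 + (ρ ^ n * c) • (Pi.single x 1 - Pi.single y 1) := by
    induction n with
    | zero => exact ⟨η, ζ, rfl, rfl, by simpa using h⟩
    | succ n ih =>
      obtain ⟨η', ζ', hη, hζ, h'⟩ := ih
      refine ⟨exchange x y p η', exchange x y p ζ', (hinv _).trans hη, (hinv _).trans hζ, ?_⟩
      rw [exchange_sub_exchange hxy p h', pow_succ', mul_assoc]
  have hunif : UniformContinuous f := CompactSpace.uniformContinuous_of_continuous hf
  refine eq_of_forall_dist_le fun ε hε => ?_
  obtain ⟨δ, hδ, hδ'⟩ := Metric.uniformContinuous_iff.1 hunif ε hε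
  have hlim : Filter.Tendsto
      (fun n : ℕ => ‖(ρ ^ n * c) • (Pi.single x 1 - Pi.single y 1 : V → ℝ)‖)
      Filter.atTop (nhds 0) := by
    have h2 : Filter.Tendsto (fun n : ℕ => (ρ ^ n * c) • (Pi.single x 1 - Pi.single y 1 : V → ℝ))
        Filter.atTop (nhds ((0 * c) • (Pi.single x 1 - Pi.single y 1 : V → ℝ))) :=
      ((tendsto_pow_atTop_nhds_zero_of_abs_lt_one hρ1).mul_const c).smul_const _
    simpa using h2.norm
  obtain ⟨n, hn⟩ := (hlim.eventually (gt_mem_nhds hδ)).exists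
  obtain ⟨η', ζ', hη, hζ, h'⟩ := hiter n
  rw [← hη, ← hζ]
  refine (hδ' ?_).le
  rw [Subtype.dist_eq, h', dist_eq_norm, add_sub_cancel_left]
  exact hn

theorem sub_smul_single_mem {η : Simplex V} {x y : V} {c : ℝ} (h0 : 0 ≤ c) (h1 : c ≤ η.1 x) :
    η.1 - c • (Pi.single x 1 - Pi.single y 1) ∈ stdSimplex ℝ V := by
  refine ⟨fun z => ?_, ?_⟩
  · have h := η.2.1 z
    simp only [Pi.sub_apply, Pi.smul_apply, smul_eq_mul, Pi.single_apply]
    by_cases hzx : z = x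
    · subst hzx
      split_ifs <;> simp <;> linarith
    · split_ifs <;> simp <;> linarith
  · have h := η.2.2
    simp [Finset.sum_sub_distrib, ← Finset.mul_sum, h]

/-- A function that is invariant under moving mass along the edges of a connected graph is
constant: all mass can be brought to a single vertex. -/
theorem eq_of_edge_invariant {f : Simplex V → ℂ} {r : V → V → Prop}
    (hr : ∀ x y, Relation.TransGen r x y)
    (hinv : ∀ a b, r a b → ∀ (η ζ : Simplex V) (c : ℝ),
      η.1 = ζ.1 + c • (Pi.single a 1 - Pi.single b 1) → f η = f ζ) (η ζ : Simplex V) :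
    f η = f ζ := by
  have hmove (x y : V) : ∀ (η ζ : Simplex V) (c : ℝ), 0 ≤ c → c ≤ η.1 x →
      ζ.1 = η.1 - c • (Pi.single x 1 - Pi.single y 1) → f ζ = f η := by
    induction hr x y with
    | single h =>
      intro η ζ c _ _ hζ
      exact (hinv _ _ h η ζ c (by rw [hζ, sub_add_cancel])).symm
    | @tail z y _ h ih =>
      intro η ζ c h0 h1 hζ
      have h2 := ih η ⟨_, sub_smul_single_mem h0 h1⟩ c h0 h1 rfl
      rw [← h2]
      refine (hinv _ _ h _ ζ c ?_).symm
      rw [hζ]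
      module
  obtain ⟨o⟩ : Nonempty V := by
    by_contra hV
    rw [not_nonempty_iff] at hV
    simpa using η.2.2
  have hall (η : Simplex V) (s : Finset V) : ∃ ζ : Simplex V, f ζ = f η ∧
      ζ.1 = η.1 - ∑ x ∈ s, η.1 x • (Pi.single x 1 - Pi.single o 1) := by
    induction s using Finset.induction_on with
    | empty => exact ⟨η, rfl, by simp⟩
    | insert x s hx ih =>
      obtain ⟨ζ, hζ, hζ'⟩ := ih
      have h1 : η.1 x ≤ ζ.1 x := by
        rw [hζ', Pi.sub_apply, Finset.sum_apply]
        suffices ∑ z ∈ s, (η.1 z • (Pi.single z 1 - Pi.single o 1 : V → ℝ)) x ≤ 0 by linarith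
        refine Finset.sum_nonpos fun z hz => ?_
        have hzx : x ≠ z := fun h => hx (h ▸ hz)
        rw [Pi.smul_apply, Pi.sub_apply, Pi.single_eq_of_ne hzx, smul_eq_mul]
        refine mul_nonpos_of_nonneg_of_nonpos (η.2.1 z) ?_
        have : (0 : ℝ) ≤ (Pi.single o 1 : V → ℝ) x := by
          rw [Pi.single_apply]
          split_ifs <;> norm_num
        linarith
      refine ⟨⟨_, sub_smul_single_mem (y := o) (η.2.1 x) h1⟩,
        (hmove x o ζ _ _ (η.2.1 x) h1 rfl).trans hζ, ?_⟩
      rw [Finset.sum_insert hx, add_comm, ← sub_sub, ← hζ']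
  have hend (η : Simplex V) : ∃ ζ : Simplex V, f ζ = f η ∧ ζ.1 = Pi.single o 1 := by
    obtain ⟨ζ, hζ, hζ'⟩ := hall η Finset.univ
    refine ⟨ζ, hζ, ?_⟩
    rw [hζ']
    ext z
    have h := η.2.2
    simp only [Pi.sub_apply, Finset.sum_apply, Pi.smul_apply, smul_eq_mul, mul_sub,
      Finset.sum_sub_distrib, ← Finset.sum_mul, h, one_mul]
    simp [Pi.single_apply]
  obtain ⟨η', h1, h1'⟩ := hend η
  obtain ⟨ζ', h2, h2'⟩ := hend ζ
  rw [← h1, ← h2, Subtype.ext (h1'.trans h2'.symm)]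

/-- A continuous function invariant under almost all exchanges is constant. -/
theorem eq_of_ae_exchange_invariant (hirr : Irreducible₂ β) {f : Simplex V → ℂ}
    (hf : Continuous f) (h : ∀ η a b, ∀ᵐ p ∂(β a b), f (exchange a b p η) = f η)
    (η ζ : Simplex V) : f η = f ζ := by
  have hall (a b : V) : ∀ᵐ p ∂(β a b), ∀ η, f (exchange a b p η) = f η := by
    -- the exceptional sets of a countable dense set of configurations have a null union
    obtain ⟨S, hS, hS'⟩ := TopologicalSpace.exists_countable_dense (Simplex V)
    have h1 : ∀ᵐ p ∂(β a b), ∀ η ∈ S, f (exchange a b p η) = f η :=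
      (ae_ball_iff hS).2 fun η _ => h η a b
    filter_upwards [h1] with p hp
    exact congrFun (Continuous.ext_on hS' (hf.comp (continuous_exchange a b p)) hf hp)
  have hsym (a b : V) : ∀ᵐ p ∂(symMeasure β a b), ∀ η, f (exchange a b p η) = f η := by
    rw [symMeasure, ae_add_measure_iff]
    refine ⟨hall a b, ?_⟩
    have hswap : MeasurableEmbedding (Prod.swap : Square → Square) :=
      MeasurableEquiv.prodComm.measurableEmbedding
    rw [hswap.ae_map_iff]
    filter_upwards [hall b a] with p hp η
    rw [exchange_swap, hp]
  refine eq_of_edge_invariant hirr (fun a b hab η ζ c hηζ => ?_) η ζ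
  -- positivity of `rate₂` provides an exchange with `0 < u < 1`
  obtain ⟨p, hp, hp'⟩ : ∃ p : Square, (∀ η, f (exchange a b p η) = f η) ∧
      (p.1 : ℝ) * (1 - (p.1 : ℝ)) ≠ 0 := by
    by_contra! hcon
    refine hab.2.ne' (integral_eq_zero_of_ae ?_)
    filter_upwards [hsym a b] with p hp
    exact hcon p hp
  have hu0 := p.1.2.1
  have hu1 := p.1.2.2
  exact eq_of_exchange_invariant hf hab.1 (lt_of_le_of_ne hu0 (left_ne_zero_of_mul hp').symm)
    (by
      have := sub_nonneg.2 hu1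
      have := lt_of_le_of_ne this (right_ne_zero_of_mul hp').symm
      linarith) hp hηζ

end Invariant

/-! ### The Dirichlet form -/

section DirichletForm

open ComplexConjugate

variable {V : Type*} [DecidableEq V] [Fintype V] {β : V → V → Measure Square}
  {μ : Measure (Simplex V)} [IsFiniteMeasure μ]

/-- The carré du champ `L|f|² - f̄ Lf - f conj(Lf)` of the generator, without the customary factor
`1 / 2`; see `carreDuChamp_eq`. -/
def carreDuChamp (β : V → V → Measure Square) (f : Simplex V → ℂ) (η : Simplex V) : ℝ :=
  ∑ a, ∑ b, ∫ p, Complex.normSq (f (exchange a b p η) - f η) ∂(β a b)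

theorem carreDuChamp_nonneg (f : Simplex V → ℂ) (η : Simplex V) : 0 ≤ carreDuChamp β f η :=
  Finset.sum_nonneg fun _ _ => Finset.sum_nonneg fun _ _ =>
    integral_nonneg fun _ => Complex.normSq_nonneg _

theorem generator_conj (f : Simplex V → ℂ) (η : Simplex V) :
    generator β (fun η => conj (f η)) η = conj (generator β f η) := by
  simp only [generator, map_sum, ← integral_conj, map_sub]

theorem normSq_exchange_sub (f : Simplex V → ℂ) (a b : V) (p : Square) (η : Simplex V) :
    (Complex.normSq (f (exchange a b p η) - f η) : ℂ) =
      (conj (f (exchange a b p η)) * f (exchange a b p η) - conj (f η) * f η) -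
        conj (f η) * (f (exchange a b p η) - f η) -
        f η * (conj (f (exchange a b p η)) - conj (f η)) := by
  rw [Complex.normSq_eq_conj_mul_self, map_sub]
  ring

theorem integrable_normSq_exchange_sub (hβ : Admissible β) {f : Simplex V → ℂ}
    (hf : IsPolynomial f) (a b : V) (η : Simplex V) :
    Integrable (fun p => Complex.normSq (f (exchange a b p η) - f η)) (β a b) := by
  have h := (((integrable_exchange_sub hβ (hf.conj.mul hf) a b η).sub
    ((integrable_exchange_sub hβ hf a b η).const_mul (conj (f η)))).sub
    ((integrable_exchange_sub hβ hf.conj a b η).const_mul (f η))).re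
  refine h.congr (Filter.Eventually.of_forall fun p => ?_)
  have := congrArg Complex.re (normSq_exchange_sub f a b p η)
  rw [Complex.ofReal_re] at this
  exact this.symm

theorem carreDuChamp_eq (hβ : Admissible β) {f : Simplex V → ℂ} (hf : IsPolynomial f)
    (η : Simplex V) :
    (carreDuChamp β f η : ℂ) = generator β (fun η => conj (f η) * f η) η -
      conj (f η) * generator β f η - f η * conj (generator β f η) := by
  rw [← generator_conj]
  simp only [carreDuChamp, generator, Complex.ofReal_sum, Finset.mul_sum,
    ← Finset.sum_sub_distrib]
  refine Finset.sum_congr rfl fun a _ => Finset.sum_congr rfl fun b _ => ?_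
  have h1 := integrable_exchange_sub hβ (hf.conj.mul hf) a b η
  have h2 := (integrable_exchange_sub hβ hf a b η).const_mul (conj (f η))
  have h3 := (integrable_exchange_sub hβ hf.conj a b η).const_mul (f η)
  rw [← integral_const_mul, ← integral_const_mul]
  refine Eq.trans ?_ ((integral_sub (h1.sub h2) h3).trans
    (congrArg (· - _) (integral_sub h1 h2)))
  refine integral_complex_ofReal.symm.trans ?_
  exact integral_congr_ae (Filter.Eventually.of_forall fun p => normSq_exchange_sub f a b p η)

theorem SymmetricOnPolynomials.integral_generator (hsymm : SymmetricOnPolynomials β μ)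
    {f : Simplex V → ℂ} (hf : IsPolynomial f) : ∫ η, generator β f η ∂μ = 0 := by
  have := hsymm (fun _ => 1) f (isPolynomial_const 1) hf
  simpa [generator_const] using this

variable (E : PolyEigenbasis β μ)

namespace PolyEigenbasis

theorem isPolynomial_poly (i) : IsPolynomial (E.poly i) := isPolynomial_iff.2 ⟨_, E.mem i⟩

/-- Since `L|f|²` has mean zero, the carré du champ of a normalized eigenfunction has mean twice the
eigenvalue. -/
theorem carreDuChamp_poly (hβ : Admissible β) (hsymm : SymmetricOnPolynomials β μ) (i) :
    Continuous (carreDuChamp β (E.poly i)) ∧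
      ∫ η, carreDuChamp β (E.poly i) η ∂μ = 2 * E.ev i := by
  have hf := E.isPolynomial_poly i
  have hff := hf.conj.mul hf
  obtain ⟨k, hk⟩ := (isPolynomial_iff (f := ⟨_, hff.continuous⟩)).1 hff
  obtain ⟨g, -, hg⟩ := exists_generator_eq hβ hk
  have hc (η) : (carreDuChamp β (E.poly i) η : ℂ) =
      g η + 2 * (E.ev i : ℂ) * (conj (E.poly i η) * E.poly i η) := by
    rw [carreDuChamp_eq hβ hf, E.generator_poly, hg, map_neg, map_mul, Complex.conj_ofReal]
    change generator β (fun η => conj (E.poly i η) * E.poly i η) η - _ - _ =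
      generator β (fun η => conj (E.poly i η) * E.poly i η) η + _
    ring
  have hcont : Continuous fun η => g η + 2 * (E.ev i : ℂ) * (conj (E.poly i η) * E.poly i η) :=
    g.continuous.add (continuous_const.mul hff.continuous)
  have hcont' : Continuous (carreDuChamp β (E.poly i)) := by
    refine (Complex.continuous_re.comp hcont).congr fun η => ?_
    rw [Function.comp_apply, ← hc, Complex.ofReal_re]
  refine ⟨hcont', ?_⟩
  have hint (h : Simplex V → ℂ) (hh : Continuous h) : Integrable h μ :=
    hh.integrable_of_hasCompactSupport (HasCompactSupport.of_compactSpace h)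
  have h1 : ∫ η, (carreDuChamp β (E.poly i) η : ℂ) ∂μ = 2 * (E.ev i : ℂ) := by
    simp only [hc]
    refine (integral_add (hint _ g.continuous)
      (hint (fun η => 2 * (E.ev i : ℂ) * (conj (E.poly i η) * E.poly i η))
        (continuous_const.mul hff.continuous))).trans ?_
    rw [integral_const_mul, ← pairing_apply, E.pairing_self]
    simp only [hg]
    have h0 : ∫ η, generator β (fun η => conj (E.poly i η) * E.poly i η) η ∂μ = 0 :=
      hsymm.integral_generator hff
    refine (congrArg₂ (· + ·) h0 rfl).trans ?_
    ring
  rw [integral_complex_ofReal] at h1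
  exact_mod_cast h1

theorem ev_nonneg (hβ : Admissible β) (hsymm : SymmetricOnPolynomials β μ) (i) : 0 ≤ E.ev i := by
  have h := (E.carreDuChamp_poly hβ hsymm i).2
  have : 0 ≤ ∫ η, carreDuChamp β (E.poly i) η ∂μ :=
    integral_nonneg fun η => carreDuChamp_nonneg (E.poly i) η
  rw [h] at this
  linarith

/-- Eigenfunctions with eigenvalue zero are constant. -/
theorem poly_mem_zero_of_ev_eq_zero [μ.IsOpenPosMeasure] (hβ : Admissible β)
    (hirr : Irreducible₂ β) (hsymm : SymmetricOnPolynomials β μ) {i} (hi : E.ev i = 0) :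
    E.poly i ∈ polySpace V 0 := by
  obtain ⟨hcont, hint⟩ := E.carreDuChamp_poly hβ hsymm i
  rw [hi, mul_zero, integral_eq_zero_iff_of_nonneg (carreDuChamp_nonneg _)
    (hcont.integrable_of_hasCompactSupport (HasCompactSupport.of_compactSpace _))] at hint
  have hzero := (hcont.ae_eq_iff_eq μ continuous_const).1 hint
  have hconst := eq_of_ae_exchange_invariant hirr (E.poly i).continuous fun η a b => by
    have hnn (a b : V) :
        0 ≤ ∫ p, Complex.normSq (E.poly i (exchange a b p η) - E.poly i η) ∂(β a b) :=
      integral_nonneg fun _ => Complex.normSq_nonneg _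
    have h1 : carreDuChamp β (E.poly i) η = 0 := congrFun hzero η
    have h2 := (Finset.sum_eq_zero_iff_of_nonneg fun a _ =>
      Finset.sum_nonneg fun b _ => hnn a b).1 h1 a (Finset.mem_univ a)
    have h3 := (Finset.sum_eq_zero_iff_of_nonneg fun b _ => hnn a b).1 h2 b (Finset.mem_univ b)
    rw [integral_eq_zero_iff_of_nonneg (fun _ => Complex.normSq_nonneg _)
      (integrable_normSq_exchange_sub hβ (E.isPolynomial_poly i) a b η)] at h3
    filter_upwards [h3] with p hp
    exact sub_eq_zero.1 (Complex.normSq_eq_zero.1 hp)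
  rw [mem_polySpace_zero]
  by_cases hne : Nonempty (Simplex V)
  · obtain ⟨η⟩ := hne
    exact ⟨E.poly i η, ContinuousMap.ext fun ζ => by simp [hconst ζ η]⟩
  · exact ⟨0, ContinuousMap.ext fun ζ => (hne ⟨ζ⟩).elim⟩

theorem ev_eq_zero_of_level {i} (hi : i.1 = 0) : E.ev i = 0 := by
  have h1 := E.mem i
  rw [hi, mem_polySpace_zero] at h1
  obtain ⟨c, hc⟩ := h1
  have h2 := E.pairing_self i
  by_contra h
  have h3 : E.poly i = 0 := by
    ext η
    have := E.generator_poly i η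
    have hg : generator β (E.poly i) η = 0 := by
      rw [hc]
      have h : ⇑(c • (1 : C(Simplex V, ℂ))) = fun _ => c := by
        ext
        simp
      rw [h, generator_const]
    rw [hg] at this
    have := mul_eq_zero.1 (neg_eq_zero.1 this.symm)
    exact this.resolve_left (Complex.ofReal_ne_zero.2 h)
  rw [h3, map_zero] at h2
  exact zero_ne_one h2

theorem ev_pos [μ.IsOpenPosMeasure] (hβ : Admissible β) (hirr : Irreducible₂ β)
    (hsymm : SymmetricOnPolynomials β μ) {i} (hi : 1 ≤ i.1) : 0 < E.ev i := by
  refine lt_of_le_of_ne (E.ev_nonneg hβ hsymm i) fun h => ?_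
  have h1 := E.pairing_of_lt (j := 0) hi (E.poly_mem_zero_of_ev_eq_zero hβ hirr hsymm h.symm)
  rw [E.pairing_self] at h1
  exact one_ne_zero h1

theorem existsUnique_ev_eq_zero [Nonempty V] [μ.IsOpenPosMeasure] (hβ : Admissible β)
    (hirr : Irreducible₂ β) (hsymm : SymmetricOnPolynomials β μ) : ∃! i, E.ev i = 0 := by
  have h0 {i} (hi : E.ev i = 0) : ∃ c : ℂ, E.poly i = c • 1 :=
    mem_polySpace_zero.1 (E.poly_mem_zero_of_ev_eq_zero hβ hirr hsymm hi)
  obtain ⟨i, hi⟩ : ∃ i : Σ k, Fin (E.dim k), i.1 = 0 := by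
    by_contra! h
    have h1 := one_mem_polySpace (V := V) 0
    rw [E.span_poly] at h1
    have h2 : E.poly '' {i | i.1 ≤ 0} = ∅ := by
      rw [Set.image_eq_empty, Set.eq_empty_iff_forall_notMem]
      exact fun i hi => h i (Nat.le_zero.1 hi)
    rw [h2, Submodule.span_empty, Submodule.mem_bot] at h1
    obtain ⟨o⟩ : Nonempty V := inferInstance
    have := congrArg (fun g : C(Simplex V, ℂ) => g ⟨_, single_mem_stdSimplex ℝ o⟩) h1
    simp at this
  refine ⟨i, E.ev_eq_zero_of_level hi, fun j hj => ?_⟩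
  by_contra hne
  obtain ⟨c, hc⟩ := h0 (E.ev_eq_zero_of_level hi)
  obtain ⟨c', hc'⟩ := h0 hj
  have h1 := E.pairing_of_ne hne
  have h2 := E.pairing_self i
  have h3 := E.pairing_self j
  rw [hc] at h1
  nth_rewrite 2 [hc] at h2
  nth_rewrite 2 [hc'] at h3
  rw [map_smul, smul_eq_mul] at h1 h2 h3
  have hc0 : c ≠ 0 := left_ne_zero_of_mul (h2.trans_ne one_ne_zero)
  rw [(mul_eq_zero.1 h1).resolve_left hc0, mul_zero] at h3
  exact zero_ne_one h3

end PolyEigenbasis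

end DirichletForm

/-! ### Lower bounds on the eigenvalues -/

section LowerBounds

variable {V : Type*} [DecidableEq V] [Fintype V] {β : V → V → Measure Square}
  {μ : Measure (Simplex V)} [IsFiniteMeasure μ]

/-- On linear forms, the generator is the generator of the random walk. -/
theorem generator_lin (hβ : Admissible β) (ψ : V → ℝ) (η : Simplex V) :
    generator β (lin ψ) η = lin (walkGen β ψ) η := by
  have hint (a b z : V) : Integrable (fun p => act a b p ψ z - ψ z) (β a b) :=
    (tame_act a b z ψ).integrable (hβ.integrable_defect a b) (by rw [act_one])
  have h (a b : V) : ∫ p, (lin ψ (exchange a b p η) - lin ψ η) ∂(β a b) =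
      ((∑ z, (∫ p, (act a b p ψ z - ψ z) ∂(β a b)) * η.1 z : ℝ) : ℂ) := by
    have h1 (p : Square) : lin ψ (exchange a b p η) - lin ψ η =
        ((∑ z, (act a b p ψ z - ψ z) * η.1 z : ℝ) : ℂ) := by
      rw [lin_exchange, lin_apply, lin_apply, ← Complex.ofReal_sub, ← Finset.sum_sub_distrib]
      simp only [sub_mul]
    simp only [h1]
    rw [integral_complex_ofReal, integral_finsetSum _ fun z _ => (hint a b z).mul_const _]
    simp only [integral_mul_const]
  simp only [generator, h]
  rw [lin_apply]
  norm_cast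
  simp only [← sum_integral_act hβ, Finset.sum_mul]
  conv_rhs => rw [Finset.sum_comm]
  exact Finset.sum_congr rfl fun a _ => Finset.sum_comm

theorem functional_lin {Λ : C(Simplex V, ℂ) →ₗ[ℝ] ℝ} (ψ : V → ℝ) :
    Λ (lin ψ) = ∑ x, ψ x * Λ (lin (Pi.single x 1)) := by
  rw [lin_eq_sum, map_sum]
  refine Finset.sum_congr rfl fun x _ => ?_
  rw [smul_real_eq, map_smul, smul_eq_mul]

/-- The midpoint of the vertices `δ_x` and `δ_y` of the simplex; it is a vertex for `x = y`. -/
def midpoint (x y : V) : Simplex V :=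
  ⟨(1 / 2 : ℝ) • Pi.single x 1 + (1 / 2 : ℝ) • Pi.single y 1,
    (convex_stdSimplex ℝ V) (single_mem_stdSimplex ℝ x) (single_mem_stdSimplex ℝ y)
      (by norm_num) (by norm_num) (by norm_num)⟩

/-- The sum over all pairs of vertices of the second differences
`f(δ_x) + f(δ_y) - 2 f((δ_x + δ_y) / 2)`. -/
def secondDiff : C(Simplex V, ℂ) →ₗ[ℂ] ℂ where
  toFun f := ∑ x, ∑ y, (f (midpoint x x) + f (midpoint y y) - 2 * f (midpoint x y))
  map_add' f g := by
    simp only [← Finset.sum_add_distrib, ContinuousMap.add_apply]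
    exact Finset.sum_congr rfl fun x _ => Finset.sum_congr rfl fun y _ => by ring
  map_smul' c f := by
    simp only [Finset.mul_sum, ContinuousMap.smul_apply, smul_eq_mul, RingHom.id_apply]
    exact Finset.sum_congr rfl fun x _ => Finset.sum_congr rfl fun y _ => by ring

theorem secondDiff_apply (f : C(Simplex V, ℂ)) : secondDiff f =
    ∑ x, ∑ y, (f (midpoint x x) + f (midpoint y y) - 2 * f (midpoint x y)) := rfl

theorem lin_midpoint (ψ : V → ℝ) (x y : V) :
    lin ψ (midpoint x y) = (((ψ x + ψ y) / 2 : ℝ) : ℂ) := by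
  rw [lin_apply]
  congr 1
  simp only [midpoint, Pi.add_apply, Pi.smul_apply, smul_eq_mul, mul_add, Finset.sum_add_distrib,
    Pi.single_apply, mul_ite, mul_one, mul_zero, Finset.sum_ite_eq', Finset.mem_univ, if_true]
  ring

theorem secondDiff_eq_zero {f : C(Simplex V, ℂ)} (hf : f ∈ polySpace V 1) : secondDiff f = 0 := by
  refine Submodule.span_le (p := LinearMap.ker secondDiff).2 ?_ hf
  rintro _ ⟨y, rfl⟩
  have : mono y = lin (Pi.single (y 0) 1) := by simp [mono]
  change secondDiff _ = 0
  rw [this, secondDiff_apply]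
  refine Finset.sum_eq_zero fun a _ => Finset.sum_eq_zero fun b _ => ?_
  simp only [lin_midpoint]
  push_cast
  ring

theorem secondDiff_linSq (ψ : V → ℝ) :
    secondDiff (linSq ψ) = ((∑ x, ∑ y, (ψ x - ψ y) ^ 2 / 2 : ℝ) : ℂ) := by
  rw [secondDiff_apply]
  push_cast
  refine Finset.sum_congr rfl fun a _ => Finset.sum_congr rfl fun b _ => ?_
  simp only [linSq_apply, lin_midpoint]
  push_cast
  ring

namespace PolyEigenbasis

variable (E : PolyEigenbasis β μ) {π : V → ℝ}

/-- On the first level the eigenvalues of the generator are eigenvalues of the random walk. -/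
theorem gapRW_le_ev (hβ : Admissible β) (hsymm : SymmetricOnPolynomials β μ) (hπ : ∀ x, 0 < π x)
    (h1 : ∑ x, π x = 1) (hst : Stationary β π) {i} (hi : i.1 = 1) : gapRW β π ≤ E.ev i := by
  obtain ⟨k, l⟩ := i
  obtain rfl : k = 1 := hi
  obtain ⟨c, y, hy⟩ := E.exists_functional_mono_ne ⟨1, l⟩
  set Λ := E.functional c ⟨1, l⟩ with hΛ
  have hy' : Λ (lin (Pi.single (y 0) 1)) ≠ 0 := by
    have : mono y = lin (Pi.single (y 0) 1) := by
      refine (Fin.prod_univ_succ _).trans ?_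
      simp
    rwa [← this]
  -- the density with respect to `π` of `Λ` on linear forms; inserting it into the eigenvalue
  -- equation gives the Dirichlet form, without reversibility of the walk
  set φ : V → ℝ := fun x => Λ (lin (Pi.single x 1)) / π x with hφ
  have hlin (ψ : V → ℝ) : Λ (lin ψ) = ∑ x, π x * φ x * ψ x := by
    rw [functional_lin]
    refine Finset.sum_congr rfl fun x _ => ?_
    rw [hφ, mul_div_cancel₀ _ (hπ x).ne', mul_comm]
  have hgen (ψ : V → ℝ) : Λ (lin (walkGen β ψ)) = -(E.ev ⟨1, l⟩ * Λ (lin ψ)) := by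
    rw [hΛ, functional_apply, functional_apply,
      E.pairing_generator hsymm _ (mem_polynomials_iff.2 ⟨1, lin_mem_polySpace ψ⟩)
        (fun η => (generator_lin hβ ψ η).symm),
      mul_neg, Complex.neg_re, mul_left_comm, Complex.re_ofReal_mul]
  have hmean : ∑ x, π x * φ x = 0 := by
    have h0 : Λ (lin fun _ => 1) = 0 := by
      rw [lin_const]
      exact E.functional_of_lt c (j := 0) Nat.zero_lt_one
        (Submodule.smul_mem _ _ (one_mem_polySpace 0))
    rw [hlin] at h0
    simpa using h0
  have hform := hst.sum_mul_walkGen_self φ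
  rw [← hlin, hgen, hlin] at hform
  have hvar := rwVar_eq h1 φ
  have hsq : ∑ x, π x * φ x * φ x = ∑ x, π x * φ x ^ 2 :=
    Finset.sum_congr rfl fun x _ => by ring
  rw [hmean, ← hsq] at hvar
  have hpos : 0 < ∑ x, π x * φ x * φ x := by
    refine Finset.sum_pos' (fun x _ => ?_) ⟨y 0, Finset.mem_univ _, ?_⟩
    · rw [mul_assoc]
      exact mul_nonneg (hπ x).le (mul_self_nonneg _)
    · rw [mul_assoc]
      exact mul_pos (hπ _) (mul_self_pos.2 (div_ne_zero hy' (hπ _).ne'))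
  have hgap := gapRW_mul_rwVar_le (β := β) (fun x => (hπ x).le) φ
  refine le_of_mul_le_mul_right ?_ hpos
  rw [hvar] at hgap
  linarith

/-- The smallest eigenvalue of the levels `≥ 2` is attained on the second level. -/
theorem exists_level_two_min [Nontrivial V] (hβ : Admissible β)
    (hsymm : SymmetricOnPolynomials β μ) {U : (V → ℝ) → ℝ}
    (hU : IsLyapunov β U 0) :
    ∃ i₀, i₀.1 = 2 ∧ ∀ i, 2 ≤ i.1 → E.ev i₀ ≤ E.ev i := by
  let Θ (l : Fin (E.dim 2)) : C(Simplex V, ℂ) →ₗ[ℝ] ℝ :=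
    E.functional (secondDiff (E.poly ⟨2, l⟩)) ⟨2, l⟩
  have hΘ (ψ : V → ℝ) : ∑ l, Θ l (linSq ψ) = ∑ x, ∑ y, (ψ x - ψ y) ^ 2 / 2 := by
    have h := E.map_eq_sum_pairing (k := 1) (fun f hf => secondDiff_eq_zero hf) (linSq_mem ψ)
    rw [secondDiff_linSq] at h
    have := congrArg Complex.re h
    rw [Complex.ofReal_re, Complex.re_sum] at this
    exact this.symm
  have hS (ψ : V → ℝ) (hψ : ∃ x y, ψ x ≠ ψ y) : 0 < ∑ l, Θ l (linSq ψ) := by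
    obtain ⟨x, y, hxy⟩ := hψ
    rw [hΘ]
    have hnn (x y : V) : 0 ≤ (ψ x - ψ y) ^ 2 / 2 := by positivity
    refine Finset.sum_pos' (fun x _ => Finset.sum_nonneg fun y _ => hnn x y)
      ⟨x, Finset.mem_univ _, Finset.sum_pos' (fun y _ => hnn x y) ⟨y, Finset.mem_univ _, ?_⟩⟩
    have := sub_ne_zero.2 hxy
    positivity
  have : Nonempty (Fin (E.dim 2)) := by
    by_contra hne
    rw [not_nonempty_iff] at hne
    obtain ⟨x, y, hxy⟩ := exists_pair_ne V
    have := hS (Pi.single x 1) ⟨x, y, by simp [hxy.symm]⟩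
    simp at this
  obtain ⟨l₀, hl₀⟩ := Finite.exists_min fun l : Fin (E.dim 2) => E.ev ⟨2, l⟩
  refine ⟨⟨2, l₀⟩, rfl, fun i hi => le_of_forall_lt_imp_le_of_dense fun t ht => ?_⟩
  -- the second differences expand as a sum of functionals `Θ l`, whose resolvent form at `t` is
  -- a Lyapunov function of rate `t`
  rcases lt_or_ge t 0 with h | h
  · exact h.le.trans (E.ev_nonneg hβ hsymm i)
  · exact E.le_ev_of_isLyapunov hβ hsymm (isLyapunov_resolventForm (Θ := Θ) hβ hU
      (fun l f hf => E.functional_of_lt _ (Nat.lt_succ_self 1) hf)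
      (fun l χ => E.sum_integral_functional hβ hsymm _ ⟨2, l⟩ χ) hS h
      (fun l => ht.trans_le (hl₀ l))) hi

/-- There is a smallest eigenvalue of the levels `≥ 1`; it is attained on the first two levels. -/
theorem exists_level_one_min [Nontrivial V] (hβ : Admissible β)
    (hsymm : SymmetricOnPolynomials β μ) {U : (V → ℝ) → ℝ}
    (hU : IsLyapunov β U 0) :
    ∃ i₀, 1 ≤ i₀.1 ∧ ∀ i, 1 ≤ i.1 → E.ev i₀ ≤ E.ev i := by
  obtain ⟨i₂, hi₂, hmin⟩ := E.exists_level_two_min hβ hsymm hU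
  let ix : Option (Fin (E.dim 1)) → Σ k, Fin (E.dim k) := fun o => o.elim i₂ fun l => ⟨1, l⟩
  obtain ⟨o, ho⟩ := Finite.exists_min fun o => E.ev (ix o)
  refine ⟨ix o, ?_, fun i hi => ?_⟩
  · cases o with
    | none => exact hi₂.ge.trans' one_le_two
    | some l => exact le_rfl
  · rcases hi.eq_or_lt with h | h
    · obtain ⟨k, l⟩ := i
      obtain rfl : 1 = k := h
      exact ho (some l)
    · exact (ho none).trans (hmin i h)

/-- Rayleigh quotients of linear forms orthogonal to the constants bound the gap from above. -/
theorem mul_pairing_le (hsymm : SymmetricOnPolynomials β μ) {g : ℝ}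
    (hg : ∀ i, i.1 = 1 → g ≤ E.ev i) {f Lf : C(Simplex V, ℂ)} (hf : f ∈ polySpace V 1)
    (hLf : Lf ∈ polySpace V 1) (hLf' : ∀ η, Lf η = generator β f η) (h0 : pairing μ f 1 = 0) :
    g * (pairing μ f f).re ≤ -(pairing μ f Lf).re := by
  have hz (h) (hh : h ∈ polySpace V 0) : pairing μ f h = 0 := by
    obtain ⟨c, rfl⟩ := mem_polySpace_zero.1 hh
    rw [map_smul, h0, smul_zero]
  have hre (l : Fin (E.dim 1)) : pairing μ f (E.poly ⟨1, l⟩) * pairing μ (E.poly ⟨1, l⟩) f =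
      (Complex.normSq (pairing μ (E.poly ⟨1, l⟩) f) : ℂ) := by
    rw [← pairing_conj, Complex.normSq_eq_conj_mul_self]
  have h1 := congrArg Complex.re (E.map_eq_sum_pairing hz hf)
  have h2 := congrArg Complex.re (E.map_eq_sum_pairing hz hLf)
  simp only [E.pairing_generator hsymm _ (mem_polynomials_iff.2 ⟨1, hf⟩) hLf', mul_neg,
    mul_left_comm _ (E.ev _ : ℂ), hre, Complex.re_sum, Complex.neg_re,
    Complex.re_ofReal_mul, Complex.ofReal_re, Finset.sum_neg_distrib] at h1 h2
  rw [h1, h2, neg_neg, Finset.mul_sum]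
  exact Finset.sum_le_sum fun l _ =>
    mul_le_mul_of_nonneg_right (hg _ rfl) (Complex.normSq_nonneg _)

end PolyEigenbasis

end LowerBounds

/-! ### The first level in the Dirichlet case -/

section Dirichlet

variable {V : Type*} [DecidableEq V] [Fintype V] [Nonempty V] {β : V → V → Measure Square}
  {α : V → ℝ}

theorem integrable_dirichlet [IsFiniteMeasure (dirichlet α)] {h : Simplex V → ℝ}
    (hh : Continuous h) : Integrable h (dirichlet α) :=
  hh.integrable_of_hasCompactSupport (HasCompactSupport.of_compactSpace h)

theorem integral_lin_dirichlet (hα : ∀ x, 0 < α x) (ψ : V → ℝ) :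
    ∫ η, lin ψ η ∂(dirichlet α) = ((∑ x, α x / (∑ y, α y) * ψ x : ℝ) : ℂ) := by
  have := isProbabilityMeasure_dirichlet hα
  have hint (z : V) : Integrable (fun η : Simplex V => ψ z * η.1 z) (dirichlet α) :=
    integrable_dirichlet (continuous_const.mul (continuous_coord z))
  simp only [lin_apply]
  rw [integral_complex_ofReal, integral_finsetSum _ fun z _ => hint z]
  congr 1
  refine Finset.sum_congr rfl fun z _ => ?_
  rw [integral_const_mul, integral_dirichlet_coord hα, mul_comm]

/-- The mean of the Dirichlet distribution is invariant for the random walk. -/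
theorem stationary_dirichlet (hβ : Admissible β) (hα : ∀ x, 0 < α x)
    (hsymm : SymmetricOnPolynomials β (dirichlet α)) :
    Stationary β fun x => α x / ∑ y, α y := by
  intro ψ
  have := isProbabilityMeasure_dirichlet hα
  have h := hsymm.integral_generator (f := lin ψ) (isPolynomial_iff.2 ⟨1, lin_mem_polySpace ψ⟩)
  simp only [generator_lin hβ] at h
  rw [integral_lin_dirichlet hα] at h
  exact_mod_cast h

/-- Under the Dirichlet distribution, linear forms of mean zero have covariance proportional to that
of their coefficient functions under `π`. -/
theorem pairing_lin_dirichlet [IsFiniteMeasure (dirichlet α)] (hα : ∀ x, 0 < α x) {φ : V → ℝ}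
    (h0 : ∑ x, α x / (∑ y, α y) * φ x = 0) (φ' : V → ℝ) :
    pairing (dirichlet α) (lin φ) (lin φ') =
      (((∑ x, α x / (∑ y, α y) * φ x * φ' x) / (∑ y, α y + 1) : ℝ) : ℂ) := by
  have hs : 0 < ∑ x, α x := Finset.sum_pos (fun x _ => hα x) Finset.univ_nonempty
  have h0' : ∑ x, φ x * α x = 0 := by
    have : ∑ x, α x / (∑ y, α y) * φ x = (∑ x, φ x * α x) / ∑ y, α y := by
      rw [Finset.sum_div]
      exact Finset.sum_congr rfl fun x _ => by ring
    rw [this, div_eq_zero_iff] at h0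
    exact h0.resolve_right hs.ne'
  rw [pairing_apply]
  simp only [lin_apply, Complex.conj_ofReal, ← Complex.ofReal_mul]
  rw [integral_complex_ofReal]
  congr 1
  simp only [Finset.sum_mul_sum]
  have hint (y z : V) :
      Integrable (fun η : Simplex V => φ y * η.1 y * (φ' z * η.1 z)) (dirichlet α) :=
    integrable_dirichlet ((continuous_const.mul (continuous_coord y)).mul
      (continuous_const.mul (continuous_coord z)))
  rw [integral_finsetSum _ fun y _ => integrable_finsetSum _ fun z _ => hint y z]
  have h1 (y : V) : ∫ η, ∑ z, φ y * η.1 y * (φ' z * η.1 z) ∂(dirichlet α) =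
      (φ y * α y * (∑ z, φ' z * α z) + φ y * φ' y * α y) /
        ((∑ x, α x) * (∑ x, α x + 1)) := by
    rw [integral_finsetSum _ fun z _ => hint y z]
    have h2 (z : V) : ∫ η, φ y * η.1 y * (φ' z * η.1 z) ∂(dirichlet α) =
        (φ y * α y * (φ' z * α z) + if y = z then φ y * φ' z * α y else 0) /
          ((∑ x, α x) * (∑ x, α x + 1)) := by
      have h3 (η : Simplex V) :
          φ y * η.1 y * (φ' z * η.1 z) = φ y * φ' z * (η.1 y * η.1 z) := by ring
      simp only [h3]
      rw [integral_const_mul, integral_dirichlet_coord_mul hα, ← mul_div_assoc]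
      congr 1
      split_ifs <;> ring
    simp only [h2]
    rw [← Finset.sum_div, Finset.sum_add_distrib, Finset.sum_ite_eq, if_pos (Finset.mem_univ _),
      Finset.mul_sum]
  simp only [h1]
  rw [← Finset.sum_div, Finset.sum_add_distrib, ← Finset.sum_mul, h0', zero_mul, zero_add,
    ← div_div]
  congr 1
  rw [Finset.sum_div]
  exact Finset.sum_congr rfl fun x _ => by ring

/-- Linear forms as test functions in the Rayleigh quotient. -/
theorem PolyEigenbasis.le_gapRW [Nontrivial V] [IsFiniteMeasure (dirichlet α)]
    (E : PolyEigenbasis β (dirichlet α)) (hβ : Admissible β) (hα : ∀ x, 0 < α x)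
    (hsymm : SymmetricOnPolynomials β (dirichlet α)) {g : ℝ}
    (hg : ∀ i, i.1 = 1 → g ≤ E.ev i) : g ≤ gapRW β fun x => α x / ∑ y, α y := by
  have hs : 0 < ∑ x, α x := Finset.sum_pos (fun x _ => hα x) Finset.univ_nonempty
  have hst := stationary_dirichlet hβ hα hsymm
  set π : V → ℝ := fun x => α x / ∑ y, α y with hπdef
  have hπ (x : V) : 0 < π x := div_pos (hα x) hs
  have h1 : ∑ x, π x = 1 := by
    rw [← Finset.sum_div]
    exact div_self hs.ne'
  refine le_csInf ?_ ?_
  · obtain ⟨x, y, hxy⟩ := exists_pair_ne V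
    have hpos : 0 < rwVar π (Pi.single x 1) := rwVar_pos hπ ⟨x, y, by simp [hxy.symm]⟩
    refine ⟨_, (Real.sqrt (rwVar π (Pi.single x 1)))⁻¹ • Pi.single x 1, ?_, rfl⟩
    rw [rwVar_smul, inv_pow, Real.sq_sqrt hpos.le, inv_mul_cancel₀ hpos.ne']
  · rintro _ ⟨ψ, hψ, rfl⟩
    set m := ∑ y, π y * ψ y with hm
    set φ : V → ℝ := fun x => ψ x - m with hφ
    have hmean : ∑ x, π x * φ x = 0 := by
      simp only [hφ, mul_sub, Finset.sum_sub_distrib, ← Finset.sum_mul, h1, one_mul, ← hm,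
        sub_self]
    have hform : rwForm β π ψ = rwForm β π φ := by
      simp only [rwForm, hφ, sub_sub_sub_cancel_right]
    have hvar : ∑ x, π x * φ x * φ x = 1 := by
      rw [← hψ, rwVar]
      exact Finset.sum_congr rfl fun x _ => by ring
    have hone : pairing (dirichlet α) (lin φ) 1 = 0 := by
      have h2 := pairing_lin_dirichlet hα hmean fun _ => 1
      simp only [mul_one] at h2
      rw [lin_const, Complex.ofReal_one, one_smul] at h2
      rw [h2]
      simp only [π] at hmean
      rw [hmean]
      simp
    have hmain := E.mul_pairing_le hsymm hg (lin_mem_polySpace φ)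
      (lin_mem_polySpace (walkGen β φ)) (fun η => (generator_lin hβ φ η).symm) hone
    rw [pairing_lin_dirichlet hα hmean, pairing_lin_dirichlet hα hmean, Complex.ofReal_re,
      Complex.ofReal_re] at hmain
    change g * ((∑ x, π x * φ x * φ x) / _) ≤ -((∑ x, π x * φ x * walkGen β φ x) / _) at hmain
    rw [hvar, hst.sum_mul_walkGen_self, neg_div, neg_neg, mul_one_div, ← hform] at hmain
    exact (div_le_div_iff_of_pos_right (by positivity)).1 hmain

end Dirichlet

/-! ### The closure of the generator -/

section Closure

variable {V : Type*} [DecidableEq V] [Fintype V] {β : V → V → Measure Square}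
  {μ : Measure (Simplex V)} [IsFiniteMeasure μ]

theorem mem_polynomialGraph {L : C(Simplex V, ℂ) →ₗ[ℂ] C(Simplex V, ℂ)}
    (hL : ∀ f ∈ polynomials V, ∀ η, L f η = generator β f η) {x : Lp ℂ 2 μ × Lp ℂ 2 μ} :
    x ∈ polynomialGraph β μ ↔ ∃ f ∈ polynomials V,
      x = (ContinuousMap.toLp 2 μ ℂ f, ContinuousMap.toLp 2 μ ℂ (-L f)) := by
  have hcoe (f : C(Simplex V, ℂ)) (hf : f ∈ polynomials V) :
      ⇑(-L f) = fun η => -generator β f η := by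
    ext η
    rw [ContinuousMap.neg_apply, hL f hf]
  constructor
  · rintro ⟨f, hf, h1, h2⟩
    have hf' : (⟨f, hf.continuous⟩ : C(Simplex V, ℂ)) ∈ polynomials V := mem_polynomials.2 hf
    refine ⟨_, hf', Prod.ext (Lp.ext ?_) (Lp.ext ?_)⟩
    · exact h1.trans (ContinuousMap.coeFn_toLp (p := 2) (𝕜 := ℂ) μ ⟨f, hf.continuous⟩).symm
    · have h3 := ContinuousMap.coeFn_toLp (p := 2) (𝕜 := ℂ) μ (-L ⟨f, hf.continuous⟩)
      rw [hcoe _ hf'] at h3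
      exact h2.trans h3.symm
  · rintro ⟨f, hf, rfl⟩
    refine ⟨f, mem_polynomials.1 hf, ContinuousMap.coeFn_toLp μ f, ?_⟩
    rw [← hcoe f hf]
    exact ContinuousMap.coeFn_toLp μ _

/-- The closed generator is the diagonal operator in the eigenbasis. -/
theorem PolyEigenbasis.diagGraph_eq_closure (E : PolyEigenbasis β μ) (hβ : Admissible β)
    (hsymm : SymmetricOnPolynomials β μ) :
    (diagGraph E.basis E.ev : Set (Lp ℂ 2 μ × Lp ℂ 2 μ)) = closure (polynomialGraph β μ) := by
  obtain ⟨L, hL⟩ := exists_generator_linearMap hβ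
  let J : C(Simplex V, ℂ) →ₗ[ℂ] Lp ℂ 2 μ :=
    (ContinuousMap.toLp 2 μ ℂ : C(Simplex V, ℂ) →L[ℂ] Lp ℂ 2 μ).toLinearMap
  refine Set.Subset.antisymm (diagGraph_subset_closure.trans (closure_mono ?_))
    (closure_minimal ?_ isClosed_diagGraph)
  · have h : Submodule.span ℂ (Set.range fun i => (E.basis i, (E.ev i : ℂ) • E.basis i)) ≤
        (polynomials V).map (J.prod (J ∘ₗ (-L))) := by
      refine Submodule.span_le.2 ?_
      rintro _ ⟨i, rfl⟩
      have hmem : E.poly i ∈ polynomials V := mem_polynomials_iff.2 ⟨_, E.mem i⟩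
      refine ⟨E.poly i, hmem, Prod.ext (E.toLp_poly i) ?_⟩
      have hLi : (-L) (E.poly i) = (E.ev i : ℂ) • E.poly i := by
        ext η
        rw [LinearMap.neg_apply, ContinuousMap.neg_apply, hL _ hmem, E.generator_poly, neg_neg]
        rfl
      change J ((-L) (E.poly i)) = (E.ev i : ℂ) • E.basis i
      rw [hLi, map_smul]
      exact congrArg _ (E.toLp_poly i)
    intro x hx
    obtain ⟨f, hf, rfl⟩ := h hx
    exact (mem_polynomialGraph hL).2 ⟨f, hf, rfl⟩
  · intro x hx
    obtain ⟨f, hf, rfl⟩ := (mem_polynomialGraph hL).1 hx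
    refine mem_diagGraph.2 fun i => ?_
    rw [← E.toLp_poly, ← pairing_eq_inner, ← pairing_eq_inner, map_neg,
      E.pairing_generator hsymm i hf (hL f hf), neg_neg]

end Closure

end ExchangeModel

end

open ExchangeModel
theorem mainTheorem2 {V : Type*} [Fintype V] [DecidableEq V] [Nontrivial V]
    (β : V → V → Measure Square) (hβ : Admissible β) (hirr : Irreducible₂ β)
    (α : V → ℝ) (hα : ∀ x, 0 < α x)
    (hsymm : SymmetricOnPolynomials β (dirichlet α)) :
    -- the random walk has a unique invariant probability vector
    ∃ π : V → ℝ, IsInvariantVector β π ∧ (∀ π' : V → ℝ, IsInvariantVector β π' → π' = π) ∧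
    -- the closure of the graph is the graph of a self-adjoint operator `A`
    ∃ A : Lp ℂ 2 (dirichlet α) →ₗ.[ℂ] Lp ℂ 2 (dirichlet α),
      (A.graph : Set (Lp ℂ 2 (dirichlet α) × Lp ℂ 2 (dirichlet α)))
          = closure (polynomialGraph β (dirichlet α)) ∧
      IsSelfAdjoint A ∧
      -- the spectrum is real and nonnegative
      (∀ z ∈ unboundedSpectrum A, z.im = 0 ∧ 0 ≤ z.re) ∧
      -- and pure-point, with a complete orthonormal system of polynomial eigenfunctions
      (∃ (ι : Type) (b : HilbertBasis ι ℂ (Lp ℂ 2 (dirichlet α))) (f : ι → Simplex V → ℂ)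
          (ev : ι → ℝ),
        (∀ i, IsPolynomial (f i) ∧ b i =ᵐ[dirichlet α] f i ∧ 0 ≤ ev i ∧
          ∀ η, -generator β (f i) η = (ev i : ℂ) * f i η) ∧
        eigenvalues A = Set.range (fun i => (ev i : ℂ)) ∧
        unboundedSpectrum A = closure (Set.range fun i => (ev i : ℂ)) ∧
        -- the smallest eigenvalue is `0`, and it is simple
        ∃! i, ev i = 0) ∧
      -- the second smallest eigenvalue exists and satisfies the two bounds
      ∃ gap : ℝ, IsLeast {t : ℝ | 0 < t ∧ (t : ℂ) ∈ eigenvalues A} gap ∧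
        min 1 (gammaConst β π) * gapRW β π ≤ gap ∧ gap ≤ gapRW β π := by
  have := isProbabilityMeasure_dirichlet hα
  have := isOpenPosMeasure_dirichlet hα
  obtain ⟨E⟩ := exists_polyEigenbasis hβ hsymm
  have hs : 0 < ∑ x, α x := Finset.sum_pos (fun x _ => hα x) Finset.univ_nonempty
  let π : V → ℝ := fun x => α x / ∑ y, α y
  have hπ (x : V) : 0 < π x := div_pos (hα x) hs
  have hπ0 (x : V) : 0 ≤ π x := (hπ x).le
  have h1 : ∑ x, π x = 1 := by
    rw [← Finset.sum_div]
    exact div_self hs.ne'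
  have hst : Stationary β π := stationary_dirichlet hβ hα hsymm
  have hinv : IsInvariantVector β π := (isInvariantVector_iff hβ).2 ⟨hπ0, h1, hst⟩
  have hγ : 0 ≤ gammaConst β π := gammaConst_nonneg hπ0
  have hgap : 0 ≤ gapRW β π := gapRW_nonneg hπ0
  have hW := isLyapunov_rwVar hβ hπ h1 hst
  -- for the existence of the gap only the monotonicity of the variance matters
  have hW0 : IsLyapunov β (rwVar π) 0 :=
    { hW with
      sum_integral_le := fun ψ => (hW.sum_integral_le ψ).trans <| neg_le_neg <|
        mul_le_mul_of_nonneg_right (mul_nonneg hγ hgap) (rwVar_nonneg hπ0 ψ) }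
  have hev := E.ev_nonneg hβ hsymm
  obtain ⟨i₀, hi₀, hmin⟩ := E.exists_level_one_min hβ hsymm hW0
  refine ⟨π, hinv, fun π' h => isInvariantVector_unique hβ hirr hπ hinv h,
    diagOp E.basis E.ev, ?_, isSelfAdjoint_diagOp, fun z hz => ?_,
    ⟨_, E.basis, fun i => E.poly i, E.ev, fun i => ⟨E.isPolynomial_poly i, ?_, hev i, fun η => ?_⟩,
      eigenvalues_diagOp, unboundedSpectrum_diagOp, E.existsUnique_ev_eq_zero hβ hirr hsymm⟩,
    E.ev i₀, ⟨⟨E.ev_pos hβ hirr hsymm hi₀, ?_⟩, ?_⟩, ?_,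
    E.le_gapRW hβ hα hsymm fun i hi => hmin i hi.ge⟩
  · rw [diagOp_graph]
    exact E.diagGraph_eq_closure hβ hsymm
  · rw [unboundedSpectrum_diagOp] at hz
    have hclosed : IsClosed {z : ℂ | z.im = 0 ∧ 0 ≤ z.re} :=
      (isClosed_eq Complex.continuous_im continuous_const).inter
        (isClosed_le continuous_const Complex.continuous_re)
    refine closure_minimal ?_ hclosed hz
    rintro _ ⟨i, rfl⟩
    exact ⟨Complex.ofReal_im _, hev i⟩
  · rw [← E.toLp_poly]
    exact ContinuousMap.coeFn_toLp _ _
  · rw [E.generator_poly, neg_neg]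
  · rw [eigenvalues_diagOp]
    exact ⟨i₀, rfl⟩
  · rintro t ⟨ht, hmem⟩
    rw [eigenvalues_diagOp] at hmem
    obtain ⟨i, hi⟩ := hmem
    obtain rfl : E.ev i = t := Complex.ofReal_injective hi
    refine hmin i (Nat.one_le_iff_ne_zero.2 fun h => ?_)
    exact ht.ne' (E.ev_eq_zero_of_level h)
  -- the gap is attained either on linear polynomials or in higher degree
  · rcases hi₀.eq_or_lt with h | h
    · exact (mul_le_of_le_one_left hgap (min_le_left _ _)).trans
        (E.gapRW_le_ev hβ hsymm hπ h1 hst h.symm)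
    · exact (mul_le_mul_of_nonneg_right (min_le_right _ _) hgap).trans
        (E.le_ev_of_isLyapunov hβ hsymm hW h)
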